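/- **Setting.** For $L\ge 0$ let $\mathcal H=\Gamma(\mathcal H_0)$ be the fermionic Fock space over $\mathcal H_0=\mathbb C^L$, with annihilation operators $c_1,\dots,c_L$, Majorana operators $\gamma_i=c_i+c_i^*$, $\gamma_{i+L}=-i(c_i-c_i^*)$ $(1\le i\le L)$ and number operator $N=\sum_i c_i^*c_i$. Let $\mathcal Y=\mathcal H_0\oplus\overline{\mathcal H_0}$ be the phase space, with field operator $\varphi(u\oplus \bar v)=c_u^*+c_v$ and antilinear involution $\xi(u\oplus\bar v)=v\oplus\bar u$. A *Bogoliubov transform* is a unitary $U$ of $\mathcal Y$ commuting with $\xi$; a unitary $V$ of $\mathcal H$ *implements* $U$ if $\varphi(Uy)=V\varphi(y)V^*$ for all $y\in\mathcal Y$. A *Gaussian state* is a state $e^{-\beta H}/\operatorname{Tr}e^{-\beta H}$ with $\beta\in\mathbb R$ and $H$ a self-adjoint operator of the form $\sum_{i,j}T_{ij}\gamma_i\gamma_j$; a *quasi-free state* is a limit of Gaussian states. A *quasi-free fermionic repeated interaction process* on $\mathcal H=\mathcal H_S$ is given by a fermionic space $\mathcal H_B$ with $K$ modes, a quasi-free state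 $\omega$ on $\mathcal H_B$, real antisymmetric matrices $R_S$ ($2L\times 2L$), $R_B$ ($2K\times 2K$) and a real $2L\times 2K$ matrix $W$. Put $$H_S=\tfrac12\sum_{i,j} i(R_S)_{ij}\gamma^S_i\gamma^S_j,\qquad H_B=\tfrac12\sum_{i,j} i(R_B)_{ij}\gamma^B_i\gamma^B_j,\qquad V_{\rm int}=\sum_{i,j} iW_{ij}\,\gamma_i^S\gamma_j^B,$$ as operators on $\mathcal H_S\otimes\mathcal H_B$, where either $\gamma^S_i$ stands for $\gamma_i^S\otimes 1$ and $\gamma^B_j$ for $(-1)^{N_S}\otimes\gamma^B_j$ (identification $E_{SB}$), or $\gamma^S_i$ stands for $\gamma_i^S\otimes(-1)^{N_B}$ and $\gamma_j^B$ for $1\otimes\gamma_j^B$ (identification $E_{BS}$). For $\tau>0$ let $$L_\tau(\rho)=\operatorname{Tr}_{\mathcal H_B}\!\Big(e^{-i\tau(H_S+\tau^{-1/2}V_{\rm int}+H_B)}(\rho\otimes\omega)\,e^{i\tau(H_S+\tau^{-1/2}V_{\rm int}+H_B)}\Big).$$ The *continuous-time limit* of the process is the family $\Lambda^t=\lim_{\tau\to0^+}L_\tau^{\lfloor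 t/\tau\rfloor}$, $t\ge 0$. A *stationary state* is a state $\sigma$ with $\Lambda^t\sigma=\sigma$ for all $t\ge0$. **Proposition.** Let $(\Lambda^t)_{t\ge 0}$ be the continuous-time limit of a quasi-free fermionic repeated interaction process on $\mathcal H=\Gamma(\mathcal H_0)$, with either of the two identifications. Let $\sigma$ be a stationary state with maximal support $\mathcal S\subset\mathcal H$, i.e. the support of every stationary state is contained in $\mathcal S$. Then there exist a Bogoliubov transform $U$ of $\mathcal Y$, implemented by a unitary $V$ of $\mathcal H$, and a splitting $\mathcal H_0=\mathcal H_A^0\oplus\mathcal H_C^0$ (which can be taken to be $\mathbb C^L=\mathbb C^a\oplus\mathbb C^c$, $a+c=L$, the spans of the first $a$ and of the last $c$ basis vectors) such that, identifying $\mathcal H$ with $\Gamma(\mathcal H_A^0)\otimes\Gamma(\mathcal H_C^0)$ and writing $\Omega_A$ for the vacuum of $\Gamma(\mathcal H_A^0)$, $$V\mathcal S=\Omega_A\otimes\Gamma(\mathcal H_C^0).$$ Moreover, the semigroup $\rho\mapsto V\Lambda^t(V^*\rho V)V^*$ restricts to $\Gamma(\mathcal H_C^0)$: there are linear maps $\Lambda_C^t$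 on $\mathcal B(\Gamma(\mathcal H_C^0))$ such that $$V\Lambda^t\big(V^*(|\Omega_A\rangle\langle\Omega_A|\otimes\rho)V\big)V^*=|\Omega_A\rangle\langle\Omega_A|\otimes\Lambda_C^t(\rho)\qquad\text{for all } t\ge0,\ \rho\in\mathcal B(\Gamma(\mathcal H_C^0)),$$ and $(\Lambda_C^t)_{t\ge0}$ is the continuous-time limit of a quasi-free fermionic repeated interaction process on $\Gamma(\mathcal H_C^0)$ (with the same choice of identification). -/

import Mathlib

open Filter Topology
open scoped Matrix Kronecker ComplexOrder

namespace Fermion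

noncomputable section

/-! ### Fermionic Fock space over `ℂ^L`

The one-particle space is `H₀ = ℂ^L` with its orthonormal basis `|1⟩, …, |L⟩`.  The fermionic space
`Γ(H₀)` is given in its occupation-number orthonormal basis `|u₁, …, u_L⟩`, `u ∈ {0,1}^L`
(`true` is `1`): vectors are functions `Occ L → ℂ` with the standard scalar product and operators
are matrices. -/

/-- Occupation numbers of `L` modes. -/
abbrev Occ (L : ℕ) : Type := Fin L → Bool

/-- Operators on the fermionic space `Γ(ℂ^L)`. -/
abbrev Op (L : ℕ) : Type := Matrix (Occ L) (Occ L) ℂ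

/-- Annihilation operator:
`c_i |u⟩ = δ_{u_i,1} ∏_{k<i} (-1)^{u_k} |u_1, …, u_i - 1, …, u_L⟩`. -/
def annih {L : ℕ} (i : Fin L) : Op L :=
  Matrix.of fun w u =>
    if u i = true ∧ w = Function.update u i false then
      ∏ k ∈ Finset.univ.filter (fun k => k < i), (if u k = true then (-1 : ℂ) else 1)
    else 0

/-- Creation operator `c_i^*`. -/
def creat {L : ℕ} (i : Fin L) : Op L := (annih i)ᴴ

/-- The parity operator `(-1)^N`, where `N = ∑ c_i^* c_i` is the number operator. -/
def parity (L : ℕ) : Op L :=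
  Matrix.diagonal fun u => ∏ i, (if u i = true then (-1 : ℂ) else 1)

/-- The Majorana operators, `γ_i = c_i + c_i^*` (at `Sum.inl i`) and
`γ_{i+L} = -i (c_i - c_i^*)` (at `Sum.inr i`). -/
def majorana {L : ℕ} : Fin L ⊕ Fin L → Op L
  | Sum.inl i => annih i + creat i
  | Sum.inr i => (-Complex.I) • (annih i - creat i)

/-! ### Phase space and Bogoliubov transforms -/

/-- The field operator `φ` on the phase space `Y = H₀ ⊕ conj H₀`, in the creation/annihilation
basis, i.e. `φ(e_i) = c_i^*` and `φ(e_{i+L}) = c_i`. -/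
def field {L : ℕ} (y : Fin L ⊕ Fin L → ℂ) : Op L :=
  ∑ i, y (Sum.inl i) • creat i + ∑ i, y (Sum.inr i) • annih i

/-- The antilinear involution `ξ(u ⊕ s(v)) = v ⊕ s(u)` of the phase space. As `s(v)` has coordinates
`conj v`, it reads `(x, y) ↦ (conj y, conj x)` in the creation/annihilation basis. -/
def xi {L : ℕ} (y : Fin L ⊕ Fin L → ℂ) : Fin L ⊕ Fin L → ℂ :=
  fun k => star (y k.swap)

/-- Bogoliubov transform: a unitary of the phase space (given by its matrix in the
creation/annihilation basis, which is orthonormal) commuting with `ξ`. -/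
def IsBogoliubov {L : ℕ} (U : Matrix (Fin L ⊕ Fin L) (Fin L ⊕ Fin L) ℂ) : Prop :=
  U ∈ Matrix.unitaryGroup (Fin L ⊕ Fin L) ℂ ∧ ∀ y, U *ᵥ xi y = xi (U *ᵥ y)

/-- The unitary `V` of the fermionic space implements the transform `U` of the phase space:
`φ(U y) = V φ(y) V^*`. -/
def Implements {L : ℕ} (V : Op L) (U : Matrix (Fin L ⊕ Fin L) (Fin L ⊕ Fin L) ℂ) : Prop :=
  V ∈ Matrix.unitaryGroup (Occ L) ℂ ∧ ∀ y, field (U *ᵥ y) = V * field y * Vᴴ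

/-! ### States -/

/-- Density matrices. -/
def IsState {n : Type} [Fintype n] (ρ : Matrix n n ℂ) : Prop :=
  ρ.PosSemidef ∧ ρ.trace = 1

/-- The support of a state, which is its range since a state is self-adjoint. -/
def supp {n : Type} [Fintype n] (ρ : Matrix n n ℂ) : Submodule ℂ (n → ℂ) :=
  LinearMap.range ρ.mulVecLin

/-- Quadratic Hamiltonian: a self-adjoint operator of the form `∑ T_{ij} γ_i γ_j`. -/
def IsQuadraticHamiltonian {L : ℕ} (H : Op L) : Prop :=
  H.IsHermitian ∧ ∃ T : Matrix (Fin L ⊕ Fin L) (Fin L ⊕ Fin L) ℂ,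
    H = ∑ i, ∑ j, T i j • (majorana i * majorana j)

/-- Gaussian state `exp(-βH) / Z` with `H` a quadratic Hamiltonian. -/
def IsGaussian {L : ℕ} (ρ : Op L) : Prop :=
  ∃ (β : ℝ) (H : Op L), IsQuadraticHamiltonian H ∧
    ρ = (NormedSpace.exp (-(β : ℂ) • H)).trace⁻¹ • NormedSpace.exp (-(β : ℂ) • H)

/-- Quasi-free states are the limits of Gaussian states. -/
def IsQuasiFree {L : ℕ} (ω : Op L) : Prop :=
  ω ∈ closure {ρ : Op L | IsGaussian ρ}

/-! ### Repeated interaction processes and their continuous-time limit -/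

section General

variable {S B : Type} [Fintype S] [DecidableEq S] [Fintype B] [DecidableEq B]

/-- Partial trace over the second factor. -/
def partialTr (X : Matrix (S × B) (S × B) ℂ) : Matrix S S ℂ :=
  Matrix.of fun s s' => ∑ b, X (s, b) (s', b)

/-- The Hamiltonian `H_S + λ V + H_B` of one interaction of duration `τ`, with `λ = 1/√τ`. -/
def totalHam (HS : Matrix S S ℂ) (HB : Matrix B B ℂ) (V : Matrix (S × B) (S × B) ℂ) (τ : ℝ) :
    Matrix (S × B) (S × B) ℂ :=
  HS ⊗ₖ (1 : Matrix B B ℂ) + ((1 / Real.sqrt τ : ℝ) : ℂ) • V + (1 : Matrix S S ℂ) ⊗ₖ HB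

/-- One interaction:
`L_τ(ρ) = Tr_B (e^{-iτ(H_S+λV+H_B)} (ρ ⊗ ω) e^{iτ(H_S+λV+H_B)})`. -/
def interactionStep (HS : Matrix S S ℂ) (HB : Matrix B B ℂ) (V : Matrix (S × B) (S × B) ℂ)
    (ω : Matrix B B ℂ) (τ : ℝ) (ρ : Matrix S S ℂ) : Matrix S S ℂ :=
  partialTr (NormedSpace.exp ((-(Complex.I * (τ : ℂ))) • totalHam HS HB V τ) * (ρ ⊗ₖ ω) *
    NormedSpace.exp ((Complex.I * (τ : ℂ)) • totalHam HS HB V τ))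

/-- `(Λ^t)_{t ≥ 0}` is the continuous-time limit of the repeated interaction process:
`Λ^t = lim_{τ → 0⁺} L_τ^{⌊t/τ⌋}` for all `t ≥ 0`. -/
def IsContinuousTimeLimit (HS : Matrix S S ℂ) (HB : Matrix B B ℂ)
    (V : Matrix (S × B) (S × B) ℂ) (ω : Matrix B B ℂ)
    (Λ : ℝ → Matrix S S ℂ →ₗ[ℂ] Matrix S S ℂ) : Prop :=
  ∀ t : ℝ, 0 ≤ t → ∀ ρ : Matrix S S ℂ,
    Tendsto (fun τ : ℝ => (interactionStep HS HB V ω τ)^[⌊t / τ⌋₊] ρ) (𝓝[>] 0) (𝓝 (Λ t ρ))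

end General

/-! ### Quasi-free fermionic repeated interaction processes -/

/-- The two identifications of `B(Γ(H_S⁰ ⊕ H_B⁰))` with `B(H_S ⊗ H_B)`. -/
inductive TensorIso : Type
  | SB
  | BS

/-- The Majorana operators of the system, as operators of `H_S ⊗ H_B`:
`E_SB(γ^S) = γ^S ⊗ 1` and `E_BS(γ^S) = γ^S ⊗ (-1)^{N_B}`. -/
def majoranaS {L K : ℕ} (E : TensorIso) (i : Fin L ⊕ Fin L) :
    Matrix (Occ L × Occ K) (Occ L × Occ K) ℂ :=
  match E with
  | TensorIso.SB => majorana i ⊗ₖ (1 : Op K)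
  | TensorIso.BS => majorana i ⊗ₖ parity K

/-- The Majorana operators of the bath, as operators of `H_S ⊗ H_B`:
`E_SB(γ^B) = (-1)^{N_S} ⊗ γ^B` and `E_BS(γ^B) = 1 ⊗ γ^B`. -/
def majoranaB {L K : ℕ} (E : TensorIso) (j : Fin K ⊕ Fin K) :
    Matrix (Occ L × Occ K) (Occ L × Occ K) ℂ :=
  match E with
  | TensorIso.SB => parity L ⊗ₖ majorana j
  | TensorIso.BS => (1 : Op L) ⊗ₖ majorana j

/-- The Hamiltonian `½ F^* T F = ½ ∑ T_{ij} γ_i γ_j` with `T = iR`. -/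
def quadHam {L : ℕ} (R : Matrix (Fin L ⊕ Fin L) (Fin L ⊕ Fin L) ℝ) : Op L :=
  (1 / 2 : ℂ) • ∑ i, ∑ j, (Complex.I * (R i j : ℂ)) • (majorana i * majorana j)

/-- The interaction `F_S^* Θ F_B = ∑ Θ_{ij} γ^S_i γ^B_j` with `Θ = iW`. -/
def interaction {L K : ℕ} (E : TensorIso) (W : Matrix (Fin L ⊕ Fin L) (Fin K ⊕ Fin K) ℝ) :
    Matrix (Occ L × Occ K) (Occ L × Occ K) ℂ :=
  ∑ i, ∑ j, (Complex.I * (W i j : ℂ)) • (majoranaS E i * majoranaB E j)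

/-- Data of a fermionic repeated interaction process with quadratic Hamiltonians and quasi-free
bath state, on a system with `L` modes and bath elements with `K` modes. In the Majorana basis
`T_S = i R_S`, `T_B = i R_B` with `R_S`, `R_B` real antisymmetric and `Θ = i W` with `W` real. -/
structure RepeatedInteraction (L K : ℕ) where
  RS : Matrix (Fin L ⊕ Fin L) (Fin L ⊕ Fin L) ℝ
  RB : Matrix (Fin K ⊕ Fin K) (Fin K ⊕ Fin K) ℝ
  W : Matrix (Fin L ⊕ Fin L) (Fin K ⊕ Fin K) ℝ
  ω : Op K
  antisymm_RS : RSᵀ = -RS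
  antisymm_RB : RBᵀ = -RB
  quasiFree : IsQuasiFree ω

/-- `(Λ^t)_{t ≥ 0}` is the continuous-time limit of the quasi-free fermionic repeated interaction
process `p`, the identification `E` being used for `H_S ⊗ H_B`. -/
def RepeatedInteraction.IsLimit {L K : ℕ} (p : RepeatedInteraction L K) (E : TensorIso)
    (Λ : ℝ → Op L →ₗ[ℂ] Op L) : Prop :=
  IsContinuousTimeLimit (quadHam p.RS) (quadHam p.RB) (interaction E p.W) p.ω Λ

/-- Stationary states of a semigroup. -/
def IsStationary {L : ℕ} (Λ : ℝ → Op L →ₗ[ℂ] Op L) (σ : Op L) : Prop :=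
  IsState σ ∧ ∀ t : ℝ, 0 ≤ t → Λ t σ = σ

/-! ### Splitting `H₀ = ℂ^a ⊕ ℂ^c` -/

/-- Identification `|u_1, …, u_L⟩ ↔ |u_1, …, u_a⟩ ⊗ |u_{a+1}, …, u_L⟩` of `Γ(ℂ^L)` with
`Γ(ℂ^a) ⊗ Γ(ℂ^c)`, for the splitting of `ℂ^L` into the spans of its first `a` and its last `c`
basis vectors `H_A⁰ = ℂ^a` and `H_C⁰ = ℂ^c`. -/
def occSplit {L a c : ℕ} (h : a + c = L) : Occ L ≃ Occ a × Occ c :=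
  (Equiv.arrowCongr (finCongr h.symm) (Equiv.refl Bool)).trans (Fin.appendEquiv a c).symm

/-- The empty state `|Ω⟩ = |0, …, 0⟩`. -/
def vac (a : ℕ) : Occ a → ℂ := Pi.single (fun _ => false) 1

/-- The projection `|Ω⟩⟨Ω|`. -/
def vacProj (a : ℕ) : Op a := Matrix.vecMulVec (vac a) (star (vac a))

/-- `ψ ↦ |Ω_A⟩ ⊗ ψ`, from `Γ(ℂ^c)` to `Γ(ℂ^L) = Γ(ℂ^a) ⊗ Γ(ℂ^c)`. -/
def vacTensor {L a c : ℕ} (h : a + c = L) : (Occ c → ℂ) →ₗ[ℂ] (Occ L → ℂ) where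
  toFun ψ := fun u => vac a (occSplit h u).1 * ψ (occSplit h u).2
  map_add' x y := by funext u; simp [mul_add]
  map_smul' r x := by funext u; simp [mul_left_comm]

/-- `ρ ↦ |Ω_A⟩⟨Ω_A| ⊗ ρ`, from operators on `Γ(ℂ^c)` to operators on
`Γ(ℂ^L) = Γ(ℂ^a) ⊗ Γ(ℂ^c)`. -/
def vacTensorOp {L a c : ℕ} (h : a + c = L) (ρ : Op c) : Op L :=
  (vacProj a ⊗ₖ ρ).submatrix (occSplit h) (occSplit h)

end

end Fermion

/-! Put `s = √τ`. One interaction is conjugation by `exp(-i(sV + s²(H_S + H_B)))`. The term of order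
`s` vanishes after the partial trace, because the bath state is even and `V` is odd in the bath.
Hence `L_τ = 1 + τG + o(τ)` and `Λ^t = exp(tG)`, where `G` is a Lindblad generator with the
quadratic Hamiltonian `H_S` and jumps `ℓ_b` linear in the Majorana operators, multiplied by the
parity for `E_SB` (`isLimit_semigroup`). Stationarity of `σ` becomes `G σ = 0`. Of the bath state
only positivity, trace one and evenness enter.

The two-point function of `σ` is diagonalized by a real orthogonal map of the Majorana basis,
implemented by a unitary `V` (`exists_diagonalization`, `exists_implementer`). Each normal mode has
an occupation in `[0, 1/2]`. The empty modes form `A`, the others `C`, and `VσV^*` is annihilated by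
exactly the field operators that annihilate `Ω_A ⊗ Γ(ℂ^c)`.

This subspace is invariant (`lindblad_vacMat`). If a field operator `x` annihilates a stationary
`σ`, then sandwiching `Gσ = 0` between `x` and `x^*` gives `x ℓ_b σ = 0`, so the scalar `{x, ℓ_b}`
is zero. Next, `x` times the effective Hamiltonian annihilates `σ`, so the commutator of the two,
again a field operator, annihilates `σ` and therefore the whole subspace. The compression keeps the
quadratic and linear form of the data, up to a real constant in the Hamiltonian, so the restricted
semigroup comes from a process with the same bath.

The support must fill the subspace. Let `ρ` be the product state on `Γ(ℂ^c)` with the occupations of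
the modes in `C`; it is faithful. It is stationary by `lindblad_eq_zero_of_exchange`: since `ρ` can
be moved through field operators, `Gρ = Xρ` with `X` of degree at most two; the Heisenberg generator
preserves degree at most two, and on such operators `ρ` agrees with the restriction of `σ`, so
`Tr(XρX^*) = Tr(Gρ X^*) = 0` and `Xρ = 0`. Maximality of `σ` applied to `Ω_A ⊗ ρ`, transported back
by `V`, gives the equality of supports. -/

namespace Fermion

noncomputable section

/-! ### Anticommutation relations -/

/-- The Jordan–Wigner sign of mode `i` in the configuration `u`. -/
def jwSign {L : ℕ} (i : Fin L) (u : Occ L) : ℂ :=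
  ∏ k, if k < i ∧ u k = true then (-1 : ℂ) else 1

/-- The configuration `u` with the occupation of mode `i` reversed. -/
def flipAt {L : ℕ} (i : Fin L) (u : Occ L) : Occ L := Function.update u i (!u i)

/-- The mode to which a Majorana operator belongs. -/
def site {L : ℕ} : Fin L ⊕ Fin L → Fin L := Sum.elim id id

/-- The nonzero entry of `majorana k` in the column `u`. -/
def majPhase {L : ℕ} : Fin L ⊕ Fin L → Occ L → ℂ
  | Sum.inl i, u => jwSign i u
  | Sum.inr i, u => Complex.I * (if u i = true then -1 else 1) * jwSign i u

theorem prod_filter_eq_jwSign {L : ℕ} (i : Fin L) (u : Occ L) :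
    ∏ k ∈ Finset.univ.filter (fun k => k < i), (if u k = true then (-1 : ℂ) else 1) =
      jwSign i u := by
  rw [Finset.prod_filter, jwSign]
  refine Finset.prod_congr rfl fun k _ => ?_
  by_cases h : k < i <;> simp [h]

theorem jwSign_update_of_le {L : ℕ} {i j : Fin L} (h : i ≤ j) (u : Occ L) (b : Bool) :
    jwSign i (Function.update u j b) = jwSign i u := by
  refine Finset.prod_congr rfl fun k _ => ?_
  by_cases hk : k < i
  · rw [Function.update_of_ne (by omega)]
  · simp [hk]

theorem jwSign_flipAt_of_le {L : ℕ} {i j : Fin L} (h : i ≤ j) (u : Occ L) :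
    jwSign i (flipAt j u) = jwSign i u :=
  jwSign_update_of_le h u _

/-- Only the factor at `j` changes. The predicate is left general so that one count serves both the
Jordan–Wigner sign (modes below `i`) and the parity (all modes). -/
theorem prod_ite_flipAt {L : ℕ} (p : Fin L → Prop) [DecidablePred p] {j : Fin L} (h : p j)
    (u : Occ L) :
    (∏ k, if p k ∧ flipAt j u k = true then (-1 : ℂ) else 1) =
      -∏ k, if p k ∧ u k = true then (-1 : ℂ) else 1 := by
  rw [← Finset.mul_prod_erase _ _ (Finset.mem_univ j),
    ← Finset.mul_prod_erase Finset.univ (fun k => if p k ∧ u k = true then (-1 : ℂ) else 1)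
      (Finset.mem_univ j), ← neg_mul]
  congr 1
  · cases hu : u j <;> simp [flipAt, h, hu]
  · refine Finset.prod_congr rfl fun k hk => ?_
    rw [flipAt, Function.update_of_ne (Finset.ne_of_mem_erase hk)]

theorem jwSign_flipAt_of_lt {L : ℕ} {i j : Fin L} (h : j < i) (u : Occ L) :
    jwSign i (flipAt j u) = -jwSign i u :=
  prod_ite_flipAt (fun k => k < i) h u

theorem jwSign_mul_self {L : ℕ} (i : Fin L) (u : Occ L) : jwSign i u * jwSign i u = 1 := by
  rw [jwSign, ← Finset.prod_mul_distrib]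
  refine Finset.prod_eq_one fun k _ => ?_
  split_ifs <;> simp

theorem star_jwSign {L : ℕ} (i : Fin L) (u : Occ L) : star (jwSign i u) = jwSign i u := by
  rw [jwSign, star_prod]
  refine Finset.prod_congr rfl fun k _ => ?_
  split_ifs <;> simp

theorem flipAt_apply_self {L : ℕ} (i : Fin L) (u : Occ L) : flipAt i u i = !u i := by
  simp [flipAt]

theorem flipAt_apply_of_ne {L : ℕ} {i j : Fin L} (h : j ≠ i) (u : Occ L) :
    flipAt i u j = u j := by
  simp [flipAt, h]

theorem flipAt_flipAt {L : ℕ} (i : Fin L) (u : Occ L) : flipAt i (flipAt i u) = u := by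
  simp [flipAt]

theorem flipAt_comm {L : ℕ} (i j : Fin L) (u : Occ L) :
    flipAt i (flipAt j u) = flipAt j (flipAt i u) := by
  by_cases h : i = j
  · rw [h]
  · ext k
    by_cases hi : k = i
    · subst hi
      rw [flipAt_apply_self, flipAt_apply_of_ne h, flipAt_apply_of_ne h, flipAt_apply_self]
    · by_cases hj : k = j
      · subst hj
        rw [flipAt_apply_self, flipAt_apply_of_ne hi, flipAt_apply_of_ne hi, flipAt_apply_self]
      · simp [flipAt_apply_of_ne, hi, hj]

theorem annih_apply {L : ℕ} (i : Fin L) (w u : Occ L) :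
    annih i w u = if w = flipAt i u ∧ u i = true then jwSign i u else 0 := by
  simp only [annih, Matrix.of_apply, prod_filter_eq_jwSign]
  refine if_congr ?_ rfl rfl
  constructor
  · rintro ⟨h, rfl⟩
    simp [flipAt, h]
  · rintro ⟨rfl, h⟩
    simp [flipAt, h]

theorem creat_apply {L : ℕ} (i : Fin L) (w u : Occ L) :
    creat i w u = if w = flipAt i u ∧ u i = false then jwSign i u else 0 := by
  rw [creat, Matrix.conjTranspose_apply, annih_apply]
  by_cases h : u = flipAt i w ∧ w i = true
  · obtain ⟨rfl, hw⟩ := h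
    rw [if_pos ⟨rfl, hw⟩, if_pos ⟨(flipAt_flipAt i w).symm, by simp [flipAt_apply_self, hw]⟩,
      star_jwSign, jwSign_flipAt_of_le le_rfl]
  · rw [if_neg h, if_neg, star_zero]
    rintro ⟨rfl, hu⟩
    exact h ⟨(flipAt_flipAt i u).symm, by simp [flipAt_apply_self, hu]⟩

/-- A Majorana operator is a monomial matrix: each configuration goes to a phase times its flip at
one site. The anticommutation relations thereby reduce to identities between phases. -/
theorem majorana_apply {L : ℕ} (k : Fin L ⊕ Fin L) (w u : Occ L) :
    majorana k w u = if w = flipAt (site k) u then majPhase k u else 0 := by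
  rcases k with i | i
  · simp only [majorana, Matrix.add_apply, annih_apply, creat_apply, site, Sum.elim_inl, id,
      majPhase]
    by_cases h : w = flipAt i u <;> cases hu : u i <;> simp [h]
  · simp only [majorana, Matrix.smul_apply, Matrix.sub_apply, annih_apply, creat_apply, site,
      Sum.elim_inr, id, majPhase, smul_eq_mul]
    by_cases h : w = flipAt i u <;> cases hu : u i <;> simp [h]

theorem majorana_mul_apply {L : ℕ} (k l : Fin L ⊕ Fin L) (w u : Occ L) :
    (majorana k * majorana l) w u =
      if w = flipAt (site k) (flipAt (site l) u) then
        majPhase k (flipAt (site l) u) * majPhase l u else 0 := by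
  rw [Matrix.mul_apply, Finset.sum_eq_single (flipAt (site l) u)]
  · simp [majorana_apply]
  · intro v _ hv
    simp [majorana_apply, hv]
  · simp

theorem majPhase_mul_self {L : ℕ} (k : Fin L ⊕ Fin L) (u : Occ L) :
    majPhase k (flipAt (site k) u) * majPhase k u = 1 := by
  rcases k with i | i
  · simp [majPhase, site, jwSign_flipAt_of_le, jwSign_mul_self]
  · have h := jwSign_mul_self i u
    simp only [majPhase, site, Sum.elim_inr, id, jwSign_flipAt_of_le le_rfl, flipAt_apply_self]
    cases u i <;> simp <;> linear_combination h - jwSign i u * jwSign i u * Complex.I_mul_I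

/-- The Jordan–Wigner sign of the lower mode ignores the flip of the higher one, whereas the sign of
the higher mode counts the flipped lower mode once; this is the minus sign. -/
theorem majPhase_mul_of_lt {L : ℕ} {k l : Fin L ⊕ Fin L} (h : site k < site l) (u : Occ L) :
    majPhase k (flipAt (site l) u) * majPhase l u =
      -(majPhase l (flipAt (site k) u) * majPhase k u) := by
  rcases k with i | i <;> rcases l with j | j <;>
    simp only [site, Sum.elim_inl, Sum.elim_inr, id] at h ⊢ <;>
    simp only [majPhase, jwSign_flipAt_of_le h.le, jwSign_flipAt_of_lt h,
      flipAt_apply_of_ne h.ne, flipAt_apply_of_ne h.ne'] <;> ring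

theorem majPhase_mul {L : ℕ} {k l : Fin L ⊕ Fin L} (h : k ≠ l) (u : Occ L) :
    majPhase k (flipAt (site l) u) * majPhase l u =
      -(majPhase l (flipAt (site k) u) * majPhase k u) := by
  rcases lt_trichotomy (site k) (site l) with hlt | heq | hlt
  · exact majPhase_mul_of_lt hlt u
  · rcases k with i | i <;> rcases l with j | j <;>
      simp only [site, Sum.elim_inl, Sum.elim_inr, id] at heq <;> subst heq
    · exact absurd rfl h
    · simp only [majPhase, site, Sum.elim_inl, Sum.elim_inr, id, jwSign_flipAt_of_le le_rfl,
        flipAt_apply_self]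
      cases u i <;> simp <;> ring
    · simp only [majPhase, site, Sum.elim_inl, Sum.elim_inr, id, jwSign_flipAt_of_le le_rfl,
        flipAt_apply_self]
      cases u i <;> simp <;> ring
    · exact absurd rfl h
  · rw [majPhase_mul_of_lt hlt u, neg_neg]

theorem majorana_mul_self {L : ℕ} (k : Fin L ⊕ Fin L) :
    majorana k * majorana k = (1 : Op L) := by
  ext w u
  rw [majorana_mul_apply, majPhase_mul_self, flipAt_flipAt, Matrix.one_apply]

theorem majorana_anticomm {L : ℕ} {k l : Fin L ⊕ Fin L} (h : k ≠ l) :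
    majorana k * majorana l = -(majorana l * majorana k : Op L) := by
  ext w u
  rw [Matrix.neg_apply, majorana_mul_apply, majorana_mul_apply, majPhase_mul h,
    flipAt_comm (site k)]
  split_ifs <;> simp

theorem conjTranspose_majorana {L : ℕ} (k : Fin L ⊕ Fin L) :
    (majorana k)ᴴ = (majorana k : Op L) := by
  rcases k with i | i
  · simp [majorana, creat, add_comm]
  · simp only [majorana, creat, Matrix.conjTranspose_smul, Matrix.conjTranspose_sub,
      Matrix.conjTranspose_conjTranspose, star_neg, Complex.star_def, Complex.conj_I]
    module

theorem parity_mul_majorana {L : ℕ} (k : Fin L ⊕ Fin L) :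
    parity L * majorana k = -(majorana k * parity L) := by
  ext w u
  rw [Matrix.neg_apply, parity, Matrix.diagonal_mul, Matrix.mul_diagonal, majorana_apply]
  by_cases h : w = flipAt (site k) u
  · have := prod_ite_flipAt (fun _ => True) (j := site k) trivial u
    simp only [true_and] at this
    rw [if_pos h, h, this]
    ring
  · simp [h]

theorem parity_mul_parity (L : ℕ) : parity L * parity L = 1 := by
  rw [parity, Matrix.diagonal_mul_diagonal, ← Matrix.diagonal_one]
  congr 1
  funext u
  rw [← Finset.prod_mul_distrib]
  refine Finset.prod_eq_one fun k _ => ?_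
  split_ifs <;> simp

theorem conjTranspose_parity (L : ℕ) : (parity L)ᴴ = parity L := by
  rw [parity, Matrix.diagonal_conjTranspose]
  congr 1
  funext u
  rw [Pi.star_apply, star_prod]
  refine Finset.prod_congr rfl fun k _ => ?_
  split_ifs <;> simp

/-- The operator `∑ x_k γ_k`. -/
def majLin {L : ℕ} : (Fin L ⊕ Fin L → ℂ) →ₗ[ℂ] Op L :=
  Fintype.linearCombination ℂ majorana

theorem majLin_apply {L : ℕ} (x : Fin L ⊕ Fin L → ℂ) :
    majLin x = ∑ k, x k • (majorana k : Op L) := rfl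

theorem majLin_single {L : ℕ} (k : Fin L ⊕ Fin L) :
    majLin (Pi.single k 1) = (majorana k : Op L) := by
  simp [majLin]

theorem conjTranspose_majLin {L : ℕ} (x : Fin L ⊕ Fin L → ℂ) :
    (majLin x)ᴴ = (majLin (star x) : Op L) := by
  simp [majLin_apply, Matrix.conjTranspose_sum, Matrix.conjTranspose_smul,
    conjTranspose_majorana]

theorem parity_mul_majLin {L : ℕ} (x : Fin L ⊕ Fin L → ℂ) :
    parity L * majLin x = -(majLin x * parity L) := by
  simp only [majLin_apply, Finset.mul_sum, Finset.sum_mul, mul_smul_comm, smul_mul_assoc,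
    parity_mul_majorana, smul_neg, Finset.sum_neg_distrib]

/-- The pairing is bilinear, without conjugation, since the adjoint of `majLin x` is `majLin (star
x)`. -/
theorem majLin_anticomm {L : ℕ} (x y : Fin L ⊕ Fin L → ℂ) :
    majLin x * majLin y + majLin y * majLin x = ((2 * (x ⬝ᵥ y)) • 1 : Op L) := by
  have key : ∀ k l : Fin L ⊕ Fin L,
      (majorana k * majorana l + majorana l * majorana k : Op L) =
        (if k = l then (2 : ℂ) else 0) • 1 := by
    intro k l
    by_cases h : k = l
    · subst h
      rw [majorana_mul_self, if_pos rfl, two_smul]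
    · rw [majorana_anticomm h, if_neg h, zero_smul, neg_add_cancel]
  have h1 : (majLin x * majLin y + majLin y * majLin x : Op L) =
      ∑ k, ∑ l, (x k * y l) • (majorana k * majorana l + majorana l * majorana k) := by
    simp only [smul_add, Finset.sum_add_distrib, majLin_apply]
    congr 1
    · rw [Finset.sum_mul_sum]
      simp only [smul_mul_smul_comm]
    · rw [Finset.sum_mul_sum, Finset.sum_comm]
      simp only [smul_mul_smul_comm, mul_comm]
  rw [h1]
  simp only [key, smul_smul, ← Finset.sum_smul]
  congr 1
  rw [dotProduct, Finset.mul_sum]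
  refine Finset.sum_congr rfl fun k _ => ?_
  simp only [mul_ite, mul_zero, Finset.sum_ite_eq, Finset.mem_univ, if_true]
  ring

theorem annih_eq_majLin {L : ℕ} (i : Fin L) :
    (annih i : Op L) = majLin ((1 / 2 : ℂ) • Pi.single (Sum.inl i) 1 +
      (Complex.I / 2) • Pi.single (Sum.inr i) 1) := by
  rw [map_add, map_smul, map_smul, majLin_single, majLin_single, majorana, majorana, smul_smul,
    show Complex.I / 2 * -Complex.I = 1 / 2 by linear_combination (-1 / 2) * Complex.I_mul_I]
  module

theorem creat_eq_majLin {L : ℕ} (i : Fin L) :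
    (creat i : Op L) = majLin ((1 / 2 : ℂ) • Pi.single (Sum.inl i) 1 -
      (Complex.I / 2) • Pi.single (Sum.inr i) 1) := by
  rw [map_sub, map_smul, map_smul, majLin_single, majLin_single, majorana, majorana, smul_smul,
    show Complex.I / 2 * -Complex.I = 1 / 2 by linear_combination (-1 / 2) * Complex.I_mul_I]
  module

/-! ### Operators of degree at most two -/

/-- The span of the identity and of the products of two field operators. -/
def quadSpan (L : ℕ) : Submodule ℂ (Op L) :=
  Submodule.span ℂ ({1} ∪ {Z | ∃ x y, Z = majLin x * majLin y})

theorem one_mem_quadSpan (L : ℕ) : (1 : Op L) ∈ quadSpan L :=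
  Submodule.subset_span (Or.inl rfl)

theorem majLin_mul_mem_quadSpan {L : ℕ} (x y : Fin L ⊕ Fin L → ℂ) :
    majLin x * majLin y ∈ quadSpan L :=
  Submodule.subset_span (Or.inr ⟨x, y, rfl⟩)

theorem quadSpan_induction {L : ℕ} {p : Op L → Prop} (h1 : p 1)
    (h2 : ∀ x y, p (majLin x * majLin y)) (hadd : ∀ X Y, p X → p Y → p (X + Y))
    (hsmul : ∀ (c : ℂ) X, p X → p (c • X)) {X : Op L} (hX : X ∈ quadSpan L) : p X := by
  refine Submodule.span_induction (p := fun X _ => p X) ?_ ?_ ?_ ?_ hX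
  · rintro X (rfl | ⟨x, y, rfl⟩)
    · exact h1
    · exact h2 x y
  · simpa using hsmul 0 _ h1
  · exact fun X Y _ _ => hadd X Y
  · exact fun c X _ => hsmul c X

theorem conjTranspose_mem_quadSpan {L : ℕ} {X : Op L} (hX : X ∈ quadSpan L) :
    Xᴴ ∈ quadSpan L := by
  refine quadSpan_induction (p := fun X => Xᴴ ∈ quadSpan L) ?_ ?_ ?_ ?_ hX
  · simpa using one_mem_quadSpan L
  · intro x y
    simpa [conjTranspose_majLin] using majLin_mul_mem_quadSpan (star y) (star x)
  · intro X Y hX hY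
    simpa using add_mem hX hY
  · intro c X hX
    simpa using Submodule.smul_mem _ (star c) hX

/-- In the commutator of `γ(x)γ(y)` with `γ(v)` only anticommutators survive, and these are scalars.
This is what makes quadratic dynamics linear on the phase space. -/
theorem commutator_majLin {L : ℕ} {X : Op L} (hX : X ∈ quadSpan L) (v : Fin L ⊕ Fin L → ℂ) :
    ∃ z, X * majLin v - majLin v * X = majLin z := by
  refine quadSpan_induction
    (p := fun X => ∃ z, X * majLin v - majLin v * X = majLin z) ?_ ?_ ?_ ?_ hX
  · exact ⟨0, by simp⟩
  · intro x y
    refine ⟨(2 * (y ⬝ᵥ v)) • x - (2 * (x ⬝ᵥ v)) • y, ?_⟩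
    have h1 := majLin_anticomm y v
    have h2 := majLin_anticomm x v
    calc majLin x * majLin y * majLin v - majLin v * (majLin x * majLin y)
        = majLin x * (majLin y * majLin v + majLin v * majLin y) -
          (majLin x * majLin v + majLin v * majLin x) * majLin y := by noncomm_ring
      _ = _ := by rw [h1, h2]; simp
  · rintro X Y ⟨z, hz⟩ ⟨z', hz'⟩
    refine ⟨z + z', ?_⟩
    rw [map_add, ← hz, ← hz']
    noncomm_ring
  · rintro c X ⟨z, hz⟩
    refine ⟨c • z, ?_⟩
    rw [map_smul, ← hz, smul_sub, smul_mul_assoc, mul_smul_comm]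

theorem commutator_mem_quadSpan {L : ℕ} {X Y : Op L} (hX : X ∈ quadSpan L)
    (hY : Y ∈ quadSpan L) : X * Y - Y * X ∈ quadSpan L := by
  refine quadSpan_induction (p := fun Y => X * Y - Y * X ∈ quadSpan L) ?_ ?_ ?_ ?_ hY
  · simp
  · intro x y
    obtain ⟨a, ha⟩ := commutator_majLin hX x
    obtain ⟨b, hb⟩ := commutator_majLin hX y
    have : X * (majLin x * majLin y) - majLin x * majLin y * X =
        majLin a * majLin y + majLin x * majLin b := by
      rw [← ha, ← hb]
      noncomm_ring
    rw [this]
    exact add_mem (majLin_mul_mem_quadSpan _ _) (majLin_mul_mem_quadSpan _ _)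
  · intro Y Z hY hZ
    convert add_mem hY hZ using 1
    noncomm_ring
  · intro c Y hY
    convert Submodule.smul_mem _ c hY using 1
    rw [smul_sub, smul_mul_assoc, mul_smul_comm]

/-- The separate terms have degree four, but together they equal half of `ℓ^*[X, ℓ] - [X, ℓ^*]ℓ`,
and both commutators are field operators. -/
theorem dissipator_mem_quadSpan {L : ℕ} {X : Op L} (hX : X ∈ quadSpan L)
    (v : Fin L ⊕ Fin L → ℂ) :
    (majLin v)ᴴ * X * majLin v -
      (1 / 2 : ℂ) • ((majLin v)ᴴ * majLin v * X + X * ((majLin v)ᴴ * majLin v)) ∈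
        quadSpan L := by
  rw [conjTranspose_majLin]
  obtain ⟨a, ha⟩ := commutator_majLin hX v
  obtain ⟨b, hb⟩ := commutator_majLin hX (star v)
  have : majLin (star v) * X * majLin v -
      (1 / 2 : ℂ) • (majLin (star v) * majLin v * X + X * (majLin (star v) * majLin v)) =
      (1 / 2 : ℂ) • (majLin (star v) * majLin a) - (1 / 2 : ℂ) • (majLin b * majLin v) := by
    have e1 : majLin (star v) * majLin a =
        majLin (star v) * X * majLin v - majLin (star v) * majLin v * X := by
      rw [← ha]; noncomm_ring
    have e2 : majLin b * majLin v =
        X * (majLin (star v) * majLin v) - majLin (star v) * X * majLin v := by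
      rw [← hb]; noncomm_ring
    rw [e1, e2]
    module
  rw [this]
  exact sub_mem (Submodule.smul_mem _ _ (majLin_mul_mem_quadSpan _ _))
    (Submodule.smul_mem _ _ (majLin_mul_mem_quadSpan _ _))

theorem quadHam_mem_quadSpan {L : ℕ} (R : Matrix (Fin L ⊕ Fin L) (Fin L ⊕ Fin L) ℝ) :
    quadHam R ∈ quadSpan L := by
  refine Submodule.smul_mem _ _ (Submodule.sum_mem _ fun i _ => Submodule.sum_mem _ fun j _ =>
    Submodule.smul_mem _ _ ?_)
  rw [← majLin_single, ← majLin_single]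
  exact majLin_mul_mem_quadSpan _ _

theorem isHermitian_quadHam {L : ℕ} {R : Matrix (Fin L ⊕ Fin L) (Fin L ⊕ Fin L) ℝ}
    (hR : Rᵀ = -R) : (quadHam R).IsHermitian := by
  rw [Matrix.IsHermitian, quadHam, Matrix.conjTranspose_smul, Matrix.conjTranspose_sum,
    Finset.sum_congr rfl fun i _ => Matrix.conjTranspose_sum _ _, Finset.sum_comm]
  congr 1
  · simp
  refine Finset.sum_congr rfl fun i _ => Finset.sum_congr rfl fun j _ => ?_
  have h : R j i = -R i j := congrFun (congrFun hR i) j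
  rw [Matrix.conjTranspose_smul, Matrix.conjTranspose_mul, conjTranspose_majorana,
    conjTranspose_majorana, h]
  simp

/-! ### The parity twist of the jump operators -/

/-- The operator that accompanies the jumps of the system: the parity for `E_SB` and the identity
for `E_BS`. -/
def twist (E : TensorIso) (L : ℕ) : Op L :=
  match E with
  | TensorIso.SB => parity L
  | TensorIso.BS => 1

theorem twist_mul_twist (E : TensorIso) (L : ℕ) : twist E L * twist E L = 1 := by
  cases E
  · exact parity_mul_parity L
  · exact one_mul 1

theorem conjTranspose_twist (E : TensorIso) (L : ℕ) : (twist E L)ᴴ = twist E L := by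
  cases E
  · exact conjTranspose_parity L
  · exact Matrix.conjTranspose_one

theorem parity_mul_quad {L : ℕ} {X : Op L} (hX : X ∈ quadSpan L) :
    parity L * X = X * parity L := by
  refine quadSpan_induction (p := fun X => parity L * X = X * parity L) ?_ ?_ ?_ ?_ hX
  · simp
  · intro x y
    rw [← mul_assoc, parity_mul_majLin, neg_mul, mul_assoc, parity_mul_majLin]
    noncomm_ring
  · intro X Y hX hY
    rw [mul_add, add_mul, hX, hY]
  · intro c X hX
    rw [mul_smul_comm, smul_mul_assoc, hX]

theorem parity_mul_majLin_mul_quad {L : ℕ} {X : Op L} (hX : X ∈ quadSpan L)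
    (x y : Fin L ⊕ Fin L → ℂ) :
    parity L * (majLin x * X * majLin y) = majLin x * X * majLin y * parity L := by
  rw [← mul_assoc, ← mul_assoc, parity_mul_majLin, neg_mul, mul_assoc (majLin x),
    parity_mul_quad hX, neg_mul, ← mul_assoc, mul_assoc (majLin x * X), parity_mul_majLin]
  noncomm_ring

/-- The operator in the middle is even, so the parity drops out. In the Heisenberg picture the two
identifications thus act alike on operators of degree at most two. -/
theorem twist_mul_majLin_mul_quad {L : ℕ} (E : TensorIso) {X : Op L} (hX : X ∈ quadSpan L)
    (x y : Fin L ⊕ Fin L → ℂ) :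
    twist E L * (majLin x * X * majLin y) * twist E L = majLin x * X * majLin y := by
  cases E
  · rw [twist, parity_mul_majLin_mul_quad hX, mul_assoc, parity_mul_parity, mul_one]
  · simp [twist]

/-! ### Lindblad generators -/

section Lindblad

variable {n α : Type} [Fintype n] [Fintype α]

/-- The non-self-adjoint effective Hamiltonian `-iH - ½ ∑ ℓ^* ℓ`. -/
def effHam (H : Matrix n n ℂ) (l : α → Matrix n n ℂ) : Matrix n n ℂ :=
  -(Complex.I • H) - (1 / 2 : ℂ) • ∑ a, (l a)ᴴ * l a

/-- The Lindblad generator with Hamiltonian `H` and jumps `ℓ Q`. -/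
def lindblad (H : Matrix n n ℂ) (l : α → Matrix n n ℂ) (Q : Matrix n n ℂ) :
    Matrix n n ℂ →ₗ[ℂ] Matrix n n ℂ where
  toFun ρ := effHam H l * ρ + ρ * (effHam H l)ᴴ + ∑ a, l a * (Q * ρ * Q) * (l a)ᴴ
  map_add' ρ ρ' := by
    simp only [mul_add, add_mul, Finset.sum_add_distrib]
    abel
  map_smul' c ρ := by
    simp only [mul_smul_comm, smul_mul_assoc, smul_add, Finset.smul_sum, RingHom.id_apply]

theorem lindblad_apply (H : Matrix n n ℂ) (l : α → Matrix n n ℂ) (Q ρ : Matrix n n ℂ) :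
    lindblad H l Q ρ =
      effHam H l * ρ + ρ * (effHam H l)ᴴ + ∑ a, l a * (Q * ρ * Q) * (l a)ᴴ := rfl

theorem conjTranspose_effHam {H : Matrix n n ℂ} (hH : H.IsHermitian) (l : α → Matrix n n ℂ) :
    (effHam H l)ᴴ = Complex.I • H - (1 / 2 : ℂ) • ∑ a, (l a)ᴴ * l a := by
  rw [effHam, Matrix.conjTranspose_sub, Matrix.conjTranspose_neg, Matrix.conjTranspose_smul,
    Matrix.conjTranspose_smul, Matrix.conjTranspose_sum, hH.eq]
  simp

/-- Duality: by cyclicity of the trace, the bracket on the right is the Heisenberg generator applied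
to `X`. -/
theorem trace_lindblad_mul (H : Matrix n n ℂ) (l : α → Matrix n n ℂ) (Q ρ X : Matrix n n ℂ) :
    (lindblad H l Q ρ * X).trace =
      (ρ * ((effHam H l)ᴴ * X + X * effHam H l + ∑ a, Q * ((l a)ᴴ * X * l a) * Q)).trace := by
  rw [lindblad_apply]
  simp only [add_mul, mul_add, Finset.sum_mul, Finset.mul_sum, Matrix.trace_add,
    Matrix.trace_sum]
  rw [add_comm (Matrix.trace (effHam H l * ρ * X)), mul_assoc, mul_assoc,
    Matrix.trace_mul_comm (effHam H l), mul_assoc]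
  congr 1
  refine Finset.sum_congr rfl fun a _ => ?_
  calc (l a * (Q * ρ * Q) * (l a)ᴴ * X).trace
      = ((l a * Q) * (ρ * (Q * (l a)ᴴ * X))).trace := by simp only [mul_assoc]
    _ = _ := by rw [Matrix.trace_mul_comm]; simp only [mul_assoc]

open scoped MatrixOrder in
theorem exists_eq_conjTranspose_mul_self {σ : Matrix n n ℂ} (hσ : σ.PosSemidef) :
    ∃ B : Matrix n n ℂ, σ = Bᴴ * B := by
  classical
  obtain ⟨B, hB⟩ := CStarAlgebra.nonneg_iff_eq_star_mul_self.mp hσ.nonneg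
  exact ⟨B, hB⟩

/-- If `σ ≥ 0` and `Tr X σ X^* = 0`, then `X σ = 0`. -/
theorem mul_eq_zero_of_trace_eq_zero {m : Type} [Fintype m] {σ : Matrix n n ℂ}
    (hσ : σ.PosSemidef) {X : Matrix m n ℂ} (h : (X * σ * Xᴴ).trace = 0) : X * σ = 0 := by
  obtain ⟨B, rfl⟩ := exists_eq_conjTranspose_mul_self hσ
  have h1 : ((B * Xᴴ)ᴴ * (B * Xᴴ)).trace = 0 := by
    rw [← h, Matrix.conjTranspose_mul, Matrix.conjTranspose_conjTranspose]
    simp only [Matrix.mul_assoc]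
  have h2 : B * Xᴴ = 0 := Matrix.trace_conjTranspose_mul_self_eq_zero_iff.mp h1
  have h3 : X * Bᴴ = 0 := by
    rw [← Matrix.conjTranspose_conjTranspose X, ← Matrix.conjTranspose_mul, h2,
      Matrix.conjTranspose_zero]
  rw [← Matrix.mul_assoc, h3, Matrix.zero_mul]

end Lindblad

theorem effHam_mem_quadSpan {L : ℕ} {α : Type} [Fintype α] {H : Op L} (hH : H ∈ quadSpan L)
    (w : α → Fin L ⊕ Fin L → ℂ) : effHam H (fun a => majLin (w a)) ∈ quadSpan L := by
  refine sub_mem (neg_mem (Submodule.smul_mem _ _ hH))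
    (Submodule.smul_mem _ _ (Submodule.sum_mem _ fun a _ => ?_))
  rw [conjTranspose_majLin]
  exact majLin_mul_mem_quadSpan _ _

/-- The Heisenberg generator maps operators of degree at most two to such operators. -/
theorem heisenberg_mem_quadSpan {L : ℕ} {α : Type} [Fintype α] {H : Op L}
    (hH : H ∈ quadSpan L) (hH' : H.IsHermitian) (w : α → Fin L ⊕ Fin L → ℂ) (E : TensorIso)
    {X : Op L} (hX : X ∈ quadSpan L) :
    (effHam H (fun a => majLin (w a)))ᴴ * X + X * effHam H (fun a => majLin (w a)) +
      ∑ a, twist E L * ((majLin (w a))ᴴ * X * majLin (w a)) * twist E L ∈ quadSpan L := by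
  have h1 : (effHam H (fun a => majLin (w a)))ᴴ * X + X * effHam H (fun a => majLin (w a)) +
      ∑ a, twist E L * ((majLin (w a))ᴴ * X * majLin (w a)) * twist E L =
      Complex.I • (H * X - X * H) + ∑ a, ((majLin (w a))ᴴ * X * majLin (w a) -
        (1 / 2 : ℂ) • ((majLin (w a))ᴴ * majLin (w a) * X +
          X * ((majLin (w a))ᴴ * majLin (w a)))) := by
    have h2 : ∀ a, twist E L * ((majLin (w a))ᴴ * X * majLin (w a)) * twist E L =
        (majLin (w a))ᴴ * X * majLin (w a) := fun a => by
      rw [conjTranspose_majLin, twist_mul_majLin_mul_quad E hX]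
    rw [Finset.sum_congr rfl fun a _ => h2 a, conjTranspose_effHam hH', effHam,
      Finset.sum_sub_distrib, ← Finset.smul_sum,
      Finset.sum_add_distrib, ← Finset.sum_mul, ← Finset.mul_sum]
    simp only [sub_mul, mul_sub, smul_mul_assoc, mul_smul_comm, mul_neg]
    module
  rw [h1]
  exact add_mem (Submodule.smul_mem _ _ (commutator_mem_quadSpan hH hX))
    (Submodule.sum_mem _ fun a _ => dissipator_mem_quadSpan hX (w a))

/-- A faithful even state that exchanges with the field operators, and whose two-point function is
that of a stationary state, is stationary. -/
theorem lindblad_eq_zero_of_exchange {L : ℕ} {α : Type} [Fintype α] {H : Op L}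
    (hH : H ∈ quadSpan L) (hH' : H.IsHermitian) (w : α → Fin L ⊕ Fin L → ℂ) (E : TensorIso)
    {ρ σ : Op L} (hσ : lindblad H (fun a => majLin (w a)) (twist E L) σ = 0)
    (hρ : ρ.PosDef) (hρE : twist E L * ρ * twist E L = ρ)
    (hexch : ∀ x : Fin L ⊕ Fin L → ℂ, ∃ y, ρ * majLin x = majLin y * ρ)
    (htr : ∀ X ∈ quadSpan L, (σ * X).trace = (ρ * X).trace) :
    lindblad H (fun a => majLin (w a)) (twist E L) ρ = 0 := by
  -- Exchange with single field operators extends to products of two of them.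
  have hexq : ∀ X ∈ quadSpan L, ∃ Y ∈ quadSpan L, ρ * X = Y * ρ := by
    intro X hX
    refine quadSpan_induction (p := fun X => ∃ Y ∈ quadSpan L, ρ * X = Y * ρ) ?_ ?_ ?_ ?_ hX
    · exact ⟨1, one_mem_quadSpan L, by simp⟩
    · intro x y
      obtain ⟨x', hx⟩ := hexch x
      obtain ⟨y', hy⟩ := hexch y
      exact ⟨_, majLin_mul_mem_quadSpan x' y', by rw [← mul_assoc, hx, mul_assoc, hy, mul_assoc]⟩
    · rintro X Y ⟨X', hX', hX⟩ ⟨Y', hY', hY⟩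
      exact ⟨_, add_mem hX' hY', by rw [mul_add, hX, hY, add_mul]⟩
    · rintro c X ⟨X', hX', hX⟩
      exact ⟨_, Submodule.smul_mem _ c hX', by rw [mul_smul_comm, hX, smul_mul_assoc]⟩
  have hGq := effHam_mem_quadSpan hH w
  obtain ⟨G', hG', hG⟩ := hexq _ (conjTranspose_mem_quadSpan hGq)
  choose y hy using fun a => hexch (star (w a))
  -- Moving `ρ` to the right in each of the three terms of the generator writes its value at `ρ` as
  -- `X ρ`, with `X` of degree at most two.
  set X : Op L := effHam H (fun a => majLin (w a)) + G' + ∑ a, majLin (w a) * majLin (y a)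
    with hXdef
  have hXq : X ∈ quadSpan L := add_mem (add_mem hGq hG')
    (Submodule.sum_mem _ fun a _ => majLin_mul_mem_quadSpan _ _)
  have hX : lindblad H (fun a => majLin (w a)) (twist E L) ρ = X * ρ := by
    rw [lindblad_apply, hG, hρE, hXdef, add_mul, add_mul, Finset.sum_mul]
    congr 1
    refine Finset.sum_congr rfl fun a _ => ?_
    rw [mul_assoc, conjTranspose_majLin, hy, mul_assoc]
  -- Pass to the Heisenberg picture, replace `ρ` by `σ` in the expectation of an operator of degree
  -- at most two, and return: stationarity of `σ` gives zero.
  have h0 : (X * ρ * Xᴴ).trace = 0 := by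
    have hXs := conjTranspose_mem_quadSpan hXq
    rw [← hX, trace_lindblad_mul, ← htr _ (heisenberg_mem_quadSpan hH hH' w E hXs),
      ← trace_lindblad_mul, hσ, zero_mul, Matrix.trace_zero]
  rw [hX]
  exact mul_eq_zero_of_trace_eq_zero hρ.posSemidef h0

/-! ### The embedding `ψ ↦ Ω_A ⊗ ψ` -/

section Vacuum

variable {L a c : ℕ}

/-- The configuration in which the first `a` modes are empty. -/
def vacOcc (h : a + c = L) (v : Occ c) : Occ L := (occSplit h).symm (fun _ => false, v)

/-- The matrix of `ψ ↦ Ω_A ⊗ ψ`. -/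
def vacMat (h : a + c = L) : Matrix (Occ L) (Occ c) ℂ :=
  Matrix.of fun u v => if u = vacOcc h v then 1 else 0

/-- The inclusion of the first `a` modes. -/
def modeA (h : a + c = L) (i : Fin a) : Fin L := Fin.cast h (Fin.castAdd c i)

/-- The inclusion of the last `c` modes. -/
def modeC (h : a + c = L) (i : Fin c) : Fin L := Fin.cast h (Fin.natAdd a i)

theorem vacOcc_modeA (h : a + c = L) (v : Occ c) (i : Fin a) :
    vacOcc h v (modeA h i) = false := by
  subst h
  simp [vacOcc, occSplit, modeA, Fin.appendEquiv, Equiv.arrowCongr]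

theorem vacOcc_modeC (h : a + c = L) (v : Occ c) (i : Fin c) :
    vacOcc h v (modeC h i) = v i := by
  subst h
  simp [vacOcc, occSplit, modeC, Fin.appendEquiv, Equiv.arrowCongr]

theorem forall_modes (h : a + c = L) {p : Fin L → Prop} (hA : ∀ i, p (modeA h i))
    (hC : ∀ i, p (modeC h i)) (i : Fin L) : p i := by
  subst h
  exact Fin.addCases hA hC i

theorem sum_modes {M : Type*} [AddCommMonoid M] (h : a + c = L) (f : Fin L ⊕ Fin L → M) :
    ∑ k, f k = ∑ k, f (Sum.map (modeA h) (modeA h) k) + ∑ k, f (Sum.map (modeC h) (modeC h) k) := by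
  subst h
  simp only [Fintype.sum_sum_type, Fin.sum_univ_add, Sum.map_inl, Sum.map_inr, modeA, modeC,
    Fin.cast_eq_self]
  abel

theorem prod_modes {M : Type*} [CommMonoid M] (h : a + c = L) (f : Fin L → M) :
    ∏ k, f k = (∏ k, f (modeA h k)) * ∏ k, f (modeC h k) := by
  subst h
  simp only [Fin.prod_univ_add, modeA, modeC, Fin.cast_eq_self]

theorem vacOcc_injective (h : a + c = L) : Function.Injective (vacOcc h) := by
  intro v v' hv
  funext i
  rw [← vacOcc_modeC h v, hv, vacOcc_modeC]

theorem vacOcc_flipAt (h : a + c = L) (i : Fin c) (v : Occ c) :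
    vacOcc h (flipAt i v) = flipAt (modeC h i) (vacOcc h v) := by
  funext k
  refine forall_modes h (p := fun k => vacOcc h (flipAt i v) k =
    flipAt (modeC h i) (vacOcc h v) k) (fun j => ?_) (fun j => ?_) k
  · rw [flipAt_apply_of_ne, vacOcc_modeA, vacOcc_modeA]
    intro hj
    have := congrArg Fin.val hj
    simp [modeA, modeC] at this
    omega
  · by_cases hj : j = i
    · rw [hj, vacOcc_modeC, flipAt_apply_self, flipAt_apply_self, vacOcc_modeC]
    · rw [flipAt_apply_of_ne, vacOcc_modeC, vacOcc_modeC, flipAt_apply_of_ne hj]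
      intro hj'
      have := congrArg Fin.val hj'
      simp [modeC] at this
      omega

theorem jwSign_vacOcc (h : a + c = L) (i : Fin c) (v : Occ c) :
    jwSign (modeC h i) (vacOcc h v) = jwSign i v := by
  rw [jwSign, prod_modes h, Finset.prod_eq_one, one_mul, jwSign]
  · refine Finset.prod_congr rfl fun k _ => ?_
    rw [vacOcc_modeC]
    simp only [modeC, Fin.lt_def, Fin.val_cast, Fin.val_natAdd, add_lt_add_iff_left]
  · intro k _
    simp [vacOcc_modeA]

theorem mul_vacMat_apply {m : Type} (h : a + c = L) (X : Matrix m (Occ L) ℂ) (u : m)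
    (v : Occ c) : (X * vacMat h) u v = X u (vacOcc h v) := by
  simp [Matrix.mul_apply, vacMat]

theorem vacMat_mul_apply {m : Type} (h : a + c = L) (X : Matrix (Occ c) m ℂ) (v : Occ c)
    (j : m) : (vacMat h * X) (vacOcc h v) j = X v j := by
  simp [Matrix.mul_apply, vacMat, (vacOcc_injective h).eq_iff]

theorem vacMat_mul_apply_of_ne {m : Type} (h : a + c = L) (X : Matrix (Occ c) m ℂ) {u : Occ L}
    (hu : ∀ v, u ≠ vacOcc h v) (j : m) : (vacMat h * X) u j = 0 := by
  simp [Matrix.mul_apply, vacMat, hu]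

theorem exists_vacOcc_iff (h : a + c = L) (u : Occ L) :
    (∃ v, u = vacOcc h v) ↔ ∀ i, u (modeA h i) = false := by
  constructor
  · rintro ⟨v, rfl⟩ i
    exact vacOcc_modeA h v i
  · intro hu
    refine ⟨fun i => u (modeC h i), funext fun k => ?_⟩
    refine forall_modes h (p := fun k => u k = vacOcc h (fun i => u (modeC h i)) k)
      (fun j => ?_) (fun j => ?_) k
    · rw [hu, vacOcc_modeA]
    · rw [vacOcc_modeC]

theorem conjTranspose_vacMat_mul_apply {m : Type} (h : a + c = L) (X : Matrix (Occ L) m ℂ)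
    (v : Occ c) (j : m) : ((vacMat h)ᴴ * X) v j = X (vacOcc h v) j := by
  simp [Matrix.mul_apply, vacMat, Matrix.conjTranspose_apply, apply_ite]

theorem conjTranspose_vacMat_mul_vacMat (h : a + c = L) : (vacMat h)ᴴ * vacMat h = 1 := by
  ext v v'
  rw [conjTranspose_vacMat_mul_apply, vacMat, Matrix.of_apply, Matrix.one_apply]
  simp [(vacOcc_injective h).eq_iff]

theorem vacTensorOp_eq (h : a + c = L) (ρ : Op c) :
    vacTensorOp h ρ = vacMat h * ρ * (vacMat h)ᴴ := by
  have key : ∀ u : Occ L, ∀ v : Occ c, vacMat h u v =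
      vac a (occSplit h u).1 * if (occSplit h u).2 = v then 1 else 0 := by
    intro u v
    simp only [vacMat, Matrix.of_apply, vacOcc, Equiv.eq_symm_apply, vac, Pi.single_apply,
      Prod.ext_iff]
    by_cases h1 : (occSplit h u).1 = fun _ => false <;> simp [h1]
  ext u u'
  simp only [vacTensorOp, Matrix.submatrix_apply, Matrix.kroneckerMap_apply, vacProj,
    Matrix.vecMulVec_apply, Matrix.mul_apply, Matrix.conjTranspose_apply, key, Pi.star_apply]
  simp [apply_ite]
  ring

theorem vacTensor_eq (h : a + c = L) : vacTensor h = (vacMat h).mulVecLin := by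
  refine LinearMap.ext fun ψ => funext fun u => ?_
  rw [Matrix.mulVecLin_apply, Matrix.mulVec, dotProduct]
  simp only [vacTensor, LinearMap.coe_mk, AddHom.coe_mk, vacMat, Matrix.of_apply, vacOcc,
    Equiv.eq_symm_apply, vac, Pi.single_apply, Prod.ext_iff]
  by_cases h1 : (occSplit h u).1 = fun _ => false <;> simp [h1]

theorem majorana_mul_vacMat (h : a + c = L) (k : Fin c ⊕ Fin c) :
    majorana (Sum.map (modeC h) (modeC h) k) * vacMat h = vacMat h * majorana k := by
  have hs : site (Sum.map (modeC h) (modeC h) k) = modeC h (site k) := by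
    rcases k with i | i <;> rfl
  have hp : ∀ v, majPhase (Sum.map (modeC h) (modeC h) k) (vacOcc h v) = majPhase k v := by
    intro v
    rcases k with i | i <;> simp [majPhase, jwSign_vacOcc, vacOcc_modeC]
  ext u v
  rw [mul_vacMat_apply, majorana_apply, hs, hp, ← vacOcc_flipAt]
  by_cases hu : ∃ v', u = vacOcc h v'
  · obtain ⟨v', rfl⟩ := hu
    rw [vacMat_mul_apply, majorana_apply]
    simp [(vacOcc_injective h).eq_iff]
  · rw [not_exists] at hu
    rw [vacMat_mul_apply_of_ne h _ hu, if_neg (hu _)]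

theorem annih_mul_vacMat (h : a + c = L) (i : Fin a) : annih (modeA h i) * vacMat h = 0 := by
  ext u v
  rw [mul_vacMat_apply, annih_apply, vacOcc_modeA]
  simp

theorem parity_mul_vacMat (h : a + c = L) : parity L * vacMat h = vacMat h * parity c := by
  ext u v
  rw [mul_vacMat_apply, parity, parity, Matrix.mul_diagonal, Matrix.diagonal_apply, vacMat,
    Matrix.of_apply, prod_modes h]
  by_cases hu : u = vacOcc h v
  · simp [hu, vacOcc_modeA, vacOcc_modeC]
  · simp [hu]

theorem twist_mul_vacMat (E : TensorIso) (h : a + c = L) :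
    twist E L * vacMat h = vacMat h * twist E c := by
  cases E
  · exact parity_mul_vacMat h
  · simp [twist]

/-- Vectors annihilated by the first `a` modes are of the form `Ω_A ⊗ ψ`. -/
theorem vacMat_mul_conjTranspose_mul {m : Type} (h : a + c = L) {X : Matrix (Occ L) m ℂ}
    (hX : ∀ i, annih (modeA h i) * X = 0) : vacMat h * ((vacMat h)ᴴ * X) = X := by
  ext u j
  by_cases hu : ∃ v, u = vacOcc h v
  · obtain ⟨v, rfl⟩ := hu
    rw [vacMat_mul_apply, conjTranspose_vacMat_mul_apply]
  · have hu' := hu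
    rw [exists_vacOcc_iff] at hu'
    rw [not_exists] at hu
    rw [vacMat_mul_apply_of_ne h _ hu]
    push Not at hu'
    obtain ⟨i, hi⟩ := hu'
    -- If mode `i` is occupied in `u`, the operator `c_i` sends `u` to its flip up to a sign and
    -- sends no other configuration there, so the coefficient at `u` must vanish.
    have h0 := congrFun (congrFun (hX i) (flipAt (modeA h i) u)) j
    rw [Matrix.mul_apply, Finset.sum_eq_single u, annih_apply, if_pos ⟨rfl, by simpa using hi⟩,
      Matrix.zero_apply] at h0
    · refine ((mul_eq_zero.mp h0).resolve_left ?_).symm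
      intro h1
      simpa [h1] using jwSign_mul_self (modeA h i) u
    · intro w _ hw
      rw [annih_apply, if_neg, zero_mul]
      rintro ⟨hw', -⟩
      exact hw (by rw [← flipAt_flipAt (modeA h i) w, ← hw', flipAt_flipAt])
    · simp

/-- `γ_k (Ω_A ⊗ ψ)` is a multiple of `c_i^* (Ω_A ⊗ ψ)` for the Majorana operators of the first
modes. -/
theorem majorana_modeA_mul_vacMat (h : a + c = L) (k : Fin a ⊕ Fin a) :
    ∃ z : ℂ, majorana (Sum.map (modeA h) (modeA h) k) * vacMat h =
      z • (creat (modeA h (site k)) * vacMat h) := by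
  rcases k with i | i
  · exact ⟨1, by simp [majorana, Matrix.add_mul, annih_mul_vacMat, site]⟩
  · refine ⟨Complex.I, ?_⟩
    simp [majorana, Matrix.sub_mul, annih_mul_vacMat, site]

theorem conjTranspose_vacMat_mul_creat (h : a + c = L) (i : Fin a) :
    (vacMat h)ᴴ * creat (modeA h i) = 0 := by
  rw [creat, ← Matrix.conjTranspose_mul, annih_mul_vacMat, Matrix.conjTranspose_zero]

/-- On an empty mode a Majorana operator can only create a particle, which makes the vector
orthogonal to `Ω_A ⊗ Γ(ℂ^c)`. -/
theorem compress_majorana_modeA (h : a + c = L) (k : Fin a ⊕ Fin a) :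
    (vacMat h)ᴴ * (majorana (Sum.map (modeA h) (modeA h) k) * vacMat h) = 0 := by
  obtain ⟨z, hz⟩ := majorana_modeA_mul_vacMat h k
  rw [hz, Matrix.mul_smul, ← Matrix.mul_assoc, conjTranspose_vacMat_mul_creat, Matrix.zero_mul,
    smul_zero]

theorem compress_majorana_modeC (h : a + c = L) (k : Fin c ⊕ Fin c) :
    (vacMat h)ᴴ * (majorana (Sum.map (modeC h) (modeC h) k) * vacMat h) = majorana k := by
  rw [majorana_mul_vacMat, ← Matrix.mul_assoc, conjTranspose_vacMat_mul_vacMat, Matrix.one_mul]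

theorem compress_majLin (h : a + c = L) (x : Fin L ⊕ Fin L → ℂ) :
    (vacMat h)ᴴ * (majLin x * vacMat h) =
      majLin fun k => x (Sum.map (modeC h) (modeC h) k) := by
  rw [majLin_apply, sum_modes h, Matrix.add_mul, Matrix.mul_add]
  simp only [Matrix.sum_mul, Matrix.mul_sum, Matrix.smul_mul, Matrix.mul_smul,
    compress_majorana_modeA, compress_majorana_modeC, smul_zero, Finset.sum_const_zero, zero_add,
    majLin_apply]

/-- Up to scalars the product acts between vacuum vectors as `c_k c_l^*`, and since `c_l^*` vanishes
to the left of the vacuum this equals the anticommutator `{c_k, c_l^*}`, a scalar. -/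
theorem compress_majorana_mul_majorana_modeA (h : a + c = L) (k l : Fin a ⊕ Fin a) :
    ∃ z : ℂ, (vacMat h)ᴴ * (majorana (Sum.map (modeA h) (modeA h) k) *
      majorana (Sum.map (modeA h) (modeA h) l) * vacMat h) = z • 1 := by
  obtain ⟨z, hz⟩ := majorana_modeA_mul_vacMat h k
  obtain ⟨z', hz'⟩ := majorana_modeA_mul_vacMat h l
  have h1 : (vacMat h)ᴴ * majorana (Sum.map (modeA h) (modeA h) k) =
      star z • ((vacMat h)ᴴ * annih (modeA h (site k))) := by
    rw [← conjTranspose_majorana, ← Matrix.conjTranspose_mul, hz, Matrix.conjTranspose_smul,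
      Matrix.conjTranspose_mul, creat, Matrix.conjTranspose_conjTranspose]
  have h2 := majLin_anticomm (L := L) ((1 / 2 : ℂ) • Pi.single (Sum.inl (modeA h (site k))) 1 +
      (Complex.I / 2) • Pi.single (Sum.inr (modeA h (site k))) 1)
    ((1 / 2 : ℂ) • Pi.single (Sum.inl (modeA h (site l))) 1 -
      (Complex.I / 2) • Pi.single (Sum.inr (modeA h (site l))) 1)
  rw [← annih_eq_majLin, ← creat_eq_majLin] at h2
  have h3 : (vacMat h)ᴴ * annih (modeA h (site k)) * (creat (modeA h (site l)) * vacMat h) =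
      (vacMat h)ᴴ * (annih (modeA h (site k)) * creat (modeA h (site l)) +
        creat (modeA h (site l)) * annih (modeA h (site k))) * vacMat h := by
    rw [Matrix.mul_add, Matrix.add_mul, ← Matrix.mul_assoc _ (creat _) (annih _),
      conjTranspose_vacMat_mul_creat, Matrix.zero_mul, Matrix.zero_mul, add_zero]
    simp only [Matrix.mul_assoc]
  rw [Matrix.mul_assoc (majorana _), hz', ← Matrix.mul_assoc, h1, Matrix.smul_mul,
    Matrix.mul_smul, h3, h2, Matrix.mul_smul, Matrix.mul_one, Matrix.smul_mul,
    conjTranspose_vacMat_mul_vacMat, smul_smul, smul_smul]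
  exact ⟨_, rfl⟩

theorem compress_majorana_mul_majorana (h : a + c = L) (k l : Fin c ⊕ Fin c) :
    (vacMat h)ᴴ * (majorana (Sum.map (modeC h) (modeC h) k) *
      majorana (Sum.map (modeC h) (modeC h) l) * vacMat h) = majorana k * majorana l := by
  rw [Matrix.mul_assoc (majorana _), majorana_mul_vacMat, ← Matrix.mul_assoc, ← Matrix.mul_assoc,
    Matrix.mul_assoc (vacMat h)ᴴ, compress_majorana_modeC]

/-- The compression of a quadratic Hamiltonian to `Ω_A ⊗ Γ(ℂ^c)` is quadratic, up to a constant. -/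
theorem compress_quadHam (h : a + c = L) (R : Matrix (Fin L ⊕ Fin L) (Fin L ⊕ Fin L) ℝ) :
    ∃ z : ℂ, (vacMat h)ᴴ * (quadHam R * vacMat h) =
      quadHam (R.submatrix (Sum.map (modeC h) (modeC h)) (Sum.map (modeC h) (modeC h))) +
        z • 1 := by
  have hAC : ∀ (k : Fin a ⊕ Fin a) (l : Fin c ⊕ Fin c),
      (vacMat h)ᴴ * (majorana (Sum.map (modeA h) (modeA h) k) *
        majorana (Sum.map (modeC h) (modeC h) l) * vacMat h) = 0 := fun k l => by
    rw [Matrix.mul_assoc (majorana _), majorana_mul_vacMat, ← Matrix.mul_assoc,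
      ← Matrix.mul_assoc, Matrix.mul_assoc (vacMat h)ᴴ, compress_majorana_modeA, Matrix.zero_mul]
  have hCA : ∀ (k : Fin c ⊕ Fin c) (l : Fin a ⊕ Fin a),
      (vacMat h)ᴴ * (majorana (Sum.map (modeC h) (modeC h) k) *
        majorana (Sum.map (modeA h) (modeA h) l) * vacMat h) = 0 := fun k l => by
    rw [← Matrix.conjTranspose_eq_zero]
    simp only [Matrix.conjTranspose_mul, Matrix.conjTranspose_conjTranspose,
      conjTranspose_majorana]
    rw [← hAC l k]
    simp only [Matrix.mul_assoc]
  choose z hz using compress_majorana_mul_majorana_modeA (c := c) h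
  refine ⟨(1 / 2 : ℂ) * ∑ k, ∑ l, Complex.I * (R (Sum.map (modeA h) (modeA h) k)
    (Sum.map (modeA h) (modeA h) l) : ℂ) * z k l, ?_⟩
  have h1 : (vacMat h)ᴴ * (quadHam R * vacMat h) = (1 / 2 : ℂ) • ∑ k, ∑ l,
      (Complex.I * (R k l : ℂ)) • ((vacMat h)ᴴ * (majorana k * majorana l * vacMat h)) := by
    simp only [quadHam, Matrix.smul_mul, Matrix.mul_smul, Matrix.sum_mul, Matrix.mul_sum]
  rw [h1, sum_modes h, Finset.sum_congr rfl fun k _ => sum_modes h _,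
    Finset.sum_congr rfl fun k _ => sum_modes h (fun l => (Complex.I *
      (R (Sum.map (modeC h) (modeC h) k) l : ℂ)) • ((vacMat h)ᴴ *
        (majorana (Sum.map (modeC h) (modeC h) k) * majorana l * vacMat h)))]
  simp only [hAC, hCA, hz, compress_majorana_mul_majorana, smul_zero, Finset.sum_const_zero,
    add_zero, zero_add, smul_smul, ← Finset.sum_smul, smul_add, quadHam, Matrix.submatrix_apply]
  rw [add_comm]

end Vacuum

/-! ### Restriction of the semigroup to `Ω_A ⊗ Γ(ℂ^c)` -/

theorem twist_comm_quad {L : ℕ} (E : TensorIso) {X : Op L} (hX : X ∈ quadSpan L) :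
    twist E L * X = X * twist E L := by
  cases E
  · exact parity_mul_quad hX
  · simp [twist]

section Restriction

variable {L a c : ℕ} {α : Type} [Fintype α] {E : TensorIso} {σ H : Op L}
  {w : α → Fin L ⊕ Fin L → ℂ} {x : Fin L ⊕ Fin L → ℂ}

/-- The jumps out of the kernel of a field operator vanish. -/
theorem jump_mul_eq_zero (hσ : σ.PosSemidef)
    (hst : lindblad H (fun a => majLin (w a)) (twist E L) σ = 0) (hx : majLin x * σ = 0)
    (b : α) : majLin x * majLin (w b) * σ = 0 := by
  have hx' : σ * (majLin x)ᴴ = 0 := by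
    rw [← hσ.isHermitian.eq, ← Matrix.conjTranspose_mul, hx, Matrix.conjTranspose_zero]
  -- Both effective Hamiltonian terms contain `xσ` or `σx^*` and vanish. A sum of positive operators
  -- remains, with total trace zero, so each of them has trace zero.
  have h1 : majLin x * lindblad H (fun a => majLin (w a)) (twist E L) σ * (majLin x)ᴴ =
      ∑ b, (majLin x * majLin (w b) * twist E L) * σ *
        (majLin x * majLin (w b) * twist E L)ᴴ := by
    rw [lindblad_apply, mul_add, mul_add, add_mul, add_mul, ← mul_assoc (majLin x) σ, hx,
      zero_mul, zero_mul, add_zero, ← mul_assoc (majLin x), mul_assoc _ σ, hx', mul_zero,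
      zero_add, Finset.mul_sum, Finset.sum_mul]
    refine Finset.sum_congr rfl fun b _ => ?_
    simp only [Matrix.conjTranspose_mul, conjTranspose_twist, mul_assoc]
  rw [hst, mul_zero, zero_mul] at h1
  have h2 := congrArg Matrix.trace h1
  rw [Matrix.trace_zero, Matrix.trace_sum] at h2
  have h3 := (Finset.sum_eq_zero_iff_of_nonneg
    (fun b _ => (hσ.mul_mul_conjTranspose_same _).trace_nonneg)).mp h2.symm b (Finset.mem_univ b)
  have h4 := mul_eq_zero_of_trace_eq_zero hσ h3
  -- The twist commutes with the even operator `xℓ_b` and is its own inverse, so it can be removed.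
  rw [← twist_comm_quad E (majLin_mul_mem_quadSpan _ _), mul_assoc] at h4
  rw [← one_mul (majLin x * majLin (w b) * σ), ← twist_mul_twist E L, mul_assoc, h4, mul_zero]

/-- Both `xℓ_b` and `ℓ_b x` annihilate `σ`, while their sum is a scalar; as `σ ≠ 0`, the scalar is
zero, i.e. `x` anticommutes with every jump. -/
theorem dotProduct_jump_eq_zero (hσ : σ.PosSemidef) (hσ0 : σ ≠ 0)
    (hst : lindblad H (fun a => majLin (w a)) (twist E L) σ = 0) (hx : majLin x * σ = 0)
    (b : α) : 2 * (x ⬝ᵥ w b) = 0 := by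
  have h1 : (2 * (x ⬝ᵥ w b)) • σ = 0 := by
    rw [← one_mul σ, ← smul_mul_assoc, ← majLin_anticomm, add_mul,
      jump_mul_eq_zero hσ hst hx, mul_assoc, hx, mul_zero, add_zero]
  exact (smul_eq_zero.mp h1).resolve_right hσ0

/-- After left multiplication of the stationarity equation by `x`, the jump terms vanish by
`jump_mul_eq_zero` and the right-hand Hamiltonian term by `xσ = 0`. -/
theorem majLin_mul_effHam_mul_eq_zero (hσ : σ.PosSemidef)
    (hst : lindblad H (fun a => majLin (w a)) (twist E L) σ = 0) (hx : majLin x * σ = 0) :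
    majLin x * effHam H (fun a => majLin (w a)) * σ = 0 := by
  have h1 : majLin x * lindblad H (fun a => majLin (w a)) (twist E L) σ = 0 := by
    rw [hst, mul_zero]
  have h2 : ∀ b, majLin x * (majLin (w b) * (twist E L * σ * twist E L) * (majLin (w b))ᴴ) = 0 :=
      fun b => by
    have := jump_mul_eq_zero hσ hst hx b
    calc majLin x * (majLin (w b) * (twist E L * σ * twist E L) * (majLin (w b))ᴴ)
        = (majLin x * majLin (w b)) * twist E L * (σ * (twist E L * (majLin (w b))ᴴ)) := by
          simp only [mul_assoc]
      _ = twist E L * (majLin x * majLin (w b) * σ) * (twist E L * (majLin (w b))ᴴ) := by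
          rw [← twist_comm_quad E (majLin_mul_mem_quadSpan _ _)]
          simp only [mul_assoc]
      _ = 0 := by rw [this, mul_zero, zero_mul]
  rw [lindblad_apply, mul_add, mul_add, ← mul_assoc _ σ, hx, zero_mul, add_zero, Finset.mul_sum,
    Finset.sum_eq_zero fun b _ => h2 b, add_zero, ← mul_assoc] at h1
  exact h1

variable {R : Matrix (Fin L ⊕ Fin L) (Fin L ⊕ Fin L) ℝ}

/-- If the state `σ`, stationary for a quasi-free semigroup, is annihilated by exactly the field
operators that annihilate `Ω_A ⊗ Γ(ℂ^c)`, then the semigroup restricts to this subspace. -/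
theorem lindblad_vacMat (h : a + c = L) (hR : Rᵀ = -R) (hσ : σ.PosSemidef) (hσ0 : σ ≠ 0)
    (hst : lindblad (quadHam R) (fun b => majLin (w b)) (twist E L) σ = 0)
    (hA : ∀ i, annih (modeA h i) * σ = 0)
    (hker : ∀ x, majLin x * σ = 0 → majLin x * vacMat h = 0) (ρ : Op c) :
    lindblad (quadHam R) (fun b => majLin (w b)) (twist E L) (vacMat h * ρ * (vacMat h)ᴴ) =
      vacMat h * lindblad
        (quadHam (R.submatrix (Sum.map (modeC h) (modeC h)) (Sum.map (modeC h) (modeC h))))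
        (fun b => majLin fun k => w b (Sum.map (modeC h) (modeC h) k)) (twist E c) ρ *
          (vacMat h)ᴴ := by
  set RC := R.submatrix (Sum.map (modeC h) (modeC h)) (Sum.map (modeC h) (modeC h)) with hRC
  set lC : α → Op c := fun b => majLin fun k => w b (Sum.map (modeC h) (modeC h) k) with hlC
  have hRC' : RCᵀ = -RC := by
    rw [hRC, Matrix.transpose_submatrix, hR]
    rfl
  -- The jumps anticommute with the annihilation operators of the empty modes and hence preserve
  -- their common kernel `Ω_A ⊗ Γ(ℂ^c)`.
  have hl : ∀ b, majLin (w b) * vacMat h = vacMat h * lC b := by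
    intro b
    rw [show lC b = _ from (compress_majLin h (w b)).symm, vacMat_mul_conjTranspose_mul]
    intro i
    have h1 := hA i
    have h2 := annih_mul_vacMat h i
    rw [annih_eq_majLin] at h1 h2 ⊢
    have h3 := majLin_anticomm (L := L) ((1 / 2 : ℂ) • Pi.single (Sum.inl (modeA h i)) 1 +
      (Complex.I / 2) • Pi.single (Sum.inr (modeA h i)) 1) (w b)
    rw [dotProduct_jump_eq_zero hσ hσ0 hst h1 b, zero_smul, add_eq_zero_iff_eq_neg] at h3
    rw [← Matrix.mul_assoc, h3, Matrix.neg_mul, Matrix.mul_assoc, h2, Matrix.mul_zero, neg_zero]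
  obtain ⟨z, hz⟩ := compress_quadHam h R
  rw [← hRC] at hz
  -- The constant must be real: it enters the effective Hamiltonian as `-iz` and its adjoint as `i
  -- conj z`, which cancel in the generator only for real `z`. Any diagonal entry of the
  -- self-adjointness relation shows this.
  have hz' : star z = z := by
    have h1 := congrArg Matrix.conjTranspose hz
    rw [Matrix.conjTranspose_add, (isHermitian_quadHam hRC').eq, Matrix.conjTranspose_mul,
      Matrix.conjTranspose_mul, Matrix.conjTranspose_conjTranspose, (isHermitian_quadHam hR).eq,
      Matrix.mul_assoc, hz, Matrix.conjTranspose_smul, Matrix.conjTranspose_one] at h1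
    have h2 := congrFun (congrFun h1 fun _ => false) fun _ => false
    simpa using h2.symm
  have hG : effHam (quadHam R) (fun b => majLin (w b)) * vacMat h =
      vacMat h * (effHam (quadHam RC) lC - (Complex.I * z) • 1) := by
    rw [← vacMat_mul_conjTranspose_mul h
      (X := effHam (quadHam R) (fun b => majLin (w b)) * vacMat h)]
    · congr 1
      have h1 : ∀ b, (vacMat h)ᴴ * ((majLin (w b))ᴴ * majLin (w b) * vacMat h) =
          (lC b)ᴴ * lC b := by
        intro b
        rw [Matrix.mul_assoc, ← Matrix.mul_assoc, ← Matrix.conjTranspose_mul, hl,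
          Matrix.conjTranspose_mul, Matrix.mul_assoc, ← Matrix.mul_assoc _ (vacMat h),
          conjTranspose_vacMat_mul_vacMat, Matrix.one_mul]
      rw [effHam, effHam, Matrix.sub_mul, Matrix.mul_sub, Matrix.neg_mul, Matrix.mul_neg,
        Matrix.smul_mul, Matrix.mul_smul, hz, Matrix.smul_mul, Matrix.mul_smul, Matrix.sum_mul,
        Matrix.mul_sum, Finset.sum_congr rfl fun b _ => h1 b]
      module
    · intro i
      have h1 := hA i
      have h2 := annih_mul_vacMat h i
      rw [annih_eq_majLin] at h1 h2 ⊢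
      -- The commutator of the effective Hamiltonian with `c_i` is a field operator annihilating
      -- `σ`; by `hker` it annihilates the subspace, which is therefore invariant.
      obtain ⟨y, hy⟩ := commutator_majLin (effHam_mem_quadSpan (quadHam_mem_quadSpan R) w)
        ((1 / 2 : ℂ) • Pi.single (Sum.inl (modeA h i)) 1 +
          (Complex.I / 2) • Pi.single (Sum.inr (modeA h i)) 1)
      have h3 := hker y (by
        rw [← hy, sub_mul, majLin_mul_effHam_mul_eq_zero hσ hst h1, mul_assoc, h1, mul_zero,
          sub_zero])
      rw [← hy, Matrix.sub_mul, Matrix.mul_assoc, h2, Matrix.mul_zero, zero_sub,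
        neg_eq_zero] at h3
      rw [← Matrix.mul_assoc, h3]
  set T := vacMat h with hT
  have hT' : Tᴴ * twist E L = twist E c * Tᴴ := by
    rw [← conjTranspose_twist, ← Matrix.conjTranspose_mul, twist_mul_vacMat,
      Matrix.conjTranspose_mul, conjTranspose_twist]
  have hG' : Tᴴ * (effHam (quadHam R) (fun b => majLin (w b)))ᴴ =
      ((effHam (quadHam RC) lC)ᴴ + (Complex.I * z) • 1) * Tᴴ := by
    rw [← Matrix.conjTranspose_mul, hG, Matrix.conjTranspose_mul, Matrix.conjTranspose_sub,
      Matrix.conjTranspose_smul, Matrix.conjTranspose_one, star_mul', hz']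
    simp
  have hj : ∀ b, majLin (w b) * (twist E L * (T * ρ * Tᴴ) * twist E L) * (majLin (w b))ᴴ =
      T * (lC b * (twist E c * ρ * twist E c) * (lC b)ᴴ) * Tᴴ := by
    intro b
    calc majLin (w b) * (twist E L * (T * ρ * Tᴴ) * twist E L) * (majLin (w b))ᴴ
        = majLin (w b) * (twist E L * T) * ρ * (Tᴴ * twist E L) * (majLin (w b))ᴴ := by
          simp only [Matrix.mul_assoc]
      _ = (majLin (w b) * T) * (twist E c * ρ * twist E c) * (majLin (w b) * T)ᴴ := by
          rw [hT, twist_mul_vacMat, ← hT, hT', Matrix.conjTranspose_mul]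
          simp only [Matrix.mul_assoc]
      _ = _ := by
          rw [hl, Matrix.conjTranspose_mul]
          simp only [Matrix.mul_assoc]
  rw [lindblad_apply, lindblad_apply, Finset.sum_congr rfl fun b _ => hj b, ← Matrix.mul_assoc,
    ← Matrix.mul_assoc, hG, Matrix.mul_assoc (T * ρ), hG', Matrix.mul_add, Matrix.mul_add,
    Matrix.add_mul, Matrix.add_mul, Matrix.mul_sum, Matrix.sum_mul]
  congr 1
  simp only [Matrix.mul_sub, Matrix.sub_mul, Matrix.mul_add, Matrix.add_mul, Matrix.mul_smul,
    Matrix.smul_mul, Matrix.mul_one, Matrix.one_mul, Matrix.mul_assoc]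
  abel

end Restriction

/-! ### Powers of approximate semigroups -/

section Banach

variable {𝔸 : Type*} [NormedRing 𝔸]

theorem norm_pow_le_of_norm_one_le (h1 : ‖(1 : 𝔸)‖ ≤ 1) {a : 𝔸} {M : ℝ} (ha : ‖a‖ ≤ M) (n : ℕ) :
    ‖a ^ n‖ ≤ M ^ n := by
  induction n with
  | zero => simpa using h1
  | succ n ih =>
    rw [pow_succ, pow_succ]
    exact (norm_mul_le _ _).trans
      (mul_le_mul ih ha (norm_nonneg _) (pow_nonneg ((norm_nonneg _).trans ha) _))

/-- Telescoping. The assumption `‖1‖ ≤ 1`, rather than equality, also covers operators on the zero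
space. -/
theorem norm_pow_sub_pow_le_mul (h1 : ‖(1 : 𝔸)‖ ≤ 1) {a b : 𝔸} {M : ℝ} (hM : 1 ≤ M)
    (ha : ‖a‖ ≤ M) (hb : ‖b‖ ≤ M) (n : ℕ) : ‖a ^ n - b ^ n‖ ≤ n * M ^ n * ‖a - b‖ := by
  have hM0 : 0 ≤ M := zero_le_one.trans hM
  induction n with
  | zero => simp
  | succ n ih =>
    have h2 : a ^ (n + 1) - b ^ (n + 1) = a ^ n * (a - b) + (a ^ n - b ^ n) * b := by
      rw [pow_succ, pow_succ]
      noncomm_ring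
    rw [h2]
    calc ‖a ^ n * (a - b) + (a ^ n - b ^ n) * b‖
        ≤ ‖a ^ n‖ * ‖a - b‖ + ‖a ^ n - b ^ n‖ * ‖b‖ :=
          (norm_add_le _ _).trans (add_le_add (norm_mul_le _ _) (norm_mul_le _ _))
      _ ≤ M ^ (n + 1) * ‖a - b‖ + (n * M ^ n * ‖a - b‖) * M := by
          refine add_le_add (mul_le_mul_of_nonneg_right ?_ (norm_nonneg _))
            (mul_le_mul ih hb (norm_nonneg _) (by positivity))
          exact (norm_pow_le_of_norm_one_le h1 ha n).trans (pow_le_pow_right₀ hM n.le_succ)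
      _ = _ := by push_cast; ring

variable [NormedAlgebra ℂ 𝔸]

theorem tendsto_floor_div_mul (t : ℝ) (ht : 0 ≤ t) :
    Tendsto (fun τ : ℝ => (⌊t / τ⌋₊ : ℝ) * τ) (𝓝[>] 0) (𝓝 t) := by
  have hτ : Tendsto (fun τ : ℝ => t - τ) (𝓝[>] 0) (𝓝 t) := by
    have : Tendsto (fun τ : ℝ => t - τ) (𝓝 0) (𝓝 (t - 0)) := tendsto_const_nhds.sub tendsto_id
    rw [sub_zero] at this
    exact this.mono_left nhdsWithin_le_nhds
  refine tendsto_of_tendsto_of_tendsto_of_le_of_le' hτ tendsto_const_nhds ?_ ?_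
  · filter_upwards [self_mem_nhdsWithin] with τ hτ
    have h0 : (0 : ℝ) < τ := hτ
    have := Nat.lt_floor_add_one (t / τ)
    rw [div_lt_iff₀ h0] at this
    linarith
  · filter_upwards [self_mem_nhdsWithin] with τ hτ
    have h0 : (0 : ℝ) < τ := hτ
    exact (le_div_iff₀ h0).mp (Nat.floor_le (by positivity))

theorem tendsto_slope_exp [CompleteSpace 𝔸] (X : 𝔸) :
    Tendsto (fun τ : ℝ => (τ : ℂ)⁻¹ • (NormedSpace.exp ((τ : ℂ) • X) - 1)) (𝓝[>] 0) (𝓝 X) := by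
  have h := (hasDerivAt_exp_smul_const (𝕂 := ℂ) X 0).scomp_of_eq (0 : ℝ)
    (Complex.ofRealCLM.hasDerivAt) (by simp)
  have h2 := h.tendsto_slope_zero_right
  simp only [Complex.ofRealCLM_apply, Complex.ofReal_one, zero_smul, NormedSpace.exp_zero, one_mul,
    one_smul, Function.comp_apply, zero_add, Complex.ofReal_zero] at h2
  refine h2.congr fun τ => ?_
  rw [← Complex.ofReal_inv]
  exact (Complex.coe_smul _ _).symm

/-- If `F τ = 1 + τ X + o(τ)`, then `F τ ^ ⌊t/τ⌋` converges to `exp (t X)`. -/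
theorem tendsto_pow_floor [CompleteSpace 𝔸] (h1 : ‖(1 : 𝔸)‖ ≤ 1) {F : ℝ → 𝔸} {X : 𝔸}
    (hF : Tendsto (fun τ : ℝ => (τ : ℂ)⁻¹ • (F τ - 1)) (𝓝[>] 0) (𝓝 X)) {t : ℝ} (ht : 0 ≤ t) :
    Tendsto (fun τ : ℝ => F τ ^ ⌊t / τ⌋₊) (𝓝[>] 0) (𝓝 (NormedSpace.exp ((t : ℂ) • X))) := by
  have hG := tendsto_slope_exp X
  set G : ℝ → 𝔸 := fun τ => NormedSpace.exp ((τ : ℂ) • X) with hGdef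
  -- Any constant above `‖X‖` works: a family with slope `X` at `0` is eventually bounded by `1 +
  -- Cτ`, so its powers up to `t/τ` stay below `exp(Ct)`.
  set C : ℝ := ‖X‖ + 1 with hC
  have hC0 : 0 ≤ C := by positivity
  have bound : ∀ K : ℝ → 𝔸, Tendsto (fun τ : ℝ => (τ : ℂ)⁻¹ • (K τ - 1)) (𝓝[>] 0) (𝓝 X) →
      ∀ᶠ τ in 𝓝[>] (0 : ℝ), ‖K τ‖ ≤ 1 + C * τ := by
    intro K hK
    have h2 := hK.norm.eventually (ge_mem_nhds (lt_add_one ‖X‖))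
    filter_upwards [h2, self_mem_nhdsWithin] with τ hτ hτ0
    have h0 : (0 : ℝ) < τ := hτ0
    rw [norm_smul, norm_inv, Complex.norm_real, Real.norm_of_nonneg h0.le,
      inv_mul_le_iff₀ h0] at hτ
    calc ‖K τ‖ = ‖1 + (K τ - 1)‖ := by rw [add_sub_cancel]
      _ ≤ ‖(1 : 𝔸)‖ + ‖K τ - 1‖ := norm_add_le _ _
      _ ≤ 1 + C * τ := by rw [mul_comm C]; exact add_le_add h1 hτ
  have hdiff : Tendsto (fun τ : ℝ => t * Real.exp (C * t) *
      ‖(τ : ℂ)⁻¹ • (F τ - 1) - (τ : ℂ)⁻¹ • (G τ - 1)‖) (𝓝[>] 0) (𝓝 0) := by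
    have h := (hF.sub hG).norm.const_mul (t * Real.exp (C * t))
    rwa [sub_self, norm_zero, mul_zero] at h
  -- The distance of the powers is at most `t exp(Ct)` times the distance of the difference
  -- quotients of `F` and `exp(τX)`, which have the same limit.
  have h2 : Tendsto (fun τ : ℝ => F τ ^ ⌊t / τ⌋₊ - G τ ^ ⌊t / τ⌋₊) (𝓝[>] 0) (𝓝 0) := by
    refine squeeze_zero_norm' ?_ hdiff
    filter_upwards [bound F hF, bound G hG, self_mem_nhdsWithin] with τ hFτ hGτ hτ0
    have h0 : (0 : ℝ) < τ := hτ0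
    set n := ⌊t / τ⌋₊ with hn
    have hnt : (n : ℝ) * τ ≤ t := (le_div_iff₀ h0).mp (Nat.floor_le (by positivity))
    have hM : 1 ≤ 1 + C * τ := le_add_of_nonneg_right (by positivity)
    have hpow : (1 + C * τ) ^ n ≤ Real.exp (C * t) := by
      calc (1 + C * τ) ^ n ≤ Real.exp (C * τ) ^ n := by
            refine pow_le_pow_left₀ (by positivity) ?_ _
            rw [add_comm]
            exact Real.add_one_le_exp _
        _ = Real.exp (C * (n * τ)) := by rw [← Real.exp_nat_mul]; ring_nf
        _ ≤ Real.exp (C * t) := Real.exp_le_exp.mpr (mul_le_mul_of_nonneg_left hnt hC0)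
    have hdiv : ‖(τ : ℂ)⁻¹ • (F τ - 1) - (τ : ℂ)⁻¹ • (G τ - 1)‖ = τ⁻¹ * ‖F τ - G τ‖ := by
      rw [← smul_sub, norm_smul, norm_inv, Complex.norm_real, Real.norm_of_nonneg h0.le,
        sub_sub_sub_cancel_right]
    rw [hdiv]
    calc ‖F τ ^ n - G τ ^ n‖ ≤ n * (1 + C * τ) ^ n * ‖F τ - G τ‖ :=
          norm_pow_sub_pow_le_mul h1 hM hFτ hGτ n
      _ ≤ n * Real.exp (C * t) * ‖F τ - G τ‖ := by gcongr
      _ = (n * τ) * Real.exp (C * t) * (τ⁻¹ * ‖F τ - G τ‖) := by field_simp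
      _ ≤ t * Real.exp (C * t) * (τ⁻¹ * ‖F τ - G τ‖) := by gcongr
  have h3 : Tendsto (fun τ : ℝ => G τ ^ ⌊t / τ⌋₊) (𝓝[>] 0)
      (𝓝 (NormedSpace.exp ((t : ℂ) • X))) := by
    let _ : NormedAlgebra ℚ 𝔸 := NormedAlgebra.restrictScalars ℚ ℂ 𝔸
    have h4 : ∀ τ : ℝ, G τ ^ ⌊t / τ⌋₊ =
        NormedSpace.exp (((⌊t / τ⌋₊ * τ : ℝ) : ℂ) • X) := by
      intro τ
      rw [hGdef, ← NormedSpace.exp_nsmul, ← Nat.cast_smul_eq_nsmul ℂ, smul_smul]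
      push_cast
      rfl
    simp only [h4]
    have hc : Continuous fun s : ℝ => NormedSpace.exp ((s : ℂ) • X) :=
      NormedSpace.exp_continuous.comp (by fun_prop)
    exact (hc.tendsto t).comp (tendsto_floor_div_mul t ht)
  simpa using h2.add h3

/-- Second-order expansion of `exp (s A + s² B)` at `s = 0`. -/
theorem tendsto_exp_second_order [CompleteSpace 𝔸] (A B : 𝔸) :
    Tendsto (fun s : ℝ => ((s : ℂ) ^ 2)⁻¹ •
      (NormedSpace.exp ((s : ℂ) • A + ((s : ℂ) ^ 2) • B) - 1 - (s : ℂ) • A)) (𝓝[>] 0)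
      (𝓝 (B + (1 / 2 : ℂ) • (A * A))) := by
  set y : ℝ → 𝔸 := fun s => (s : ℂ) • A + ((s : ℂ) ^ 2) • B with hy
  have hyc : Continuous y := by fun_prop
  have hy0 : Tendsto y (𝓝[>] 0) (𝓝 0) := by
    have h := hyc.tendsto 0
    simp only [hy, Complex.ofReal_zero, zero_smul, zero_pow two_ne_zero, add_zero] at h
    exact h.mono_left nhdsWithin_le_nhds
  have hyO : y =O[𝓝[>] 0] fun s : ℝ => s := by
    refine Asymptotics.IsBigO.of_bound (‖A‖ + ‖B‖) ?_
    filter_upwards [self_mem_nhdsWithin, nhdsWithin_le_nhds (Iio_mem_nhds one_pos)] with s hs hs1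
    have h0 : (0 : ℝ) < s := hs
    have h1 : s < 1 := hs1
    refine (norm_add_le _ _).trans ?_
    rw [norm_smul, norm_smul, norm_pow, Complex.norm_real, Real.norm_of_nonneg h0.le]
    have : s ^ 2 * ‖B‖ ≤ s * ‖B‖ :=
      mul_le_mul_of_nonneg_right (by nlinarith) (norm_nonneg _)
    linarith
  -- Three terms of the series form the Taylor polynomial of degree two, with error `O(‖y‖³)`; as `y
  -- = O(s)`, the error is `o(s²)`.
  have hT := ((NormedSpace.exp_hasFPowerSeriesAt_zero (𝕂 := ℂ) (𝔸 := 𝔸)).isBigO_sub_partialSum_pow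
    3).comp_tendsto hy0
  have hp : ∀ x : 𝔸, (NormedSpace.expSeries ℂ 𝔸).partialSum 3 x =
      1 + x + (1 / 2 : ℂ) • (x * x) := by
    intro x
    simp only [FormalMultilinearSeries.partialSum, NormedSpace.expSeries_apply_eq]
    simp [Finset.sum_range_succ, pow_two, Nat.factorial]
  have hO : (fun s : ℝ => NormedSpace.exp (y s) - (1 + y s + (1 / 2 : ℂ) • (y s * y s)))
      =O[𝓝[>] 0] fun s : ℝ => s ^ 3 := by
    have h1 : (fun s : ℝ => ‖y s‖ ^ 3) =O[𝓝[>] 0] fun s : ℝ => s ^ 3 := hyO.norm_left.pow 3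
    refine (hT.trans h1).congr_left fun s => ?_
    simp only [Function.comp_apply, zero_add, hp]
  have ho : Tendsto (fun s : ℝ => ((s : ℂ) ^ 2)⁻¹ •
      (NormedSpace.exp (y s) - (1 + y s + (1 / 2 : ℂ) • (y s * y s)))) (𝓝[>] 0) (𝓝 0) := by
    have h1 : (fun s : ℝ => s ^ 3) =o[𝓝[>] 0] fun s : ℝ => s ^ 2 :=
      (Asymptotics.isLittleO_pow_pow (by norm_num : 2 < 3)).mono nhdsWithin_le_nhds
    have h2 := (hO.trans_isLittleO h1).tendsto_inv_smul_nhds_zero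
    refine h2.congr fun s => ?_
    rw [← Complex.coe_smul]
    push_cast
    rfl
  have hrest : Tendsto (fun s : ℝ => B + (1 / 2 : ℂ) • (A * A) +
      (1 / 2 : ℂ) • ((s : ℂ) • (A * B + B * A) + ((s : ℂ) ^ 2) • (B * B))) (𝓝[>] 0)
      (𝓝 (B + (1 / 2 : ℂ) • (A * A))) := by
    have hc : Continuous fun s : ℝ => B + (1 / 2 : ℂ) • (A * A) +
      (1 / 2 : ℂ) • ((s : ℂ) • (A * B + B * A) + ((s : ℂ) ^ 2) • (B * B)) := by fun_prop
    have h := hc.tendsto 0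
    simp only [Complex.ofReal_zero, zero_smul, zero_pow two_ne_zero, add_zero, smul_zero] at h
    exact h.mono_left nhdsWithin_le_nhds
  have hsum := ho.add hrest
  rw [zero_add] at hsum
  refine hsum.congr' ?_
  filter_upwards [self_mem_nhdsWithin] with s hs
  have h0 : (s : ℂ) ≠ 0 := Complex.ofReal_ne_zero.mpr (ne_of_gt hs)
  have h4 : B + (1 / 2 : ℂ) • (A * A) +
      (1 / 2 : ℂ) • ((s : ℂ) • (A * B + B * A) + ((s : ℂ) ^ 2) • (B * B)) =
      ((s : ℂ) ^ 2)⁻¹ • (((s : ℂ) ^ 2) • B + (1 / 2 : ℂ) • (y s * y s)) := by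
    have h5 : y s * y s = ((s : ℂ) ^ 2) • (A * A + (s : ℂ) • (A * B + B * A) +
        ((s : ℂ) ^ 2) • (B * B)) := by
      simp only [hy, add_mul, mul_add, smul_mul_assoc, mul_smul_comm, smul_smul, smul_add]
      module
    rw [h5, smul_comm (1 / 2 : ℂ), ← smul_add, inv_smul_smul₀ (pow_ne_zero 2 h0)]
    module
  rw [h4, ← smul_add]
  congr 1
  simp only [hy]
  abel

/-- Second-order expansion of `exp (s A + s² B) Z exp (s A' + s² B')` at `s = 0`. -/
theorem tendsto_exp_mul_mul_exp [CompleteSpace 𝔸] (A B A' B' Z : 𝔸) :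
    Tendsto (fun s : ℝ => ((s : ℂ) ^ 2)⁻¹ •
      (NormedSpace.exp ((s : ℂ) • A + ((s : ℂ) ^ 2) • B) * Z *
        NormedSpace.exp ((s : ℂ) • A' + ((s : ℂ) ^ 2) • B') - Z -
          (s : ℂ) • (A * Z + Z * A'))) (𝓝[>] 0)
      (𝓝 ((B + (1 / 2 : ℂ) • (A * A)) * Z + Z * (B' + (1 / 2 : ℂ) • (A' * A')) +
        A * Z * A')) := by
  have hD := tendsto_exp_second_order A B
  have hD' := tendsto_exp_second_order A' B'
  set D : ℝ → 𝔸 := fun s => ((s : ℂ) ^ 2)⁻¹ •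
      (NormedSpace.exp ((s : ℂ) • A + ((s : ℂ) ^ 2) • B) - 1 - (s : ℂ) • A) with hDdef
  set D' : ℝ → 𝔸 := fun s => ((s : ℂ) ^ 2)⁻¹ •
      (NormedSpace.exp ((s : ℂ) • A' + ((s : ℂ) ^ 2) • B') - 1 - (s : ℂ) • A') with hDdef'
  have hs : Tendsto (fun s : ℝ => (s : ℂ)) (𝓝[>] 0) (𝓝 0) := by
    have h := Complex.continuous_ofReal.tendsto 0
    rw [Complex.ofReal_zero] at h
    exact h.mono_left nhdsWithin_le_nhds
  have hlim := ((hD.mul_const Z).add (hD'.const_mul Z)).add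
    (tendsto_const_nhds (x := A * Z * A') (f := 𝓝[>] (0 : ℝ))) |>.add
    (hs.smul ((hD'.const_mul (A * Z)).add ((hD.mul_const Z).mul_const A'))) |>.add
    ((hs.pow 2).smul ((hD.mul_const Z).mul hD'))
  rw [zero_smul, zero_pow two_ne_zero, zero_smul, add_zero, add_zero] at hlim
  refine hlim.congr' ?_
  filter_upwards [self_mem_nhdsWithin] with s hs
  have h0 : (s : ℂ) ≠ 0 := Complex.ofReal_ne_zero.mpr (ne_of_gt hs)
  have e1 : NormedSpace.exp ((s : ℂ) • A + ((s : ℂ) ^ 2) • B) =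
      1 + (s : ℂ) • A + ((s : ℂ) ^ 2) • D s := by
    rw [hDdef, smul_inv_smul₀ (pow_ne_zero 2 h0)]
    abel
  have e2 : NormedSpace.exp ((s : ℂ) • A' + ((s : ℂ) ^ 2) • B') =
      1 + (s : ℂ) • A' + ((s : ℂ) ^ 2) • D' s := by
    rw [hDdef', smul_inv_smul₀ (pow_ne_zero 2 h0)]
    abel
  rw [e1, e2, eq_inv_smul_iff₀ (pow_ne_zero 2 h0)]
  simp only [add_mul, mul_add, one_mul, mul_one, smul_mul_assoc, mul_smul_comm, mul_assoc]
  module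

end Banach

/-! ### Semigroups on finite-dimensional spaces -/

section Semigroup

variable {V W : Type*} [NormedAddCommGroup V] [NormedSpace ℂ V] [FiniteDimensional ℂ V]
  [NormedAddCommGroup W] [NormedSpace ℂ W] [FiniteDimensional ℂ W]

/-- Convergence of operators on a finite-dimensional space is pointwise convergence. -/
theorem tendsto_clm_of_pointwise {ι : Type*} {l : Filter ι} {F : ι → V →L[ℂ] V} {X : V →L[ℂ] V}
    (h : ∀ v, Tendsto (fun i => F i v) l (𝓝 (X v))) : Tendsto F l (𝓝 X) := by
  let ev : (V →L[ℂ] V) →ₗ[ℂ] (V → V) :=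
    { toFun := fun f => f
      map_add' := fun _ _ => rfl
      map_smul' := fun _ _ => rfl }
  -- An injective linear map out of a finite-dimensional space is an embedding, and the target
  -- carries the topology of pointwise convergence.
  have hev : Topology.IsClosedEmbedding ev :=
    LinearMap.isClosedEmbedding_of_injective
      (LinearMap.ker_eq_bot.mpr fun f g hfg => ContinuousLinearMap.ext fun v => congrFun hfg v)
  rw [hev.isInducing.tendsto_nhds_iff, tendsto_pi_nhds]
  exact h

/-- Intertwining passes through the exponential series term by term. It serves both for restricting
the semigroup to the subspace and for fixed points. -/
theorem exp_smul_apply_comm (A : V →L[ℂ] V) (B : W →L[ℂ] W) (J : W →L[ℂ] V)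
    (h : ∀ w, A (J w) = J (B w)) (t : ℂ) (w : W) :
    NormedSpace.exp (t • A) (J w) = J (NormedSpace.exp (t • B) w) := by
  have : CompleteSpace V := FiniteDimensional.complete ℂ V
  have : CompleteSpace W := FiniteDimensional.complete ℂ W
  have hA := (NormedSpace.exp_series_hasSum_exp' (𝕂 := ℂ) (t • A)).mapL
    (ContinuousLinearMap.apply ℂ V (J w))
  have hB := (NormedSpace.exp_series_hasSum_exp' (𝕂 := ℂ) (t • B)).mapL
    (J.comp (ContinuousLinearMap.apply ℂ W w))
  have hpow : ∀ n : ℕ, ((t • A) ^ n) (J w) = J (((t • B) ^ n) w) := by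
    intro n
    induction n with
    | zero => simp
    | succ n ih => simp [pow_succ', ih, h]
  refine hA.unique ?_
  convert hB using 1
  · funext n
    simp [hpow]
  · rfl

theorem generator_apply_eq_zero (A : V →L[ℂ] V) {v : V}
    (h : ∀ t : ℝ, 0 ≤ t → NormedSpace.exp ((t : ℂ) • A) v = v) : A v = 0 := by
  have : CompleteSpace V := FiniteDimensional.complete ℂ V
  have h1 := ((ContinuousLinearMap.apply ℂ V v).continuous.tendsto _).comp (tendsto_slope_exp A)
  refine tendsto_nhds_unique h1 (tendsto_const_nhds.congr' ?_)
  filter_upwards [self_mem_nhdsWithin] with τ hτ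
  have h2 := h τ (le_of_lt hτ)
  change 0 = (τ : ℂ)⁻¹ • (NormedSpace.exp ((τ : ℂ) • A) v - v)
  rw [h2, sub_self, smul_zero]

end Semigroup

/-! ### The continuous-time limit of a repeated interaction process -/

section ExpLin

variable {V W : Type*} [NormedAddCommGroup V] [NormedSpace ℂ V] [FiniteDimensional ℂ V]
  [NormedAddCommGroup W] [NormedSpace ℂ W] [FiniteDimensional ℂ W]

/-- The semigroup `exp (t G)` on a finite-dimensional normed space. -/
def expLin (G : V →ₗ[ℂ] V) (t : ℝ) : V →ₗ[ℂ] V :=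
  (NormedSpace.exp ((t : ℂ) • LinearMap.toContinuousLinearMap G) : V →L[ℂ] V)

theorem expLin_apply_comm (G : V →ₗ[ℂ] V) (G' : W →ₗ[ℂ] W) (J : W →ₗ[ℂ] V)
    (h : ∀ w, G (J w) = J (G' w)) (t : ℝ) (w : W) :
    expLin G t (J w) = J (expLin G' t w) :=
  exp_smul_apply_comm (LinearMap.toContinuousLinearMap G) (LinearMap.toContinuousLinearMap G')
    (LinearMap.toContinuousLinearMap J) h t w

theorem expLin_zero (t : ℝ) (v : V) : expLin (0 : V →ₗ[ℂ] V) t v = v := by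
  simp [expLin]

/-- The inclusion of the line through `v` intertwines the zero generator on `ℂ` with `G`. -/
theorem expLin_apply_eq_self (G : V →ₗ[ℂ] V) {v : V} (h : G v = 0) (t : ℝ) :
    expLin G t v = v := by
  have h1 := expLin_apply_comm G (0 : ℂ →ₗ[ℂ] ℂ) (LinearMap.toSpanSingleton ℂ V v)
    (fun z => by simp [h]) t 1
  rw [expLin_zero] at h1
  simpa using h1

theorem generator_eq_zero_of_expLin (G : V →ₗ[ℂ] V) {v : V}
    (h : ∀ t : ℝ, 0 ≤ t → expLin G t v = v) : G v = 0 :=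
  generator_apply_eq_zero (LinearMap.toContinuousLinearMap G) h

theorem tendsto_iterate_expLin {F : ℝ → V →ₗ[ℂ] V} {G : V →ₗ[ℂ] V}
    (hF : ∀ v, Tendsto (fun τ : ℝ => (τ : ℂ)⁻¹ • (F τ v - v)) (𝓝[>] 0) (𝓝 (G v))) {t : ℝ}
    (ht : 0 ≤ t) (v : V) :
    Tendsto (fun τ : ℝ => (F τ)^[⌊t / τ⌋₊] v) (𝓝[>] 0) (𝓝 (expLin G t v)) := by
  have : CompleteSpace V := FiniteDimensional.complete ℂ V
  have h1 : Tendsto (fun τ : ℝ => (τ : ℂ)⁻¹ • (LinearMap.toContinuousLinearMap (F τ) - 1)) (𝓝[>] 0)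
      (𝓝 (LinearMap.toContinuousLinearMap G)) :=
    tendsto_clm_of_pointwise fun v => hF v
  have h2 := tendsto_pow_floor ContinuousLinearMap.norm_id_le h1 ht
  refine (((ContinuousLinearMap.apply ℂ V v).continuous.tendsto _).comp h2).congr fun τ => ?_
  change (LinearMap.toContinuousLinearMap (F τ) ^ ⌊t / τ⌋₊) v = _
  induction ⌊t / τ⌋₊ with
  | zero => rfl
  | succ k ih =>
    rw [pow_succ', Function.iterate_succ_apply', ← ih]
    rfl

end ExpLin

section Matrices

attribute [local instance] Matrix.linftyOpNormedRing Matrix.linftyOpNormedAlgebra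

variable {n m : Type} [Fintype n] [DecidableEq n] [Fintype m] [DecidableEq m]

/-- The semigroup `exp (t G)` on matrices. -/
def semigroup (G : Matrix n n ℂ →ₗ[ℂ] Matrix n n ℂ) (t : ℝ) :
    Matrix n n ℂ →ₗ[ℂ] Matrix n n ℂ :=
  expLin G t

theorem semigroup_apply_comm (G : Matrix n n ℂ →ₗ[ℂ] Matrix n n ℂ)
    (G' : Matrix m m ℂ →ₗ[ℂ] Matrix m m ℂ) (J : Matrix m m ℂ →ₗ[ℂ] Matrix n n ℂ)
    (h : ∀ ρ, G (J ρ) = J (G' ρ)) (t : ℝ) (ρ : Matrix m m ℂ) :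
    semigroup G t (J ρ) = J (semigroup G' t ρ) :=
  expLin_apply_comm G G' J h t ρ

theorem semigroup_apply_eq_self (G : Matrix n n ℂ →ₗ[ℂ] Matrix n n ℂ) {ρ : Matrix n n ℂ}
    (h : G ρ = 0) (t : ℝ) : semigroup G t ρ = ρ :=
  expLin_apply_eq_self G h t

theorem generator_eq_zero_of_semigroup (G : Matrix n n ℂ →ₗ[ℂ] Matrix n n ℂ) {ρ : Matrix n n ℂ}
    (h : ∀ t : ℝ, 0 ≤ t → semigroup G t ρ = ρ) : G ρ = 0 :=
  generator_eq_zero_of_expLin G h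

theorem tendsto_iterate_semigroup {F : ℝ → Matrix n n ℂ →ₗ[ℂ] Matrix n n ℂ}
    {G : Matrix n n ℂ →ₗ[ℂ] Matrix n n ℂ}
    (hF : ∀ ρ, Tendsto (fun τ : ℝ => (τ : ℂ)⁻¹ • (F τ ρ - ρ)) (𝓝[>] 0) (𝓝 (G ρ))) {t : ℝ}
    (ht : 0 ≤ t) (ρ : Matrix n n ℂ) :
    Tendsto (fun τ : ℝ => (F τ)^[⌊t / τ⌋₊] ρ) (𝓝[>] 0) (𝓝 (semigroup G t ρ)) :=
  tendsto_iterate_expLin hF ht ρ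

theorem tendsto_matrix_exp_mul_mul_exp (A B A' B' Z : Matrix n n ℂ) :
    Tendsto (fun s : ℝ => ((s : ℂ) ^ 2)⁻¹ •
      (NormedSpace.exp ((s : ℂ) • A + ((s : ℂ) ^ 2) • B) * Z *
        NormedSpace.exp ((s : ℂ) • A' + ((s : ℂ) ^ 2) • B') - Z -
          (s : ℂ) • (A * Z + Z * A'))) (𝓝[>] 0)
      (𝓝 ((B + (1 / 2 : ℂ) • (A * A)) * Z + Z * (B' + (1 / 2 : ℂ) • (A' * A')) +
        A * Z * A')) :=
  tendsto_exp_mul_mul_exp A B A' B' Z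

end Matrices

/-! ### One interaction step and its expansion in the square root of its duration -/

section Interaction

variable {n m : Type} [Fintype m]

/-- The partial trace over the second factor, as a linear map. -/
def partialTrLin : Matrix (n × m) (n × m) ℂ →ₗ[ℂ] Matrix n n ℂ where
  toFun := partialTr
  map_add' X Y := by
    ext
    simp [partialTr, Finset.sum_add_distrib]
  map_smul' c X := by
    ext
    simp [partialTr, Finset.mul_sum]

theorem partialTrLin_kronecker (A : Matrix n n ℂ) (B : Matrix m m ℂ) :
    partialTrLin (A ⊗ₖ B) = B.trace • A := by
  ext s s'
  simp [partialTrLin, partialTr, Matrix.trace, Finset.mul_sum, mul_comm]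

theorem continuous_partialTrLin :
    Continuous (partialTrLin : Matrix (n × m) (n × m) ℂ →ₗ[ℂ] Matrix n n ℂ) := by
  refine continuous_matrix fun i j => ?_
  change Continuous fun X : Matrix (n × m) (n × m) ℂ => ∑ b, X (i, b) (j, b)
  exact continuous_finsetSum _ fun b _ => continuous_id.matrix_elem _ _

variable [Fintype n] [DecidableEq n] [DecidableEq m]

/-- One interaction, as a linear map. -/
def interactionStepLin (HS : Matrix n n ℂ) (HB : Matrix m m ℂ)
    (V : Matrix (n × m) (n × m) ℂ) (ω : Matrix m m ℂ) (τ : ℝ) :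
    Matrix n n ℂ →ₗ[ℂ] Matrix n n ℂ where
  toFun := interactionStep HS HB V ω τ
  map_add' ρ ρ' := by
    simp only [interactionStep, Matrix.add_kronecker, mul_add, add_mul]
    exact map_add partialTrLin _ _
  map_smul' c ρ := by
    simp only [interactionStep, Matrix.smul_kronecker, mul_smul_comm, smul_mul_assoc]
    exact map_smul partialTrLin _ _

/-- The hypotheses `h1` and `h2` kill the term of order `√τ`, which would otherwise diverge after
division by `τ`; `G` is then the coefficient of order `τ`. -/
theorem isContinuousTimeLimit_semigroup {HS : Matrix n n ℂ} {HB : Matrix m m ℂ}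
    {V : Matrix (n × m) (n × m) ℂ} {ω : Matrix m m ℂ} (hω : ω.trace = 1)
    (h1 : ∀ ρ : Matrix n n ℂ, partialTrLin (V * (ρ ⊗ₖ ω)) = 0)
    (h2 : ∀ ρ : Matrix n n ℂ, partialTrLin ((ρ ⊗ₖ ω) * V) = 0)
    {G : Matrix n n ℂ →ₗ[ℂ] Matrix n n ℂ}
    (hG : ∀ ρ : Matrix n n ℂ, G ρ = partialTrLin
      ((-(Complex.I • (HS ⊗ₖ 1 + 1 ⊗ₖ HB)) - (1 / 2 : ℂ) • (V * V)) * (ρ ⊗ₖ ω) +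
        (ρ ⊗ₖ ω) * (Complex.I • (HS ⊗ₖ 1 + 1 ⊗ₖ HB) - (1 / 2 : ℂ) • (V * V)) +
          V * (ρ ⊗ₖ ω) * V)) :
    IsContinuousTimeLimit HS HB V ω (semigroup G) := by
  intro t ht ρ
  set H : Matrix (n × m) (n × m) ℂ := HS ⊗ₖ 1 + 1 ⊗ₖ HB with hH
  have hF : ∀ ρ, Tendsto (fun τ : ℝ => (τ : ℂ)⁻¹ • (interactionStepLin HS HB V ω τ ρ - ρ)) (𝓝[>] 0)
      (𝓝 (G ρ)) := by
    intro ρ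
    have h3 := tendsto_matrix_exp_mul_mul_exp (-(Complex.I • V)) (-(Complex.I • H)) (Complex.I • V)
      (Complex.I • H) (ρ ⊗ₖ ω)
    have hsqrt : Tendsto Real.sqrt (𝓝[>] 0) (𝓝[>] 0) := by
      refine tendsto_nhdsWithin_iff.mpr ⟨?_, ?_⟩
      · have h := Real.continuous_sqrt.tendsto 0
        rw [Real.sqrt_zero] at h
        exact h.mono_left nhdsWithin_le_nhds
      · filter_upwards [self_mem_nhdsWithin] with τ hτ
        exact Real.sqrt_pos.mpr hτ
    have h4 := (continuous_partialTrLin.tendsto _).comp (h3.comp hsqrt)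
    have h5 : partialTrLin ((-(Complex.I • H) + (1 / 2 : ℂ) • (-(Complex.I • V) * -(Complex.I • V))) *
        (ρ ⊗ₖ ω) + (ρ ⊗ₖ ω) * (Complex.I • H + (1 / 2 : ℂ) • (Complex.I • V * Complex.I • V)) +
          -(Complex.I • V) * (ρ ⊗ₖ ω) * Complex.I • V) = G ρ := by
      rw [hG]
      have e1 : Complex.I • V * Complex.I • V = -(V * V) := by
        rw [smul_mul_smul_comm, Complex.I_mul_I, neg_one_smul]
      have e2 : -(Complex.I • V) * (ρ ⊗ₖ ω) * Complex.I • V = V * (ρ ⊗ₖ ω) * V := by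
        rw [neg_mul, neg_mul, smul_mul_assoc, smul_mul_smul_comm, Complex.I_mul_I,
          neg_one_smul, neg_neg]
      rw [neg_mul_neg, e1, e2, smul_neg, ← sub_eq_add_neg, ← sub_eq_add_neg]
    rw [h5] at h4
    refine h4.congr' ?_
    filter_upwards [self_mem_nhdsWithin] with τ hτ
    have hτ0 : (0 : ℝ) < τ := hτ
    have hs2 : ((Real.sqrt τ : ℝ) : ℂ) ^ 2 = τ := by
      rw [← Complex.ofReal_pow, Real.sq_sqrt hτ0.le]
    have hs1 : (τ : ℂ) * ((1 / Real.sqrt τ : ℝ) : ℂ) = (Real.sqrt τ : ℝ) := by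
      rw [← Complex.ofReal_mul]
      congr 1
      rw [mul_one_div, Real.div_sqrt]
    -- With `s = √τ` the exponent is `s(iV) + s²(iH)`, the form required by the second-order
    -- expansion.
    have hham : (Complex.I * (τ : ℂ)) • totalHam HS HB V τ =
        ((Real.sqrt τ : ℝ) : ℂ) • (Complex.I • V) + (τ : ℂ) • (Complex.I • H) := by
      rw [totalHam, hH, add_right_comm, smul_add, smul_smul, mul_assoc, hs1, smul_smul, smul_smul,
        mul_comm Complex.I, mul_comm Complex.I, add_comm]
    simp only [Function.comp_apply, hs2, map_smul, map_sub, map_add, smul_neg, ← neg_add]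
    rw [← hham, ← neg_smul]
    change (τ : ℂ)⁻¹ • (interactionStep HS HB V ω τ ρ - partialTrLin (ρ ⊗ₖ ω) - _) =
      (τ : ℂ)⁻¹ • (interactionStep HS HB V ω τ ρ - ρ)
    rw [partialTrLin_kronecker, hω, one_smul, neg_mul, smul_mul_assoc, mul_smul_comm, map_neg,
      map_smul, map_smul, h1, h2, smul_zero, neg_zero, add_zero, smul_zero, sub_zero]
  exact tendsto_iterate_semigroup hF ht ρ

end Interaction

/-! ### Quasi-free states -/

theorem isClosed_posSemidef {n : Type} [Fintype n] :
    IsClosed {M : Matrix n n ℂ | M.PosSemidef} := by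
  have : {M : Matrix n n ℂ | M.PosSemidef} =
      {M | Mᴴ = M} ∩ ⋂ x : n → ℂ, {M | 0 ≤ star x ⬝ᵥ (M *ᵥ x)} := by
    ext M
    simp [Matrix.posSemidef_iff_dotProduct_mulVec, Matrix.IsHermitian]
  rw [this]
  refine (isClosed_eq (by fun_prop) continuous_id).inter (isClosed_iInter fun x => ?_)
  exact isClosed_le continuous_const
    (continuous_const.dotProduct (continuous_id.matrix_mulVec continuous_const))

/-- Positivity and nonzero trace come from `exp(-βH) = D^*D` with `D = exp(-βH/2)` invertible;
evenness holds because `H` is quadratic. All three properties are closed conditions, so they pass to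
quasi-free states. -/
theorem isGaussian_spec {K : ℕ} {ω : Op K} (h : IsGaussian ω) :
    ω.PosSemidef ∧ ω.trace = 1 ∧ parity K * ω = ω * parity K := by
  obtain ⟨β, H, ⟨hH, T, hT⟩, rfl⟩ := h
  have hHq : H ∈ quadSpan K := by
    rw [hT]
    refine Submodule.sum_mem _ fun i _ => Submodule.sum_mem _ fun j _ => Submodule.smul_mem _ _ ?_
    rw [← majLin_single, ← majLin_single]
    exact majLin_mul_mem_quadSpan _ _
  have hherm : ((-(β : ℂ) / 2) • H).IsHermitian := by
    rw [Matrix.IsHermitian, Matrix.conjTranspose_smul, hH.eq]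
    simp
  set D : Op K := NormedSpace.exp ((-(β : ℂ) / 2) • H) with hD
  have hexp : NormedSpace.exp (-(β : ℂ) • H) = Dᴴ * D := by
    rw [hherm.exp.eq, hD, ← Matrix.exp_add_of_commute _ _ (Commute.refl _), ← add_smul]
    congr 2
    ring
  have hpsd : (Dᴴ * D).PosSemidef := Matrix.posSemidef_conjTranspose_mul_self D
  have htr : (Dᴴ * D).trace ≠ 0 := by
    intro h0
    have h1 := Matrix.trace_conjTranspose_mul_self_eq_zero_iff.mp h0
    have h2 := Matrix.isUnit_exp ((-(β : ℂ) / 2) • H)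
    rw [← hD, h1] at h2
    exact not_isUnit_zero h2
  rw [hexp]
  refine ⟨?_, ?_, ?_⟩
  · refine hpsd.smul ?_
    obtain ⟨r, hr, hr'⟩ := Complex.nonneg_iff.mp hpsd.trace_nonneg |>.imp_left id |> fun h =>
      (⟨_, h.1, Complex.ext rfl h.2.symm⟩ : ∃ r : ℝ, 0 ≤ r ∧ (Dᴴ * D).trace = (r : ℂ))
    rw [hr', ← Complex.ofReal_inv]
    exact Complex.zero_le_real.mpr (inv_nonneg.mpr hr)
  · rw [Matrix.trace_smul, smul_eq_mul, inv_mul_cancel₀ htr]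
  · rw [mul_smul_comm, smul_mul_assoc, ← hexp]
    congr 1
    have : Commute (parity K) (-(β : ℂ) • H) := Commute.smul_right (parity_mul_quad hHq) _
    exact this.exp_right

theorem isQuasiFree_spec {K : ℕ} {ω : Op K} (h : IsQuasiFree ω) :
    ω.PosSemidef ∧ ω.trace = 1 ∧ parity K * ω = ω * parity K := by
  have hcl : IsClosed {ω : Op K | ω.PosSemidef ∧ ω.trace = 1 ∧ parity K * ω = ω * parity K} :=
    isClosed_posSemidef.inter ((isClosed_eq continuous_id.matrix_trace continuous_const).inter
      (isClosed_eq (continuous_const.mul continuous_id) (continuous_id.mul continuous_const)))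
  exact closure_minimal (fun _ => isGaussian_spec) hcl h

/-! ### The generator of a quasi-free process -/

/-- The parity factor of the bath operators in the interaction. -/
def bathTwist (E : TensorIso) (K : ℕ) : Op K :=
  match E with
  | TensorIso.SB => 1
  | TensorIso.BS => parity K

/-- The sign by which the parity factors enter products of two bath operators. -/
def twistSign (E : TensorIso) : ℂ :=
  match E with
  | TensorIso.SB => 1
  | TensorIso.BS => -1

theorem twistSign_mul_self (E : TensorIso) : twistSign E * twistSign E = 1 := by
  cases E <;> simp [twistSign]

section Generator

variable {L K : ℕ}

/-- Puts both identifications into one form, with the parity on the system factor for `E_SB` and on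
the bath factor for `E_BS`. -/
theorem interaction_eq (E : TensorIso) (W : Matrix (Fin L ⊕ Fin L) (Fin K ⊕ Fin K) ℝ) :
    interaction E W = ∑ j, (Complex.I • (majLin (fun i => (W i j : ℂ)) * twist E L)) ⊗ₖ
      (bathTwist E K * majorana j) := by
  have key : ∀ i j, majoranaS (L := L) E i * majoranaB E j =
      (majorana i * twist E L) ⊗ₖ (bathTwist E K * majorana j) := by
    intro i j
    cases E <;> simp [majoranaS, majoranaB, twist, bathTwist, ← Matrix.mul_kronecker_mul]
  rw [interaction, Finset.sum_comm]
  refine Finset.sum_congr rfl fun j _ => ?_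
  simp only [key, majLin_apply, Finset.sum_mul, Finset.smul_sum, smul_mul_assoc, smul_smul]
  ext x y
  simp only [Matrix.sum_apply, Matrix.smul_apply, Matrix.kroneckerMap_apply, smul_eq_mul,
    Finset.sum_mul, mul_assoc]

theorem bathTwist_mul_majorana_mul (E : TensorIso) (j k : Fin K ⊕ Fin K) :
    bathTwist E K * majorana j * (bathTwist E K * majorana k) =
      twistSign E • (majorana j * majorana k) := by
  cases E
  · simp [bathTwist, twistSign]
  · rw [bathTwist, twistSign, parity_mul_majorana, ← mul_assoc, neg_mul, mul_assoc (majorana j),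
      parity_mul_parity, mul_one, neg_one_smul, neg_mul]

/-- The factor `i² = -1` is compensated for `E_SB` by moving the parity past `majLin y`. For `E_BS`
it stays as `twistSign` and cancels against the same sign in `bathTwist_mul_majorana_mul`. -/
theorem jumpOp_mul (E : TensorIso) (x y : Fin L ⊕ Fin L → ℂ) (ρ : Op L) :
    (Complex.I • (majLin x * twist E L)) * ρ * (Complex.I • (majLin y * twist E L)) =
      twistSign E • (majLin x * (twist E L * ρ * twist E L) * majLin y) := by
  rw [smul_mul_assoc, smul_mul_smul_comm, Complex.I_mul_I]
  cases E
  · rw [twist, twistSign, one_smul, ← neg_eq_iff_eq_neg.mpr (parity_mul_majLin y)]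
    simp only [mul_neg, neg_smul, one_smul, neg_neg, mul_assoc]
  · simp [twist, twistSign, mul_assoc]

theorem jumpOp_mul_jumpOp (E : TensorIso) (x y : Fin L ⊕ Fin L → ℂ) :
    (Complex.I • (majLin x * twist E L)) * (Complex.I • (majLin y * twist E L)) =
      twistSign E • (majLin x * majLin y) := by
  have h := jumpOp_mul E x y 1
  rwa [mul_one, mul_one, twist_mul_twist, mul_one] at h

/-- Conjugation by the parity preserves the trace and fixes `ω`, but changes the sign of `X`. -/
theorem trace_odd_mul_eq_zero {X ω : Op K} (hX : parity K * X = -(X * parity K))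
    (hω : parity K * ω = ω * parity K) : (X * ω).trace = 0 := by
  have h1 : (X * ω).trace = -(X * ω).trace := by
    calc (X * ω).trace = (parity K * (parity K * X) * ω).trace := by
          rw [← mul_assoc, parity_mul_parity, one_mul]
      _ = -(parity K * (X * ω * parity K)).trace := by
          rw [hX, mul_assoc, mul_assoc X ω, ← hω]
          simp [mul_assoc]
      _ = -(X * ω).trace := by
          rw [Matrix.trace_mul_comm, mul_assoc, parity_mul_parity, mul_one]
  linear_combination (1 / 2 : ℂ) * h1

theorem parity_mul_bath (E : TensorIso) (j : Fin K ⊕ Fin K) :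
    parity K * (bathTwist E K * majorana j) = -(bathTwist E K * majorana j * parity K) := by
  cases E
  · simp [bathTwist, parity_mul_majorana]
  · rw [bathTwist, mul_assoc, ← mul_neg, ← parity_mul_majorana]

/-- Coefficients of the jumps of the process with coupling `W` and bath state `D D^*`. -/
def jumpCoeff (D : Op K) (W : Matrix (Fin L ⊕ Fin L) (Fin K ⊕ Fin K) ℝ) (b : Occ K × Occ K) :
    Fin L ⊕ Fin L → ℂ :=
  fun i => ∑ j, (majorana j * D) b.1 b.2 * (W i j : ℂ)

theorem majLin_jumpCoeff (D : Op K) (W : Matrix (Fin L ⊕ Fin L) (Fin K ⊕ Fin K) ℝ)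
    (b : Occ K × Occ K) : (majLin (jumpCoeff D W b) : Op L) =
      ∑ j, (majorana j * D) b.1 b.2 • majLin fun i => (W i j : ℂ) := by
  rw [← Finset.sum_congr rfl fun j _ => map_smul majLin _ _, ← map_sum]
  congr 1
  funext i
  simp [jumpCoeff, Finset.sum_apply]

/-- The two-point matrix of the bath state `DD^*` is the Gram matrix of the `γ_j D`. Indexing the
jumps by the entries of these matrices gives a Lindblad form without diagonalizing that matrix. -/
theorem sum_star_mul_eq_trace (D : Op K) (j k : Fin K ⊕ Fin K) :
    ∑ b : Occ K × Occ K, star ((majorana j * D) b.1 b.2) * (majorana k * D) b.1 b.2 =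
      (majorana j * majorana k * (D * Dᴴ)).trace := by
  have h1 : (majorana j * majorana k * (D * Dᴴ)).trace =
      ((majorana j * D)ᴴ * (majorana k * D)).trace := by
    rw [← mul_assoc, Matrix.trace_mul_comm, Matrix.conjTranspose_mul, conjTranspose_majorana]
    simp only [mul_assoc]
  rw [h1, Fintype.sum_prod_type, Finset.sum_comm, Matrix.trace]
  simp only [Matrix.diag, Matrix.mul_apply (M := (majorana j * D)ᴴ), Matrix.conjTranspose_apply]

theorem sum_conjTranspose_jump_mul (D : Op K)
    (W : Matrix (Fin L ⊕ Fin L) (Fin K ⊕ Fin K) ℝ) :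
    ∑ b, (majLin (jumpCoeff D W b) : Op L)ᴴ * majLin (jumpCoeff D W b) =
      ∑ j, ∑ k, (majorana j * majorana k * (D * Dᴴ)).trace •
        (majLin (fun i => (W i j : ℂ)) * majLin fun i => (W i k : ℂ)) := by
  have hr : ∀ j, (majLin fun i => (W i j : ℂ) : Op L)ᴴ = majLin fun i => (W i j : ℂ) := by
    intro j
    rw [conjTranspose_majLin]
    congr 1
    funext i
    simp
  simp only [majLin_jumpCoeff, Matrix.conjTranspose_sum, Matrix.conjTranspose_smul, hr,
    Finset.sum_mul_sum, smul_mul_smul_comm, ← sum_star_mul_eq_trace, Finset.sum_smul]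
  rw [Finset.sum_comm]
  refine Finset.sum_congr rfl fun j _ => ?_
  rw [Finset.sum_comm]

theorem sum_jump_mul_conjTranspose (D : Op K)
    (W : Matrix (Fin L ⊕ Fin L) (Fin K ⊕ Fin K) ℝ) (ρ : Op L) :
    ∑ b, (majLin (jumpCoeff D W b) : Op L) * ρ * (majLin (jumpCoeff D W b))ᴴ =
      ∑ j, ∑ k, (majorana k * majorana j * (D * Dᴴ)).trace •
        (majLin (fun i => (W i j : ℂ)) * ρ * majLin fun i => (W i k : ℂ)) := by
  have hr : ∀ j, (majLin fun i => (W i j : ℂ) : Op L)ᴴ = majLin fun i => (W i j : ℂ) := by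
    intro j
    rw [conjTranspose_majLin]
    congr 1
    funext i
    simp
  simp only [majLin_jumpCoeff, Matrix.conjTranspose_sum, Matrix.conjTranspose_smul, hr,
    Finset.sum_mul, Finset.mul_sum, smul_mul_assoc, mul_smul_comm, smul_smul, Finset.smul_sum,
    ← sum_star_mul_eq_trace, Finset.sum_smul]
  rw [Finset.sum_comm, Finset.sum_congr rfl fun j _ => Finset.sum_comm, Finset.sum_comm]

/-- The continuous-time limit of a quasi-free process is the semigroup of a Lindblad generator with
quadratic Hamiltonian and linear jumps. -/
theorem RepeatedInteraction.isLimit_semigroup (p : RepeatedInteraction L K) (E : TensorIso)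
    {D : Op K} (hD : p.ω = D * Dᴴ) :
    p.IsLimit E (semigroup (lindblad (quadHam p.RS)
      (fun b => majLin (jumpCoeff D p.W b)) (twist E L))) := by
  obtain ⟨-, htr, hpar⟩ := isQuasiFree_spec p.quasiFree
  set X : Fin K ⊕ Fin K → Op L :=
    fun j => Complex.I • (majLin (fun i => (p.W i j : ℂ)) * twist E L) with hX
  set Y : Fin K ⊕ Fin K → Op K := fun j => bathTwist E K * majorana j with hY
  have hV : interaction E p.W = ∑ j, X j ⊗ₖ Y j := interaction_eq E p.W
  have hYω : ∀ j, (Y j * p.ω).trace = 0 := fun j =>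
    trace_odd_mul_eq_zero (parity_mul_bath E j) hpar
  have hωY : ∀ j, (p.ω * Y j).trace = 0 := fun j => by rw [Matrix.trace_mul_comm, hYω]
  refine isContinuousTimeLimit_semigroup htr (fun ρ => ?_) (fun ρ => ?_) (fun ρ => ?_)
  · rw [hV, Finset.sum_mul, map_sum]
    refine Finset.sum_eq_zero fun j _ => ?_
    rw [← Matrix.mul_kronecker_mul, partialTrLin_kronecker, hYω, zero_smul]
  · rw [hV, Finset.mul_sum, map_sum]
    refine Finset.sum_eq_zero fun j _ => ?_
    rw [← Matrix.mul_kronecker_mul, partialTrLin_kronecker, hωY, zero_smul]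
  · have hYY : ∀ j k, (Y j * Y k * p.ω).trace =
        twistSign E * (majorana j * majorana k * (D * Dᴴ)).trace := fun j k => by
      rw [hY, bathTwist_mul_majorana_mul, smul_mul_assoc, Matrix.trace_smul, smul_eq_mul, hD]
    have hXX : ∀ j k, X j * X k = twistSign E •
        (majLin (fun i => (p.W i j : ℂ)) * majLin fun i => (p.W i k : ℂ)) :=
      fun j k => jumpOp_mul_jumpOp E _ _
    have hS : ∀ j k, (Y j * Y k * p.ω).trace • (X j * X k) =
        (majorana j * majorana k * (D * Dᴴ)).trace •
          (majLin (fun i => (p.W i j : ℂ)) * majLin fun i => (p.W i k : ℂ)) := fun j k => by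
      rw [hYY, hXX, smul_smul, mul_right_comm, twistSign_mul_self, one_mul]
    have e1 : partialTrLin (interaction E p.W * interaction E p.W * (ρ ⊗ₖ p.ω)) =
        (∑ b, (majLin (jumpCoeff D p.W b))ᴴ * majLin (jumpCoeff D p.W b)) * ρ := by
      rw [sum_conjTranspose_jump_mul, hV, Finset.sum_mul_sum]
      simp only [Finset.sum_mul, map_sum, ← Matrix.mul_kronecker_mul, partialTrLin_kronecker,
        ← hS, smul_mul_assoc]
    have e2 : partialTrLin ((ρ ⊗ₖ p.ω) * (interaction E p.W * interaction E p.W)) =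
        ρ * (∑ b, (majLin (jumpCoeff D p.W b))ᴴ * majLin (jumpCoeff D p.W b)) := by
      rw [sum_conjTranspose_jump_mul, hV, Finset.sum_mul_sum]
      simp only [Finset.mul_sum, map_sum, ← Matrix.mul_kronecker_mul, partialTrLin_kronecker,
        ← hS, mul_smul_comm]
      refine Finset.sum_congr rfl fun j _ => Finset.sum_congr rfl fun k _ => ?_
      rw [Matrix.trace_mul_comm]
    -- Here the bath state stands between the two bath operators, so cyclicity reverses their order;
    -- this is the order in `sum_jump_mul_conjTranspose`.
    have e3 : partialTrLin (interaction E p.W * (ρ ⊗ₖ p.ω) * interaction E p.W) =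
        ∑ b, majLin (jumpCoeff D p.W b) * (twist E L * ρ * twist E L) *
          (majLin (jumpCoeff D p.W b))ᴴ := by
      rw [sum_jump_mul_conjTranspose, hV, Finset.sum_mul, Finset.sum_mul_sum]
      simp only [map_sum, ← Matrix.mul_kronecker_mul, partialTrLin_kronecker]
      refine Finset.sum_congr rfl fun j _ => Finset.sum_congr rfl fun k _ => ?_
      rw [Matrix.trace_mul_comm, ← mul_assoc, hYY, hX, jumpOp_mul, smul_smul, mul_right_comm,
        twistSign_mul_self, one_mul]
    -- The bath Hamiltonian contributes only its mean energy, which cancels against the same term in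
    -- `e5`.
    have e4 : partialTrLin ((quadHam p.RS ⊗ₖ 1 + 1 ⊗ₖ quadHam p.RB) * (ρ ⊗ₖ p.ω)) =
        quadHam p.RS * ρ + (quadHam p.RB * p.ω).trace • ρ := by
      rw [add_mul, map_add, ← Matrix.mul_kronecker_mul, ← Matrix.mul_kronecker_mul, one_mul,
        one_mul, partialTrLin_kronecker, partialTrLin_kronecker, htr, one_smul]
    have e5 : partialTrLin ((ρ ⊗ₖ p.ω) * (quadHam p.RS ⊗ₖ 1 + 1 ⊗ₖ quadHam p.RB)) =
        ρ * quadHam p.RS + (quadHam p.RB * p.ω).trace • ρ := by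
      rw [mul_add, map_add, ← Matrix.mul_kronecker_mul, ← Matrix.mul_kronecker_mul, mul_one,
        mul_one, partialTrLin_kronecker, partialTrLin_kronecker, htr, one_smul,
        Matrix.trace_mul_comm]
    rw [lindblad_apply, conjTranspose_effHam (isHermitian_quadHam p.antisymm_RS), effHam, map_add,
      map_add, e3]
    simp only [sub_mul, mul_sub, neg_mul, smul_mul_assoc, mul_smul_comm, map_sub, map_neg,
      map_smul, e1, e2, e4, e5]
    module

end Generator

/-! ### Implementation of orthogonal transformations -/

/-- The complex coordinates of a real vector. -/
def cplx {ι : Type} (x : EuclideanSpace ℝ ι) : ι → ℂ := fun i => (x i : ℂ)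

theorem cplx_dotProduct {ι : Type} [Fintype ι] (x y : EuclideanSpace ℝ ι) :
    cplx x ⬝ᵥ cplx y = ((inner ℝ x y : ℝ) : ℂ) := by
  simp [cplx, dotProduct, PiLp.inner_apply, mul_comm]

theorem star_cplx {ι : Type} (x : EuclideanSpace ℝ ι) : star (cplx x) = cplx x := by
  funext i
  simp [cplx]

theorem cplx_sub {ι : Type} (x y : EuclideanSpace ℝ ι) : cplx (x - y) = cplx x - cplx y := by
  funext i
  simp [cplx]

theorem cplx_smul {ι : Type} (r : ℝ) (x : EuclideanSpace ℝ ι) :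
    cplx (r • x) = (r : ℂ) • cplx x := by
  funext i
  simp [cplx]

/-- Every linear isometry of the real phase space is implemented by a unitary, which commutes or
anticommutes with the parity. -/
theorem exists_implementer {L : ℕ}
    (φ : EuclideanSpace ℝ (Fin L ⊕ Fin L) ≃ₗᵢ[ℝ] EuclideanSpace ℝ (Fin L ⊕ Fin L)) :
    ∃ V : Op L, V * Vᴴ = 1 ∧ (∀ x, V * majLin (cplx x) * Vᴴ = majLin (cplx (φ x))) ∧
      (V * parity L = parity L * V ∨ V * parity L = -(parity L * V)) := by
  -- Cartan–Dieudonné: an isometry is a product of reflections, so it suffices to implement one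
  -- reflection and compose.
  obtain ⟨l, -, rfl⟩ := φ.reflections_generate_dim
  induction l with
  | nil => exact ⟨1, by simp, by simp, by simp⟩
  | cons v l ih =>
    obtain ⟨V, hV, hVx, hVP⟩ := ih
    rw [List.map_cons, List.prod_cons]
    by_cases hv : v = 0
    · refine ⟨V, hV, fun x => ?_, hVP⟩
      rw [hVx, LinearIsometryEquiv.coe_mul, Function.comp_apply, hv,
        Submodule.reflection_mem_subspace_eq_self]
      simp
    have hn : ((‖v‖ : ℝ) : ℂ) ≠ 0 := Complex.ofReal_ne_zero.mpr (norm_ne_zero_iff.mpr hv)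
    have hvv : (majLin (cplx v) * majLin (cplx v) : Op L) = ((‖v‖ : ℂ) ^ 2) • 1 := by
      have h := majLin_anticomm (L := L) (cplx v) (cplx v)
      rw [cplx_dotProduct, real_inner_self_eq_norm_sq, ← two_smul ℂ, mul_smul] at h
      have h' := smul_right_injective (Op L) (two_ne_zero (α := ℂ)) h
      rw [h']
      push_cast
      rfl
    -- Conjugation by `γ(v)/‖v‖` alone gives minus the reflection in the hyperplane orthogonal to
    -- `v`; the parity factor corrects the sign.
    set Z : Op L := (‖v‖ : ℂ)⁻¹ • (majLin (cplx v) * parity L) with hZ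
    have hZs : Zᴴ = (‖v‖ : ℂ)⁻¹ • (parity L * majLin (cplx v)) := by
      rw [hZ, Matrix.conjTranspose_smul, Matrix.conjTranspose_mul, conjTranspose_parity,
        conjTranspose_majLin, star_cplx]
      simp
    have hZZ : Z * Zᴴ = 1 := by
      rw [hZs, hZ, smul_mul_smul_comm, mul_assoc, ← mul_assoc (parity L), parity_mul_parity,
        one_mul, hvv, smul_smul, ← mul_inv, ← pow_two, inv_mul_cancel₀ (pow_ne_zero 2 hn),
        one_smul]
    have hZx : ∀ x, Z * majLin (cplx x) * Zᴴ =
        majLin (cplx ((ℝ ∙ v)ᗮ.reflection x)) := by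
      intro x
      have h1 : majLin (cplx v) * parity L * majLin (cplx x) * (parity L * majLin (cplx v)) =
          (‖v‖ : ℂ) ^ 2 • majLin (cplx x) -
            (2 * ((inner ℝ v x : ℝ) : ℂ)) • (majLin (cplx v) : Op L) := by
        have h2 := majLin_anticomm (L := L) (cplx v) (cplx x)
        rw [cplx_dotProduct] at h2
        calc majLin (cplx v) * parity L * majLin (cplx x) * (parity L * majLin (cplx v))
            = majLin (cplx v) * (parity L * majLin (cplx x)) * parity L * majLin (cplx v) := by
              simp only [mul_assoc]
          _ = -(majLin (cplx v) * majLin (cplx x) * (parity L * parity L) * majLin (cplx v)) := by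
              rw [parity_mul_majLin]
              noncomm_ring
          _ = -((majLin (cplx v) * majLin (cplx x) + majLin (cplx x) * majLin (cplx v)) *
                majLin (cplx v)) + majLin (cplx x) * (majLin (cplx v) * majLin (cplx v)) := by
              rw [parity_mul_parity]
              noncomm_ring
          _ = _ := by
              rw [h2, hvv]
              simp only [smul_mul_assoc, one_mul, mul_smul_comm, mul_one]
              abel
      rw [hZs, hZ, smul_mul_assoc, smul_mul_smul_comm, h1, Submodule.reflection_orthogonal_apply,
        Submodule.reflection_singleton_apply, neg_sub, cplx_sub, map_sub, ← Nat.cast_smul_eq_nsmul ℝ,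
        cplx_smul, cplx_smul, map_smul, map_smul, smul_sub, smul_smul, smul_smul, smul_smul]
      congr 1
      · rw [← mul_inv, ← pow_two, inv_mul_cancel₀ (pow_ne_zero 2 hn), one_smul]
      · congr 1
        push_cast
        simp only [RCLike.ofReal_real_eq_id, id]
        field_simp
    have hZP : Z * parity L = -(parity L * Z) := by
      rw [hZ, smul_mul_assoc, mul_smul_comm, ← mul_assoc, parity_mul_majLin, neg_mul, smul_neg,
        neg_neg]
    refine ⟨Z * V, ?_, fun x => ?_, ?_⟩
    · rw [Matrix.conjTranspose_mul, mul_assoc, ← mul_assoc V, hV, one_mul, hZZ]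
    · rw [LinearIsometryEquiv.coe_mul, Function.comp_apply, ← hZx, ← hVx, Matrix.conjTranspose_mul]
      simp only [mul_assoc]
    · rcases hVP with h | h
      · right
        rw [mul_assoc, h, ← mul_assoc, hZP]
        noncomm_ring
      · left
        rw [mul_assoc, h, mul_neg, ← mul_assoc, hZP]
        noncomm_ring

/-! ### The Majorana basis and the creation/annihilation basis -/

/-- Coordinates in the Majorana basis from those in the creation/annihilation basis. -/
def majoranaBasis (L : ℕ) : Matrix (Fin L ⊕ Fin L) (Fin L ⊕ Fin L) ℂ :=
  Matrix.fromBlocks ((1 / 2 : ℂ) • 1) ((1 / 2 : ℂ) • 1) ((-(Complex.I / 2)) • 1)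
    ((Complex.I / 2) • 1)

/-- Majorana coordinates are unitary only up to the factor `√2`, since `γ_i² = 1`; hence the `2` in
`bogoliubovOf`. -/
theorem conjTranspose_majoranaBasis_mul (L : ℕ) :
    (2 : ℂ) • ((majoranaBasis L)ᴴ * majoranaBasis L) = 1 := by
  rw [majoranaBasis, Matrix.fromBlocks_conjTranspose, Matrix.fromBlocks_multiply,
    Matrix.fromBlocks_smul, ← Matrix.fromBlocks_one]
  have h := Complex.I_mul_I
  have e1 : (2 : ℂ) * (1 / 2 * (1 / 2) + Complex.I / 2 * (-(Complex.I / 2))) = 1 := by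
    linear_combination (-1 / 2) * h
  have e2 : (2 : ℂ) * (1 / 2 * (1 / 2) + Complex.I / 2 * (Complex.I / 2)) = 0 := by
    linear_combination (1 / 2) * h
  have e3 : (2 : ℂ) * (1 / 2 * (1 / 2) + -(Complex.I / 2) * (Complex.I / 2)) = 1 := by
    linear_combination (-1 / 2) * h
  have e4 : (2 : ℂ) * (1 / 2 * (1 / 2) + -(Complex.I / 2) * (-(Complex.I / 2))) = 0 := by
    linear_combination (1 / 2) * h
  have c1 : star (1 / 2 : ℂ) = 1 / 2 := by simp
  have c2 : star (Complex.I / 2) = -(Complex.I / 2) := by simp [neg_div]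
  simp only [Matrix.conjTranspose_smul, Matrix.conjTranspose_one, star_neg, c1, c2, neg_neg,
    smul_mul_smul_comm, mul_one, ← add_smul, smul_smul, e1, e2, e3, e4, one_smul, zero_smul]

theorem majoranaBasis_mul_conjTranspose (L : ℕ) :
    (2 : ℂ) • (majoranaBasis L * (majoranaBasis L)ᴴ) = 1 := by
  rw [← mul_smul_comm]
  refine mul_eq_one_comm.mp ?_
  rw [smul_mul_assoc]
  exact conjTranspose_majoranaBasis_mul L

theorem majoranaBasis_mulVec_inl {L : ℕ} (y : Fin L ⊕ Fin L → ℂ) (i : Fin L) :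
    (majoranaBasis L *ᵥ y) (Sum.inl i) = (1 / 2) * (y (Sum.inl i) + y (Sum.inr i)) := by
  rw [majoranaBasis, Matrix.fromBlocks_mulVec]
  simp [Matrix.smul_mulVec]
  ring

theorem majoranaBasis_mulVec_inr {L : ℕ} (y : Fin L ⊕ Fin L → ℂ) (i : Fin L) :
    (majoranaBasis L *ᵥ y) (Sum.inr i) =
      (Complex.I / 2) * (y (Sum.inr i) - y (Sum.inl i)) := by
  rw [majoranaBasis, Matrix.fromBlocks_mulVec]
  simp [Matrix.smul_mulVec, Matrix.neg_mulVec]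
  ring

theorem field_eq_majLin {L : ℕ} (y : Fin L ⊕ Fin L → ℂ) :
    field y = (majLin (majoranaBasis L *ᵥ y) : Op L) := by
  rw [majLin_apply, Fintype.sum_sum_type, field, ← Finset.sum_add_distrib,
    ← Finset.sum_add_distrib]
  refine Finset.sum_congr rfl fun i _ => ?_
  rw [majoranaBasis_mulVec_inl, majoranaBasis_mulVec_inr, majorana, majorana, smul_smul,
    show Complex.I / 2 * (y (Sum.inr i) - y (Sum.inl i)) * -Complex.I =
      1 / 2 * (y (Sum.inr i) - y (Sum.inl i)) by
      linear_combination (-1 / 2 * (y (Sum.inr i) - y (Sum.inl i))) * Complex.I_mul_I]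
  module

theorem exists_field_eq_majLin {L : ℕ} (x : Fin L ⊕ Fin L → ℂ) :
    ∃ y, (majLin x : Op L) = field y := by
  refine ⟨((2 : ℂ) • (majoranaBasis L)ᴴ) *ᵥ x, ?_⟩
  rw [field_eq_majLin, Matrix.mulVec_mulVec, mul_smul_comm, majoranaBasis_mul_conjTranspose,
    Matrix.one_mulVec]

/-- In Majorana coordinates `ξ` is complex conjugation, so real matrices commute with it. -/
theorem majoranaBasis_mulVec_xi {L : ℕ} (y : Fin L ⊕ Fin L → ℂ) :
    majoranaBasis L *ᵥ xi y = star (majoranaBasis L *ᵥ y) := by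
  funext k
  rcases k with i | i
  · rw [majoranaBasis_mulVec_inl, Pi.star_apply, majoranaBasis_mulVec_inl]
    simp [xi, add_comm]
  · rw [majoranaBasis_mulVec_inr, Pi.star_apply, majoranaBasis_mulVec_inr]
    simp [xi]
    ring

/-- The matrix, in the creation/annihilation basis, of the orthogonal transformation `O` of the
Majorana basis. -/
def bogoliubovOf {L : ℕ} (O : Matrix (Fin L ⊕ Fin L) (Fin L ⊕ Fin L) ℝ) :
    Matrix (Fin L ⊕ Fin L) (Fin L ⊕ Fin L) ℂ :=
  (2 : ℂ) • ((majoranaBasis L)ᴴ * O.map Complex.ofReal * majoranaBasis L)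

theorem majoranaBasis_mul_bogoliubovOf {L : ℕ} (O : Matrix (Fin L ⊕ Fin L) (Fin L ⊕ Fin L) ℝ) :
    majoranaBasis L * bogoliubovOf O = O.map Complex.ofReal * majoranaBasis L := by
  rw [bogoliubovOf, mul_smul_comm, ← mul_assoc, ← mul_assoc, ← smul_mul_assoc, ← smul_mul_assoc,
    majoranaBasis_mul_conjTranspose, one_mul]

theorem isBogoliubov_bogoliubovOf {L : ℕ} {O : Matrix (Fin L ⊕ Fin L) (Fin L ⊕ Fin L) ℝ}
    (hO : Oᵀ * O = 1) : IsBogoliubov (bogoliubovOf O) := by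
  have hO' : (O.map Complex.ofReal)ᴴ * O.map Complex.ofReal = 1 := by
    have h1 : (O.map Complex.ofReal)ᴴ = Oᵀ.map Complex.ofReal := by
      ext
      simp
    rw [h1]
    have h2 := congrArg (fun M : Matrix (Fin L ⊕ Fin L) (Fin L ⊕ Fin L) ℝ =>
      M.map Complex.ofRealHom) hO
    simp only [Matrix.map_mul] at h2
    rw [Matrix.map_one _ (map_zero _) (map_one _)] at h2
    exact h2
  constructor
  · rw [Matrix.mem_unitaryGroup_iff', Matrix.star_eq_conjTranspose, ← conjTranspose_majoranaBasis_mul]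
    conv_lhs => rw [bogoliubovOf.eq_def O, mul_smul_comm]
    congr 1
    calc (bogoliubovOf O)ᴴ * ((majoranaBasis L)ᴴ * O.map Complex.ofReal * majoranaBasis L)
        = (majoranaBasis L * bogoliubovOf O)ᴴ * (O.map Complex.ofReal * majoranaBasis L) := by
          rw [Matrix.conjTranspose_mul]
          simp only [mul_assoc]
      _ = (majoranaBasis L)ᴴ * ((O.map Complex.ofReal)ᴴ * O.map Complex.ofReal) *
            majoranaBasis L := by
          rw [majoranaBasis_mul_bogoliubovOf, Matrix.conjTranspose_mul]
          simp only [mul_assoc]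
      _ = _ := by rw [hO', mul_one]
  · intro y
    have hinj : Function.Injective fun z => majoranaBasis L *ᵥ z := by
      intro z z' hz
      have h1 := congrArg (fun x => ((2 : ℂ) • (majoranaBasis L)ᴴ) *ᵥ x) hz
      simpa only [Matrix.mulVec_mulVec, smul_mul_assoc, conjTranspose_majoranaBasis_mul,
        Matrix.one_mulVec] using h1
    refine hinj ?_
    change majoranaBasis L *ᵥ (bogoliubovOf O *ᵥ xi y) =
      majoranaBasis L *ᵥ xi (bogoliubovOf O *ᵥ y)
    rw [majoranaBasis_mulVec_xi, Matrix.mulVec_mulVec, Matrix.mulVec_mulVec,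
      majoranaBasis_mul_bogoliubovOf, ← Matrix.mulVec_mulVec, majoranaBasis_mulVec_xi,
      ← Matrix.mulVec_mulVec]
    funext k
    rw [Pi.star_apply, Matrix.mulVec, Matrix.mulVec, dotProduct, dotProduct, star_sum]
    refine Finset.sum_congr rfl fun j _ => ?_
    rw [Pi.star_apply, star_mul', Matrix.map_apply, Complex.star_def, Complex.conj_ofReal]

/-! ### Normal form of skew-adjoint operators -/

section NormalForm

variable {E : Type*} [NormedAddCommGroup E] [InnerProductSpace ℝ E]

/-- `A²` is symmetric, hence diagonalizable. If all its eigenvalues vanish then `A² = 0`, and `‖Ax‖²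
= -⟨x, A²x⟩` forces `A = 0`. -/
theorem exists_eigenvector_sq [FiniteDimensional ℝ E] (A : E →ₗ[ℝ] E)
    (hA : ∀ x y, inner ℝ (A x) y = -inner ℝ x (A y)) (h0 : A ≠ 0) :
    ∃ v : E, ‖v‖ = 1 ∧ ∃ r : ℝ, r ≠ 0 ∧ A (A v) = r • v := by
  have hsym : (A ∘ₗ A).IsSymmetric := by
    intro x y
    rw [LinearMap.comp_apply, LinearMap.comp_apply, hA, hA, neg_neg]
  by_contra hcon
  push Not at hcon
  refine h0 (LinearMap.ext fun x => ?_)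
  have h1 : A ∘ₗ A = 0 := by
    refine (hsym.eigenvectorBasis rfl).toBasis.ext fun i => ?_
    rw [OrthonormalBasis.coe_toBasis, hsym.apply_eigenvectorBasis]
    by_cases hi : hsym.eigenvalues rfl i = 0
    · simp [hi]
    · refine absurd ?_ (hcon (hsym.eigenvectorBasis rfl i)
        ((hsym.eigenvectorBasis rfl).orthonormal.1 i) _ hi)
      exact hsym.apply_eigenvectorBasis rfl i
  have h2 : inner ℝ (A x) (A x) = 0 := by
    rw [hA, ← LinearMap.comp_apply, h1, LinearMap.zero_apply, inner_zero_right, neg_zero]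
  exact inner_self_eq_zero.mp h2

/-- A skew-adjoint operator of an even-dimensional space is, in a suitable orthonormal basis, a sum
of two-dimensional rotations generators. -/
theorem exists_skew_normal_form [FiniteDimensional ℝ E] (A : E →ₗ[ℝ] E)
    (hA : ∀ x y, inner ℝ (A x) y = -inner ℝ x (A y)) (n : ℕ) :
    ∀ W : Submodule ℝ E, Module.finrank ℝ W = 2 * n → (∀ x ∈ W, A x ∈ W) →
      ∃ (μ : Fin n → ℝ) (g k : Fin n → E), (∀ i, 0 ≤ μ i) ∧ (∀ i, g i ∈ W) ∧ (∀ i, k i ∈ W) ∧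
        Orthonormal ℝ g ∧ Orthonormal ℝ k ∧ (∀ i j, inner ℝ (g i) (k j) = 0) ∧
        (∀ i, A (g i) = -(μ i • k i)) ∧ ∀ i, A (k i) = μ i • g i := by
  induction n with
  | zero =>
    intro W _ _
    exact ⟨Fin.elim0, Fin.elim0, Fin.elim0, fun i => i.elim0, fun i => i.elim0, fun i => i.elim0,
      ⟨fun i => i.elim0, fun i => i.elim0⟩, ⟨fun i => i.elim0, fun i => i.elim0⟩,
      fun i => i.elim0, fun i => i.elim0, fun i => i.elim0⟩
  | succ n ih =>
    intro W hW hAW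
    -- If `A` vanishes on `W`, any orthonormal basis cut into two halves works, with `μ = 0`.
    by_cases h0 : A.restrict hAW = 0
    · have hA0 : ∀ x ∈ W, A x = 0 := fun x hx =>
        congrArg Subtype.val (LinearMap.congr_fun h0 ⟨x, hx⟩)
      have hcard : Module.finrank ℝ W = (n + 1) + (n + 1) := by omega
      let b := (stdOrthonormalBasis ℝ W).reindex ((finCongr hcard).trans finSumFinEquiv.symm)
      have hb : Orthonormal ℝ fun i => (b i : E) := b.orthonormal.comp_linearIsometry W.subtypeₗᵢ
      refine ⟨0, fun i => b (Sum.inl i), fun i => b (Sum.inr i), fun i => le_rfl,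
        fun i => (b _).2, fun i => (b _).2, hb.comp _ Sum.inl_injective,
        hb.comp _ Sum.inr_injective, fun i j => hb.2 (by simp), fun i => ?_, fun i => ?_⟩
      · simp [hA0 _ (b _).2]
      · simp [hA0 _ (b _).2]
    · obtain ⟨⟨v, hvW⟩, hv1, r, hr, hv⟩ := exists_eigenvector_sq (A.restrict hAW)
        (fun x y => hA x y) h0
      replace hv : A (A v) = r • v := congrArg Subtype.val hv
      replace hv1 : ‖v‖ = 1 := hv1
      have hAv : A v ≠ 0 := by
        intro h
        rw [h, map_zero, eq_comm, smul_eq_zero] at hv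
        rcases hv with h | h
        · exact hr h
        · rw [h, norm_zero] at hv1
          exact zero_ne_one hv1
      have hμ0 : ‖A v‖ ≠ 0 := norm_ne_zero_iff.mpr hAv
      have hr' : r = -‖A v‖ ^ 2 := by
        have h1 : inner ℝ (A v) (A v) = -r := by
          rw [hA, hv, inner_smul_right, real_inner_self_eq_norm_sq, hv1]
          ring
        rw [real_inner_self_eq_norm_sq] at h1
        linarith
      -- The sign of `w` makes the coefficient `‖Av‖` nonnegative. This is what later excludes
      -- completely filled modes.
      set w : E := -(‖A v‖⁻¹ • A v) with hw
      have hvAv : inner ℝ v (A v) = 0 := by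
        have h1 := hA v v
        rw [real_inner_comm] at h1
        linarith
      have hvw : inner ℝ v w = 0 := by
        rw [hw, inner_neg_right, inner_smul_right, hvAv, mul_zero, neg_zero]
      have hw1 : ‖w‖ = 1 := by
        rw [hw, norm_neg, norm_smul, norm_inv, norm_norm, inv_mul_cancel₀ hμ0]
      have hwW : w ∈ W := W.neg_mem (W.smul_mem _ (hAW v hvW))
      have hAvw : A v = -(‖A v‖ • w) := by
        rw [hw, smul_neg, neg_neg, smul_inv_smul₀ hμ0]
      have hAw : A w = ‖A v‖ • v := by
        rw [hw, map_neg, map_smul, hv, hr', smul_smul, ← neg_smul]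
        congr 1
        field_simp
      have hon : Orthonormal ℝ ![v, w] := by
        rw [orthonormal_vecCons_iff]
        refine ⟨hv1, fun i => ?_, ?_⟩
        · fin_cases i
          exact hvw
        · rw [orthonormal_vecCons_iff]
          exact ⟨hw1, fun i => i.elim0, ⟨fun i => i.elim0, fun i => i.elim0⟩⟩
      set K : Submodule ℝ E := Submodule.span ℝ (Set.range ![v, w]) with hK
      have hKW : K ≤ W := by
        rw [hK, Submodule.span_le]
        rintro _ ⟨i, rfl⟩
        fin_cases i
        · exact hvW
        · exact hwW
      have hvK : v ∈ K := Submodule.subset_span ⟨0, rfl⟩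
      have hwK : w ∈ K := Submodule.subset_span ⟨1, rfl⟩
      have hKperp : ∀ x, x ∈ Kᗮ ↔ inner ℝ v x = 0 ∧ inner ℝ w x = 0 := by
        intro x
        refine ⟨fun hx => ⟨hx v hvK, hx w hwK⟩, fun hx y hy => ?_⟩
        refine Submodule.span_induction (p := fun y _ => inner ℝ y x = 0) ?_ ?_ ?_ ?_ hy
        · rintro _ ⟨i, rfl⟩
          fin_cases i
          · exact hx.1
          · exact hx.2
        · exact inner_zero_left _
        · intro y z _ _ hy hz
          rw [inner_add_left, hy, hz, add_zero]
        · intro a y _ hy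
          rw [inner_smul_left, hy, mul_zero]
      have hfin : Module.finrank ℝ ↥(Kᗮ ⊓ W) = 2 * n := by
        have h1 := Submodule.finrank_add_inf_finrank_orthogonal hKW
        have h2 : Module.finrank ℝ K = 2 := by
          rw [hK, finrank_span_eq_card hon.linearIndependent, Fintype.card_fin]
        omega
      -- The plane of `v` and `w` is invariant, and by skew-adjointness so is its orthogonal
      -- complement in `W`.
      obtain ⟨μ, g, k, hμ, hg, hk, hgo, hko, hgk, hAg, hAk⟩ := ih (Kᗮ ⊓ W) hfin (by
        rintro x ⟨hxK, hxW⟩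
        refine ⟨(hKperp _).mpr ?_, hAW x hxW⟩
        obtain ⟨h1, h2⟩ := (hKperp x).mp hxK
        constructor
        · rw [← neg_eq_iff_eq_neg.mpr (hA v x), hAvw, inner_neg_left, inner_smul_left, h2]
          simp
        · rw [← neg_eq_iff_eq_neg.mpr (hA w x), hAw, inner_smul_left, h1]
          simp)
      have hgK := fun i => (hKperp _).mp (hg i).1
      have hkK := fun i => (hKperp _).mp (hk i).1
      refine ⟨Matrix.vecCons ‖A v‖ μ, Matrix.vecCons v g, Matrix.vecCons w k, ?_, ?_, ?_,
        orthonormal_vecCons_iff.mpr ⟨hv1, fun i => (hgK i).1, hgo⟩,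
        orthonormal_vecCons_iff.mpr ⟨hw1, fun i => (hkK i).2, hko⟩, ?_, ?_, ?_⟩
      · exact Fin.cases (norm_nonneg _) hμ
      · exact Fin.cases hvW fun i => (hg i).2
      · exact Fin.cases hwW fun i => (hk i).2
      · refine Fin.cases (Fin.cases hvw fun j => (hkK j).1) fun i => Fin.cases ?_ fun j => hgk i j
        change inner ℝ (g i) w = 0
        rw [real_inner_comm]
        exact (hgK i).2
      · exact Fin.cases hAvw hAg
      · exact Fin.cases hAw hAk

end NormalForm

/-! ### States with diagonal two-point function -/

/-- The two-point function of `σ` is diagonal, with occupation probabilities `m`. -/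
structure HasOccupation {L : ℕ} (σ : Op L) (m : Fin L → ℝ) : Prop where
  annih_annih : ∀ i j, (σ * (annih i * annih j)).trace = 0
  creat_creat : ∀ i j, (σ * (creat i * creat j)).trace = 0
  creat_annih : ∀ i j, (σ * (creat i * annih j)).trace = if i = j then (m i : ℂ) else 0
  annih_creat : ∀ i j, (σ * (annih i * creat j)).trace = if i = j then (1 - m i : ℂ) else 0

theorem annih_anticomm {L : ℕ} (i j : Fin L) :
    (annih i * annih j + annih j * annih i : Op L) = 0 := by
  rw [annih_eq_majLin, annih_eq_majLin, majLin_anticomm]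
  by_cases h : i = j
  · subst h
    have h2 := Complex.I_mul_I
    have : (2 : ℂ) * (2⁻¹ * 2⁻¹ + Complex.I / 2 * (Complex.I / 2)) = 0 := by
      linear_combination (1 / 2) * h2
    simp [this]
  · simp [h]

theorem annih_creat_anticomm {L : ℕ} (i j : Fin L) :
    (annih i * creat j + creat j * annih i : Op L) = (if i = j then (1 : ℂ) else 0) • 1 := by
  rw [annih_eq_majLin, creat_eq_majLin, majLin_anticomm]
  congr 1
  by_cases h : i = j
  · subst h
    have h2 := Complex.I_mul_I
    simp
    linear_combination (-1 / 2) * h2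
  · simp [h]

theorem creat_anticomm {L : ℕ} (i j : Fin L) :
    (creat i * creat j + creat j * creat i : Op L) = 0 := by
  rw [creat, creat, ← Matrix.conjTranspose_mul, ← Matrix.conjTranspose_mul,
    ← Matrix.conjTranspose_add, annih_anticomm, Matrix.conjTranspose_zero]

theorem HasOccupation.trace_eq {L : ℕ} {σ ρ : Op L} {m : Fin L → ℝ} (hσ : HasOccupation σ m)
    (hρ : HasOccupation ρ m) (h : σ.trace = ρ.trace) {X : Op L} (hX : X ∈ quadSpan L) :
    (σ * X).trace = (ρ * X).trace := by
  refine quadSpan_induction (p := fun X => (σ * X).trace = (ρ * X).trace) ?_ ?_ ?_ ?_ hX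
  · simpa using h
  · intro x y
    obtain ⟨x', hx⟩ := exists_field_eq_majLin x
    obtain ⟨y', hy⟩ := exists_field_eq_majLin y
    rw [hx, hy]
    simp only [field, mul_add, add_mul, Finset.sum_mul, Finset.mul_sum, smul_mul_assoc,
      mul_smul_comm, Matrix.trace_add, Matrix.trace_sum, Matrix.trace_smul, hσ.annih_annih,
      hσ.creat_creat, hσ.creat_annih, hσ.annih_creat, hρ.annih_annih, hρ.creat_creat,
      hρ.creat_annih, hρ.annih_creat]
  · intro X Y hX hY
    rw [mul_add, mul_add, Matrix.trace_add, Matrix.trace_add, hX, hY]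
  · intro c X hX
    rw [mul_smul_comm, mul_smul_comm, Matrix.trace_smul, Matrix.trace_smul, hX]

/-- A field operator that annihilates `σ` is a combination of the annihilation operators of the
empty modes. -/
theorem HasOccupation.majLin_mul_vacMat {L a c : ℕ} (h : a + c = L) {σ : Op L} {m : Fin L → ℝ}
    (hσ : HasOccupation σ m) (hA : ∀ i, m (modeA h i) = 0)
    (hC : ∀ i, 0 < m (modeC h i) ∧ m (modeC h i) < 1) {x : Fin L ⊕ Fin L → ℂ}
    (hx : majLin x * σ = 0) : majLin x * vacMat h = 0 := by
  obtain ⟨y, hy⟩ := exists_field_eq_majLin x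
  rw [hy] at hx ⊢
  -- Testing with `Z = c_i` and `Z = c_i^*` isolates single coefficients of `y`, multiplied by `1 -
  -- m_i` and `m_i`.
  have key : ∀ Z : Op L, (σ * (Z * field y)).trace = 0 := by
    intro Z
    rw [Matrix.trace_mul_comm, mul_assoc, hx, mul_zero, Matrix.trace_zero]
  have h1 : ∀ i, y (Sum.inl i) * (1 - m i : ℂ) = 0 := by
    intro i
    have h2 := key (annih i)
    simpa only [field, mul_add, Finset.mul_sum, mul_smul_comm, Matrix.trace_add,
      Matrix.trace_sum, Matrix.trace_smul, hσ.annih_annih, hσ.annih_creat, smul_eq_mul, mul_ite,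
      mul_zero, Finset.sum_ite_eq, Finset.mem_univ, if_true, Finset.sum_const_zero,
      add_zero] using h2
  have h2 : ∀ i, y (Sum.inr i) * (m i : ℂ) = 0 := by
    intro i
    have h2 := key (creat i)
    simpa only [field, mul_add, Finset.mul_sum, mul_smul_comm, Matrix.trace_add,
      Matrix.trace_sum, Matrix.trace_smul, hσ.creat_creat, hσ.creat_annih, smul_eq_mul, mul_ite,
      mul_zero, Finset.sum_ite_eq, Finset.mem_univ, if_true, Finset.sum_const_zero,
      zero_add] using h2
  have h3 : ∀ i, y (Sum.inl i) = 0 := by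
    intro i
    refine (mul_eq_zero.mp (h1 i)).resolve_right ?_
    refine forall_modes h (p := fun i => (1 - m i : ℂ) ≠ 0) (fun j => ?_) (fun j => ?_) i
    · simp [hA]
    · exact_mod_cast sub_ne_zero.mpr (hC j).2.ne'
  have h4 : ∀ i, y (Sum.inr i) • (annih i * vacMat h) = 0 := by
    refine forall_modes h (fun j => ?_) (fun j => ?_)
    · rw [annih_mul_vacMat, smul_zero]
    · have h5 := (mul_eq_zero.mp (h2 (modeC h j))).resolve_right
        (Complex.ofReal_ne_zero.mpr (hC j).1.ne')
      rw [h5, zero_smul]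
  rw [field]
  simp only [h3, zero_smul, Finset.sum_const_zero, zero_add, Matrix.sum_mul, Matrix.smul_mul, h4]

/-- The occupation is `Tr(c_i σ c_i^*)`, the trace of a positive operator. -/
theorem HasOccupation.annih_mul_eq_zero {L : ℕ} {σ : Op L} {m : Fin L → ℝ}
    (hσ : HasOccupation σ m) (hσ' : σ.PosSemidef) {i : Fin L} (hi : m i = 0) :
    annih i * σ = 0 := by
  refine mul_eq_zero_of_trace_eq_zero hσ' ?_
  have h := hσ.creat_annih i i
  rw [if_pos rfl, hi, Complex.ofReal_zero, ← mul_assoc, Matrix.trace_mul_comm] at h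
  rw [← creat, mul_assoc]
  exact h

theorem HasOccupation.nonneg {L : ℕ} {σ : Op L} {m : Fin L → ℝ}
    (hσ : HasOccupation σ m) (hσ' : σ.PosSemidef) (i : Fin L) : 0 ≤ m i := by
  have h := hσ.creat_annih i i
  rw [if_pos rfl, ← mul_assoc, Matrix.trace_mul_comm, ← mul_assoc] at h
  have h2 := (hσ'.mul_mul_conjTranspose_same (annih i)).trace_nonneg
  rw [← creat, h] at h2
  exact Complex.zero_le_real.mp h2

theorem annih_modeC_mul_vacMat {L a c : ℕ} (h : a + c = L) (i : Fin c) :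
    annih (modeC h i) * vacMat h = vacMat h * annih i := by
  have h1 := majorana_mul_vacMat h (Sum.inl i)
  have h2 := majorana_mul_vacMat h (Sum.inr i)
  rw [annih_eq_majLin, annih_eq_majLin, map_add, map_add, map_smul, map_smul, map_smul, map_smul,
    majLin_single, majLin_single, majLin_single, majLin_single, Matrix.add_mul, Matrix.mul_add,
    Matrix.smul_mul, Matrix.smul_mul, Matrix.mul_smul, Matrix.mul_smul, ← h1, ← h2]
  rfl

theorem creat_modeC_mul_vacMat {L a c : ℕ} (h : a + c = L) (i : Fin c) :
    creat (modeC h i) * vacMat h = vacMat h * creat i := by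
  have h1 := majorana_mul_vacMat h (Sum.inl i)
  have h2 := majorana_mul_vacMat h (Sum.inr i)
  rw [creat_eq_majLin, creat_eq_majLin, map_sub, map_sub, map_smul, map_smul, map_smul, map_smul,
    majLin_single, majLin_single, majLin_single, majLin_single, Matrix.sub_mul, Matrix.mul_sub,
    Matrix.smul_mul, Matrix.smul_mul, Matrix.mul_smul, Matrix.mul_smul, ← h1, ← h2]
  rfl

theorem modeC_injective {L a c : ℕ} (h : a + c = L) : Function.Injective (modeC h) := by
  intro i j hij
  have := congrArg Fin.val hij
  simp only [modeC, Fin.val_cast, Fin.val_natAdd] at this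
  exact Fin.ext (by omega)

/-- The restriction to `Ω_A ⊗ Γ(ℂ^c)` has the occupations of the last modes. -/
theorem HasOccupation.restrict {L a c : ℕ} (h : a + c = L) {σ : Op L} {σC : Op c} {m : Fin L → ℝ}
    (hσ : HasOccupation σ m) (hσC : σ = vacMat h * σC * (vacMat h)ᴴ) :
    HasOccupation σC fun i => m (modeC h i) := by
  have key : ∀ (X : Op L) (Y : Op c), X * vacMat h = vacMat h * Y →
      (σC * Y).trace = (σ * X).trace := by
    intro X Y hXY
    rw [hσC, Matrix.mul_assoc, Matrix.mul_assoc, Matrix.trace_mul_comm (vacMat h),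
      Matrix.mul_assoc σC, Matrix.mul_assoc _ X, hXY, ← Matrix.mul_assoc _ (vacMat h),
      conjTranspose_vacMat_mul_vacMat, Matrix.one_mul]
  have mulk : ∀ (X X' : Op L) (Y Y' : Op c), X * vacMat h = vacMat h * Y →
      X' * vacMat h = vacMat h * Y' → X * X' * vacMat h = vacMat h * (Y * Y') := by
    intro X X' Y Y' hX hX'
    rw [Matrix.mul_assoc, hX', ← Matrix.mul_assoc, hX, Matrix.mul_assoc]
  have hinj : ∀ i j : Fin c, (modeC h i = modeC h j) = (i = j) := fun i j =>
    propext (modeC_injective h).eq_iff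
  constructor
  · intro i j
    rw [key _ _ (mulk _ _ _ _ (annih_modeC_mul_vacMat h i) (annih_modeC_mul_vacMat h j)),
      hσ.annih_annih]
  · intro i j
    rw [key _ _ (mulk _ _ _ _ (creat_modeC_mul_vacMat h i) (creat_modeC_mul_vacMat h j)),
      hσ.creat_creat]
  · intro i j
    rw [key _ _ (mulk _ _ _ _ (creat_modeC_mul_vacMat h i) (annih_modeC_mul_vacMat h j)),
      hσ.creat_annih]
    simp only [hinj]
  · intro i j
    rw [key _ _ (mulk _ _ _ _ (annih_modeC_mul_vacMat h i) (creat_modeC_mul_vacMat h j)),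
      hσ.annih_creat]
    simp only [hinj]

/-! ### Gaussian product states -/

/-- The product state with occupation probabilities `m`. -/
def productState {L : ℕ} (m : Fin L → ℝ) : Op L :=
  Matrix.diagonal fun u => ((∏ i, if u i = true then m i else 1 - m i : ℝ) : ℂ)

section ProductState

variable {L : ℕ} {m : Fin L → ℝ}

theorem posDef_productState (hm : ∀ i, 0 < m i ∧ m i < 1) : (productState m).PosDef := by
  refine Matrix.PosDef.diagonal fun u => ?_
  refine Complex.zero_lt_real.mpr (Finset.prod_pos fun i _ => ?_)
  split_ifs
  · exact (hm i).1
  · exact sub_pos.mpr (hm i).2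

theorem trace_productState (m : Fin L → ℝ) : (productState m).trace = 1 := by
  rw [productState, Matrix.trace_diagonal, ← Complex.ofReal_sum, Complex.ofReal_eq_one]
  have h := Finset.prod_univ_sum (fun _ : Fin L => (Finset.univ : Finset Bool))
    (fun i (b : Bool) => if b = true then m i else 1 - m i)
  rw [Fintype.piFinset_univ] at h
  rw [← h]
  simp

theorem twist_mul_productState (E : TensorIso) (m : Fin L → ℝ) :
    twist E L * productState m * twist E L = productState m := by
  cases E
  · have h : parity L * productState m = productState m * parity L := by
      rw [parity, productState, Matrix.diagonal_mul_diagonal, Matrix.diagonal_mul_diagonal]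
      congr 1
      funext u
      rw [mul_comm]
    rw [twist, h, mul_assoc, parity_mul_parity, mul_one]
  · simp [twist]

/-- Raising mode `i` multiplies the weight of a configuration by `m_i/(1 - m_i)`. This is the
exchange relation behind stationarity of the product state. -/
theorem productState_mul_creat (hm : ∀ i, m i < 1) (i : Fin L) :
    productState m * creat i = ((m i / (1 - m i) : ℝ) : ℂ) • (creat i * productState m) := by
  have h0 : 1 - m i ≠ 0 := sub_ne_zero.mpr (hm i).ne'
  ext w u
  rw [productState, Matrix.diagonal_mul, Matrix.smul_apply, Matrix.mul_diagonal, creat_apply]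
  by_cases h : w = flipAt i u ∧ u i = false
  · obtain ⟨rfl, hu⟩ := h
    rw [if_pos ⟨rfl, hu⟩, smul_eq_mul]
    have key : (∏ k, if flipAt i u k = true then m k else 1 - m k) =
        m i / (1 - m i) * ∏ k, if u k = true then m k else 1 - m k := by
      rw [← Finset.mul_prod_erase _ _ (Finset.mem_univ i),
        ← Finset.mul_prod_erase Finset.univ (fun k => if u k = true then m k else 1 - m k)
          (Finset.mem_univ i), ← mul_assoc, flipAt_apply_self, hu]
      congr 1
      · simp [div_mul_cancel₀ _ h0]
      · refine Finset.prod_congr rfl fun k hk => ?_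
        rw [flipAt_apply_of_ne (Finset.ne_of_mem_erase hk)]
    rw [key, Complex.ofReal_mul]
    ring
  · rw [if_neg h, mul_zero, zero_mul, smul_zero]

theorem productState_mul_annih (hm : ∀ i, 0 < m i ∧ m i < 1) (i : Fin L) :
    productState m * annih i = ((m i / (1 - m i) : ℝ) : ℂ)⁻¹ • (annih i * productState m) := by
  have h := congrArg Matrix.conjTranspose (productState_mul_creat (fun i => (hm i).2) i)
  rw [Matrix.conjTranspose_smul, Matrix.conjTranspose_mul, Matrix.conjTranspose_mul,
    (posDef_productState hm).isHermitian.eq, creat, Matrix.conjTranspose_conjTranspose,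
    Complex.star_def, Complex.conj_ofReal] at h
  rw [h, inv_smul_smul₀]
  exact Complex.ofReal_ne_zero.mpr (div_pos (hm i).1 (sub_pos.mpr (hm i).2)).ne'

theorem productState_exchange (hm : ∀ i, 0 < m i ∧ m i < 1) (x : Fin L ⊕ Fin L → ℂ) :
    ∃ y, productState m * majLin x = majLin y * productState m := by
  let P : Submodule ℂ (Op L) :=
    { carrier := {X | ∃ y, productState m * X = majLin y * productState m}
      add_mem' := by
        rintro X Y ⟨y, hy⟩ ⟨z, hz⟩
        exact ⟨y + z, by rw [mul_add, hy, hz, map_add, add_mul]⟩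
      zero_mem' := ⟨0, by simp⟩
      smul_mem' := by
        rintro r X ⟨y, hy⟩
        exact ⟨r • y, by rw [mul_smul_comm, hy, map_smul, smul_mul_assoc]⟩ }
  have hc : ∀ i, creat i ∈ P := by
    intro i
    obtain ⟨y, hy⟩ : ∃ y, (creat i : Op L) = majLin y := ⟨_, creat_eq_majLin i⟩
    exact ⟨_ • y, by rw [productState_mul_creat (fun i => (hm i).2), map_smul, smul_mul_assoc, hy]⟩
  have ha : ∀ i, annih i ∈ P := by
    intro i
    obtain ⟨y, hy⟩ : ∃ y, (annih i : Op L) = majLin y := ⟨_, annih_eq_majLin i⟩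
    exact ⟨_ • y, by rw [productState_mul_annih hm, map_smul, smul_mul_assoc, hy]⟩
  obtain ⟨y, hy⟩ := exists_field_eq_majLin x
  rw [hy]
  change field y ∈ P
  exact add_mem (Submodule.sum_mem _ fun i _ => P.smul_mem _ (hc i))
    (Submodule.sum_mem _ fun i _ => P.smul_mem _ (ha i))

/-- The exchange relations and cyclicity (a KMS condition) together with the anticommutation
relations give linear equations for the two-point function. With `r = m/(1 - m)`, the value `t` of
`c_i^* c_i` satisfies `t = r(1 - t)`, so `t = m`. -/
theorem hasOccupation_productState (hm : ∀ i, 0 < m i ∧ m i < 1) :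
    HasOccupation (productState m) m := by
  set ρ := productState m with hρ
  have hr : ∀ i, (0 : ℝ) < m i / (1 - m i) := fun i =>
    div_pos (hm i).1 (sub_pos.mpr (hm i).2)
  have hc : ∀ i (X : Op L), (ρ * (creat i * X)).trace =
      ((m i / (1 - m i) : ℝ) : ℂ) * (ρ * (X * creat i)).trace := by
    intro i X
    rw [← mul_assoc, productState_mul_creat (fun i => (hm i).2), smul_mul_assoc,
      Matrix.trace_smul, smul_eq_mul, mul_assoc, Matrix.trace_mul_comm (creat i), mul_assoc]
  have ha : ∀ i (X : Op L), (ρ * (annih i * X)).trace =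
      ((m i / (1 - m i) : ℝ) : ℂ)⁻¹ * (ρ * (X * annih i)).trace := by
    intro i X
    rw [← mul_assoc, productState_mul_annih hm, smul_mul_assoc, Matrix.trace_smul, smul_eq_mul,
      mul_assoc, Matrix.trace_mul_comm (annih i), mul_assoc]
  have hca : ∀ i j, (ρ * (creat i * annih j)).trace = if i = j then (m i : ℂ) else 0 := by
    intro i j
    have h1 := hc i (annih j)
    have h2 : annih j * creat i = (if j = i then (1 : ℂ) else 0) • 1 - (creat i * annih j : Op L) :=
      eq_sub_of_add_eq (annih_creat_anticomm j i)
    rw [h2, mul_sub, Matrix.trace_sub, mul_smul_comm, mul_one, Matrix.trace_smul,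
      trace_productState] at h1
    have h3 : (1 - m i : ℂ) ≠ 0 := by exact_mod_cast sub_ne_zero.mpr (hm i).2.ne'
    push_cast at h1
    field_simp at h1
    by_cases hij : i = j
    · subst hij
      simp only [if_true, smul_eq_mul, mul_one] at h1 ⊢
      linear_combination h1
    · simp only [hij, Ne.symm hij, if_false, smul_eq_mul, zero_mul] at h1 ⊢
      linear_combination h1
  refine ⟨fun i j => ?_, fun i j => ?_, hca, fun i j => ?_⟩
  · have h1 := ha i (annih j)
    have h2 : annih j * annih i = -(annih i * annih j : Op L) :=
      eq_neg_of_add_eq_zero_left (annih_anticomm j i)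
    rw [h2, mul_neg, Matrix.trace_neg] at h1
    have h3 : (1 + ((m i / (1 - m i) : ℝ) : ℂ)⁻¹) ≠ 0 := by
      rw [← Complex.ofReal_inv]
      exact_mod_cast (add_pos one_pos (inv_pos.mpr (hr i))).ne'
    have h4 : (1 + ((m i / (1 - m i) : ℝ) : ℂ)⁻¹) * (ρ * (annih i * annih j)).trace = 0 := by
      linear_combination h1
    exact (mul_eq_zero.mp h4).resolve_left h3
  · have h1 := hc i (creat j)
    have h2 : creat j * creat i = -(creat i * creat j : Op L) :=
      eq_neg_of_add_eq_zero_left (creat_anticomm j i)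
    rw [h2, mul_neg, Matrix.trace_neg] at h1
    have h3 : (1 + ((m i / (1 - m i) : ℝ) : ℂ)) ≠ 0 := by
      exact_mod_cast (add_pos one_pos (hr i)).ne'
    have h4 : (1 + ((m i / (1 - m i) : ℝ) : ℂ)) * (ρ * (creat i * creat j)).trace = 0 := by
      linear_combination h1
    exact (mul_eq_zero.mp h4).resolve_left h3
  · rw [eq_sub_of_add_eq (annih_creat_anticomm i j), mul_sub, Matrix.trace_sub, hca,
      mul_smul_comm, mul_one, Matrix.trace_smul, trace_productState]
    by_cases hij : i = j
    · subst hij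
      simp
    · simp [hij, Ne.symm hij]

end ProductState

/-! ### Diagonalization of the two-point function -/

/-- On real vectors the form is Hermitian because `σ` is, and its symmetric part is fixed by the
anticommutation relations. So the real part is the inner product and the imaginary part is
antisymmetric. -/
theorem trace_mul_majLin_cplx {L : ℕ} {σ : Op L} (hσ : σ.PosSemidef) (hσ1 : σ.trace = 1) :
    ∃ A : EuclideanSpace ℝ (Fin L ⊕ Fin L) →ₗ[ℝ] EuclideanSpace ℝ (Fin L ⊕ Fin L),
      (∀ x y, inner ℝ (A x) y = -inner ℝ x (A y)) ∧
      ∀ x y, (σ * (majLin (cplx x) * majLin (cplx y))).trace =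
        ((inner ℝ x y : ℝ) : ℂ) + Complex.I * ((inner ℝ x (A y) : ℝ) : ℂ) := by
  set M : EuclideanSpace ℝ (Fin L ⊕ Fin L) → EuclideanSpace ℝ (Fin L ⊕ Fin L) → ℂ :=
    fun x y => (σ * (majLin (cplx x) * majLin (cplx y))).trace with hM
  have hstar : ∀ x y, star (M x y) = M y x := by
    intro x y
    rw [hM]
    dsimp only
    rw [← Matrix.trace_conjTranspose, Matrix.conjTranspose_mul, Matrix.conjTranspose_mul,
      conjTranspose_majLin, conjTranspose_majLin, star_cplx, star_cplx, hσ.isHermitian.eq,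
      Matrix.trace_mul_comm]
  have hsum : ∀ x y, M x y + M y x = 2 * ((inner ℝ x y : ℝ) : ℂ) := by
    intro x y
    rw [hM]
    dsimp only
    rw [← Matrix.trace_add, ← mul_add, majLin_anticomm, cplx_dotProduct, mul_smul_comm, mul_one,
      Matrix.trace_smul, hσ1, smul_eq_mul, mul_one]
  have hre : ∀ x y, (M x y).re = inner ℝ x y := by
    intro x y
    have h := congrArg Complex.re (hsum x y)
    rw [← hstar x y] at h
    simp at h
    linarith
  set Γ : Matrix (Fin L ⊕ Fin L) (Fin L ⊕ Fin L) ℝ :=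
    Matrix.of fun k l => ((σ * (majorana k * majorana l)).trace).im with hΓ
  have him : ∀ x y, (M x y).im = inner ℝ x (Matrix.toEuclideanLin Γ y) := by
    intro x y
    have h1 : M x y = ∑ k, ∑ l, (x k : ℂ) * ((y l : ℂ) * (σ * (majorana k * majorana l)).trace) := by
      rw [hM]
      dsimp only
      rw [majLin_apply, majLin_apply, Finset.sum_mul_sum]
      simp only [Finset.mul_sum, Matrix.trace_sum,
        smul_mul_assoc, mul_smul_comm, Matrix.trace_smul, smul_eq_mul, cplx, mul_left_comm]
    rw [h1, PiLp.inner_apply, Complex.im_sum]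
    refine Finset.sum_congr rfl fun k _ => ?_
    rw [Matrix.ofLp_toLpLin, Matrix.toLin'_apply, Complex.im_sum, Matrix.mulVec, dotProduct,
      RCLike.inner_apply, Finset.sum_mul]
    refine Finset.sum_congr rfl fun l _ => ?_
    rw [hΓ, Complex.im_ofReal_mul, Complex.im_ofReal_mul]
    simp
    ring
  refine ⟨Matrix.toEuclideanLin Γ, fun x y => ?_, fun x y => ?_⟩
  · rw [real_inner_comm, ← him, ← him, ← hstar x y]
    simp
  · change M x y = _
    rw [← hre, ← him, mul_comm]
    exact (Complex.re_add_im _).symm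

theorem exists_sorting {L : ℕ} (p : Fin L → Prop) :
    ∃ (a c : ℕ) (h : a + c = L) (e : Equiv.Perm (Fin L)),
      (∀ i, p (e (modeA h i))) ∧ ∀ i, ¬p (e (modeC h i)) := by
  classical
  have h : Fintype.card {i // p i} + Fintype.card {i // ¬p i} = L := by
    rw [← Fintype.card_sum, Fintype.card_congr (Equiv.sumCompl p), Fintype.card_fin]
  refine ⟨_, _, h, (finCongr h.symm).trans (finSumFinEquiv.symm.trans
    ((Equiv.sumCongr (Fintype.equivFin _).symm (Fintype.equivFin _).symm).trans
      (Equiv.sumCompl p))), fun i => ?_, fun i => ?_⟩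
  · have : (finCongr h.symm) (modeA h i) = Fin.castAdd _ i := by
      ext
      simp [modeA]
    simp only [Equiv.trans_apply, this, finSumFinEquiv_symm_apply_castAdd, Equiv.sumCongr_apply,
      Sum.map_inl, Equiv.sumCompl_apply_inl]
    exact Subtype.property _
  · have : (finCongr h.symm) (modeC h i) = Fin.natAdd _ i := by
      ext
      simp [modeC]
    simp only [Equiv.trans_apply, this, finSumFinEquiv_symm_apply_natAdd, Equiv.sumCongr_apply,
      Sum.map_inr, Equiv.sumCompl_apply_inr]
    exact ((Fintype.equivFin {i // ¬p i}).symm i).2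

theorem annih_eq_majorana {L : ℕ} (i : Fin L) : (annih i : Op L) =
    (1 / 2 : ℂ) • majorana (Sum.inl i) + (Complex.I / 2) • majorana (Sum.inr i) := by
  rw [annih_eq_majLin, map_add, map_smul, map_smul, majLin_single, majLin_single]

theorem creat_eq_majorana {L : ℕ} (i : Fin L) : (creat i : Op L) =
    (1 / 2 : ℂ) • majorana (Sum.inl i) - (Complex.I / 2) • majorana (Sum.inr i) := by
  rw [creat_eq_majLin, map_sub, map_smul, map_smul, majLin_single, majLin_single]

/-- The value `(1 - μ)/2` comes from `c_i^* c_i = ½(1 + iγ_iγ_{i+L})`. -/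
theorem hasOccupation_of_majorana {L : ℕ} {σ : Op L} {μ : Fin L → ℝ}
    (hll : ∀ i j, (σ * (majorana (Sum.inl i) * majorana (Sum.inl j))).trace =
      if i = j then 1 else 0)
    (hrr : ∀ i j, (σ * (majorana (Sum.inr i) * majorana (Sum.inr j))).trace =
      if i = j then 1 else 0)
    (hlr : ∀ i j, (σ * (majorana (Sum.inl i) * majorana (Sum.inr j))).trace =
      if i = j then Complex.I * (μ i : ℂ) else 0)
    (hrl : ∀ i j, (σ * (majorana (Sum.inr i) * majorana (Sum.inl j))).trace =
      if i = j then -(Complex.I * (μ i : ℂ)) else 0) :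
    HasOccupation σ fun i => (1 - μ i) / 2 := by
  have hI := Complex.I_mul_I
  constructor <;> intro i j <;>
    simp only [annih_eq_majorana, creat_eq_majorana, mul_add, add_mul, mul_sub, sub_mul,
      smul_mul_assoc, mul_smul_comm, Matrix.trace_add, Matrix.trace_sub, Matrix.trace_smul,
      hll, hrr, hlr, hrl, smul_eq_mul] <;>
    by_cases hij : i = j <;> simp only [hij, if_true, if_false, mul_zero, add_zero, sub_zero] <;>
    push_cast
  · linear_combination (1 / 4 : ℂ) * hI
  · linear_combination (1 / 4 : ℂ) * hI
  · linear_combination (-1 / 4 + (μ j : ℂ) / 2) * hI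
  · linear_combination (-1 / 4 - (μ j : ℂ) / 2) * hI

/-- The two-point function of a state is diagonalized by a Bogoliubov transform, the empty modes
coming first. -/
theorem exists_diagonalization {L : ℕ} {σ : Op L} (hσ : σ.PosSemidef) (hσ1 : σ.trace = 1) :
    ∃ (O : Matrix (Fin L ⊕ Fin L) (Fin L ⊕ Fin L) ℝ) (V : Op L) (a c : ℕ) (h : a + c = L)
      (m : Fin L → ℝ), Oᵀ * O = 1 ∧ V * Vᴴ = 1 ∧
      (∀ x, V * majLin x * Vᴴ = majLin (O.map Complex.ofReal *ᵥ x)) ∧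
      (V * parity L = parity L * V ∨ V * parity L = -(parity L * V)) ∧
      HasOccupation (V * σ * Vᴴ) m ∧ (∀ i, m (modeA h i) = 0) ∧
      ∀ i, 0 < m (modeC h i) ∧ m (modeC h i) < 1 := by
  obtain ⟨A, hA, hcov⟩ := trace_mul_majLin_cplx hσ hσ1
  obtain ⟨μ, g, k, hμ, -, -, hg, hk, hgk, hAg, hAk⟩ :=
    exists_skew_normal_form A hA L ⊤ (by simp; ring) (fun _ _ => trivial)
  -- A mode with occupation `(1 - μ)/2` is empty exactly when `μ = 1`; these modes are placed first.
  obtain ⟨a, c, h, e, he, he'⟩ := exists_sorting fun i => μ i = 1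
  have hf : Orthonormal ℝ (Sum.elim (g ∘ e) (k ∘ e)) := by
    constructor
    · rintro (i | i)
      · exact hg.1 _
      · exact hk.1 _
    · rintro (i | i) (j | j) hij
      · exact hg.2 fun h => hij (by rw [e.injective h])
      · exact hgk _ _
      · change inner ℝ (k (e i)) (g (e j)) = 0
        rw [real_inner_comm]
        exact hgk _ _
      · exact hk.2 fun h => hij (by rw [e.injective h])
  obtain ⟨b, hb⟩ := Orthonormal.exists_orthonormalBasis_extension_of_card_eq (s := Set.univ)
    (v := Sum.elim (g ∘ e) (k ∘ e)) (by simp) (hf.comp _ Subtype.val_injective)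
  have hbg : ∀ i, b (Sum.inl i) = g (e i) := fun i => hb _ trivial
  have hbk : ∀ i, b (Sum.inr i) = k (e i) := fun i => hb _ trivial
  -- The isometry sends `b i` to the standard basis vector `i`, so its matrix has the vectors `b i`
  -- as rows.
  obtain ⟨V, hV, hVx, hVP⟩ := exists_implementer b.repr
  have hV' : Vᴴ * V = 1 := mul_eq_one_comm.mp hV
  set O : Matrix (Fin L ⊕ Fin L) (Fin L ⊕ Fin L) ℝ := Matrix.of fun i j => b i j with hO
  have hOO : O * Oᵀ = 1 := by
    ext i j
    have h1 := orthonormal_iff_ite.mp b.orthonormal i j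
    rw [Matrix.mul_apply, Matrix.one_apply, ← h1, PiLp.inner_apply]
    refine Finset.sum_congr rfl fun l _ => ?_
    simp [hO, mul_comm]
  have hVmaj : ∀ i, V * majLin (cplx (b i)) * Vᴴ = majorana i := by
    intro i
    rw [hVx, b.repr_self, ← majLin_single]
    congr 1
    funext j
    simp [cplx, Pi.single_apply, apply_ite]
  have hcov' : ∀ i j, (V * σ * Vᴴ * (majorana i * majorana j)).trace =
      ((inner ℝ (b i) (b j) : ℝ) : ℂ) + Complex.I * ((inner ℝ (b i) (A (b j)) : ℝ) : ℂ) := by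
    intro i j
    rw [← hcov, ← hVmaj i, ← hVmaj j]
    calc (V * σ * Vᴴ * (V * majLin (cplx (b i)) * Vᴴ * (V * majLin (cplx (b j)) * Vᴴ))).trace
        = (V * (σ * (Vᴴ * V) * majLin (cplx (b i)) * (Vᴴ * V) * majLin (cplx (b j))) *
            Vᴴ).trace := by simp only [mul_assoc]
      _ = _ := by
          rw [hV', mul_one, mul_one, Matrix.trace_mul_comm, ← mul_assoc, hV', one_mul, mul_assoc]
  have hgi : ∀ i j, (inner ℝ (g (e i)) (g (e j)) : ℝ) = if i = j then 1 else 0 := fun i j => by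
    simp [orthonormal_iff_ite.mp hg]
  have hki : ∀ i j, (inner ℝ (k (e i)) (k (e j)) : ℝ) = if i = j then 1 else 0 := fun i j => by
    simp [orthonormal_iff_ite.mp hk]
  have hkg : ∀ i j, (inner ℝ (k i) (g j) : ℝ) = 0 := fun i j => by
    rw [real_inner_comm, hgk]
  have hocc : HasOccupation (V * σ * Vᴴ) fun i => (1 - μ (e i)) / 2 := by
    refine hasOccupation_of_majorana (fun i j => ?_) (fun i j => ?_) (fun i j => ?_)
      (fun i j => ?_)
    · rw [hcov', hbg, hbg, hAg, inner_neg_right, inner_smul_right, hgk, hgi]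
      by_cases hij : i = j <;> simp [hij]
    · rw [hcov', hbk, hbk, hAk, inner_smul_right, hkg, hki]
      by_cases hij : i = j <;> simp [hij]
    · rw [hcov', hbg, hbk, hAk, inner_smul_right, hgk, hgi]
      by_cases hij : i = j <;> simp [hij]
    · rw [hcov', hbk, hbg, hAg, inner_neg_right, inner_smul_right, hkg, hki]
      by_cases hij : i = j <;> simp [hij]
  refine ⟨O, V, a, c, h, _, mul_eq_one_comm.mp hOO, hV, fun x => ?_, hVP, hocc, fun i => ?_,
    fun i => ?_⟩
  · have h1 : (LinearMap.mulRight ℂ Vᴴ ∘ₗ LinearMap.mulLeft ℂ V ∘ₗ majLin) =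
        majLin ∘ₗ (O.map Complex.ofReal).mulVecLin := by
      refine LinearMap.pi_ext' fun j => LinearMap.ext_ring ?_
      have h2 := hVx (EuclideanSpace.single j 1)
      have h3 : cplx (EuclideanSpace.single j (1 : ℝ)) = Pi.single j 1 := by
        funext i
        simp [cplx, Pi.single_apply, apply_ite]
      rw [h3] at h2
      simp only [LinearMap.comp_apply, LinearMap.mulLeft_apply, LinearMap.mulRight_apply,
        LinearMap.single_apply, Matrix.mulVecLin_apply]
      rw [h2]
      congr 1
      funext i
      simp [cplx, b.repr_apply_apply, hO, EuclideanSpace.inner_single_right]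
    exact LinearMap.congr_fun h1 x
  · simp [he]
  -- Positivity of the state gives `μ ≤ 1`, strict for these modes. Since `μ ≥ 0`, the occupation is
  -- at most `1/2`, so it lies strictly between `0` and `1`.
  · have h1 := hocc.nonneg (hσ.mul_mul_conjTranspose_same V) (modeC h i)
    have h2 := hμ (e (modeC h i))
    have h3 : μ (e (modeC h i)) ≠ 1 := he' i
    have h4 : μ (e (modeC h i)) < 1 := lt_of_le_of_ne (by linarith) h3
    exact ⟨by linarith, by linarith⟩

/-! ### Covariance under Bogoliubov transforms -/

theorem implements_bogoliubovOf {L : ℕ} {O : Matrix (Fin L ⊕ Fin L) (Fin L ⊕ Fin L) ℝ} {V : Op L}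
    (hV : V * Vᴴ = 1)
    (hVO : ∀ x, V * majLin x * Vᴴ = majLin (O.map Complex.ofReal *ᵥ x)) :
    Implements V (bogoliubovOf O) := by
  refine ⟨Matrix.mem_unitaryGroup_iff.mpr hV, fun y => ?_⟩
  rw [field_eq_majLin, field_eq_majLin, hVO, Matrix.mulVec_mulVec, majoranaBasis_mul_bogoliubovOf,
    Matrix.mulVec_mulVec]

theorem conj_quadHam {L : ℕ} {O : Matrix (Fin L ⊕ Fin L) (Fin L ⊕ Fin L) ℝ} {V : Op L}
    (hV : Vᴴ * V = 1)
    (hVO : ∀ x, V * majLin x * Vᴴ = majLin (O.map Complex.ofReal *ᵥ x))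
    (R : Matrix (Fin L ⊕ Fin L) (Fin L ⊕ Fin L) ℝ) :
    V * quadHam R * Vᴴ = quadHam (O * R * Oᵀ) := by
  have hm : ∀ i, V * majorana i * Vᴴ = ∑ k, (O k i : ℂ) • majorana k := by
    intro i
    rw [← majLin_single, hVO, majLin_apply]
    refine Finset.sum_congr rfl fun k _ => ?_
    simp
  have hmm : ∀ i j, V * (majorana i * majorana j) * Vᴴ =
      ∑ k, ∑ l, ((O k i : ℂ) * (O l j : ℂ)) • (majorana k * majorana l) := by
    intro i j
    calc V * (majorana i * majorana j) * Vᴴ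
        = (V * majorana i * (Vᴴ * V)) * majorana j * Vᴴ := by
          rw [hV, mul_one]
          simp only [mul_assoc]
      _ = (V * majorana i * Vᴴ) * (V * majorana j * Vᴴ) := by simp only [mul_assoc]
      _ = _ := by
          rw [hm, hm, Finset.sum_mul_sum]
          simp only [smul_mul_smul_comm]
  rw [quadHam, quadHam, mul_smul_comm, smul_mul_assoc]
  congr 1
  simp only [Finset.mul_sum, Finset.sum_mul, mul_smul_comm, smul_mul_assoc, hmm, Finset.smul_sum,
    smul_smul]
  calc ∑ i, ∑ j, ∑ k, ∑ l, (Complex.I * (R i j : ℂ) * ((O k i : ℂ) * (O l j : ℂ))) •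
          (majorana k * majorana l : Op L)
      = ∑ i, ∑ k, ∑ l, ∑ j, (Complex.I * (R i j : ℂ) * ((O k i : ℂ) * (O l j : ℂ))) •
          (majorana k * majorana l : Op L) := by
        refine Finset.sum_congr rfl fun i _ => ?_
        rw [Finset.sum_comm]
        exact Finset.sum_congr rfl fun k _ => Finset.sum_comm
    _ = ∑ k, ∑ l, ∑ j, ∑ i, (Complex.I * (R i j : ℂ) * ((O k i : ℂ) * (O l j : ℂ))) •
          (majorana k * majorana l : Op L) := by
        rw [Finset.sum_comm]
        refine Finset.sum_congr rfl fun k _ => ?_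
        rw [Finset.sum_comm]
        exact Finset.sum_congr rfl fun l _ => Finset.sum_comm
    _ = _ := by
        refine Finset.sum_congr rfl fun k _ => Finset.sum_congr rfl fun l _ => ?_
        simp only [← Finset.sum_smul]
        congr 1
        simp only [Matrix.mul_apply, Matrix.transpose_apply, Complex.ofReal_sum,
          Complex.ofReal_mul, Finset.mul_sum, Finset.sum_mul]
        refine Finset.sum_congr rfl fun j _ => Finset.sum_congr rfl fun i _ => ?_
        ring

/-- Commutation of `V` with `Q` up to a sign suffices, because `Q` stands on both sides of the
state. Implementers of reflections do anticommute with the parity. -/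
theorem conj_lindblad {n α : Type} [Fintype n] [DecidableEq n] [Fintype α] {V : Matrix n n ℂ}
    (hV : V * Vᴴ = 1) (H : Matrix n n ℂ) (l : α → Matrix n n ℂ) {Q : Matrix n n ℂ}
    (hQ : V * Q = Q * V ∨ V * Q = -(Q * V)) (X : Matrix n n ℂ) :
    V * lindblad H l Q (Vᴴ * X * V) * Vᴴ =
      lindblad (V * H * Vᴴ) (fun b => V * l b * Vᴴ) Q X := by
  have hV' : Vᴴ * V = 1 := mul_eq_one_comm.mp hV
  have hG : V * effHam H l * Vᴴ = effHam (V * H * Vᴴ) (fun b => V * l b * Vᴴ) := by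
    have h1 : ∀ b, (V * l b * Vᴴ)ᴴ * (V * l b * Vᴴ) = V * ((l b)ᴴ * l b) * Vᴴ := by
      intro b
      calc (V * l b * Vᴴ)ᴴ * (V * l b * Vᴴ) = V * (l b)ᴴ * (Vᴴ * V) * l b * Vᴴ := by
            simp only [Matrix.conjTranspose_mul, Matrix.conjTranspose_conjTranspose, mul_assoc]
        _ = _ := by
            rw [hV', mul_one]
            simp only [mul_assoc]
    simp only [effHam, h1, mul_sub, sub_mul, mul_neg, neg_mul, mul_smul_comm, smul_mul_assoc,
      Finset.mul_sum, Finset.sum_mul]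
  have hG' : V * (effHam H l)ᴴ * Vᴴ =
      (effHam (V * H * Vᴴ) (fun b => V * l b * Vᴴ))ᴴ := by
    rw [← hG]
    simp only [Matrix.conjTranspose_mul, Matrix.conjTranspose_conjTranspose, mul_assoc]
  have hQX : V * (Q * (Vᴴ * X * V) * Q) * Vᴴ = Q * X * Q := by
    have h2 : V * Q * Vᴴ = Q ∨ V * Q * Vᴴ = -Q := by
      rcases hQ with h | h
      · left
        rw [h, mul_assoc, hV, mul_one]
      · right
        rw [h, neg_mul, mul_assoc, hV, mul_one]
    calc V * (Q * (Vᴴ * X * V) * Q) * Vᴴ = (V * Q * Vᴴ) * X * (V * Q * Vᴴ) := by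
          simp only [mul_assoc]
      _ = Q * X * Q := by
          rcases h2 with h | h <;> simp [h]
  have hterm : ∀ b, V * (l b * (Q * (Vᴴ * X * V) * Q) * (l b)ᴴ) * Vᴴ =
      V * l b * Vᴴ * (Q * X * Q) * (V * l b * Vᴴ)ᴴ := by
    intro b
    rw [← hQX]
    calc V * (l b * (Q * (Vᴴ * X * V) * Q) * (l b)ᴴ) * Vᴴ
        = V * l b * 1 * (Q * (Vᴴ * X * V) * Q) * 1 * (l b)ᴴ * Vᴴ := by
          simp only [mul_one, mul_assoc]
      _ = V * l b * (Vᴴ * V) * (Q * (Vᴴ * X * V) * Q) * (Vᴴ * V) * (l b)ᴴ * Vᴴ := by rw [hV']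
      _ = _ := by
          simp only [Matrix.conjTranspose_mul, Matrix.conjTranspose_conjTranspose, mul_assoc]
  rw [lindblad_apply, lindblad_apply, mul_add, mul_add, add_mul, add_mul, ← hG', ← hG,
    Finset.mul_sum, Finset.sum_mul, Finset.sum_congr rfl fun b _ => hterm b]
  congr 2
  · calc V * (effHam H l * (Vᴴ * X * V)) * Vᴴ = V * effHam H l * Vᴴ * X * (V * Vᴴ) := by
          simp only [mul_assoc]
      _ = _ := by rw [hV, mul_one]
  · calc V * (Vᴴ * X * V * (effHam H l)ᴴ) * Vᴴ = (V * Vᴴ) * X * (V * (effHam H l)ᴴ * Vᴴ) := by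
          simp only [mul_assoc]
      _ = _ := by rw [hV, one_mul]

theorem mulVec_jumpCoeff {L K : ℕ} (O : Matrix (Fin L ⊕ Fin L) (Fin L ⊕ Fin L) ℝ) (D : Op K)
    (W : Matrix (Fin L ⊕ Fin L) (Fin K ⊕ Fin K) ℝ) (b : Occ K × Occ K) :
    O.map Complex.ofReal *ᵥ jumpCoeff D W b = jumpCoeff D (O * W) b := by
  funext k
  simp only [Matrix.mulVec, dotProduct, jumpCoeff, Matrix.mul_apply, Matrix.map_apply,
    Complex.ofReal_sum, Complex.ofReal_mul, Finset.mul_sum]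
  rw [Finset.sum_comm]
  refine Finset.sum_congr rfl fun j _ => Finset.sum_congr rfl fun i _ => ?_
  ring

theorem transpose_conj_eq_neg {ι : Type} [Fintype ι] (O : Matrix ι ι ℝ) {R : Matrix ι ι ℝ}
    (hR : Rᵀ = -R) : (O * R * Oᵀ)ᵀ = -(O * R * Oᵀ) := by
  rw [Matrix.transpose_mul, Matrix.transpose_mul, Matrix.transpose_transpose, hR, Matrix.neg_mul,
    Matrix.mul_neg, Matrix.mul_assoc]

/-! ### Restriction of a process to a subset of the system modes -/

/-- The process obtained by the orthogonal transformation `O` of the system and restriction to its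
last `c` modes. -/
def RepeatedInteraction.restrict {L K a c : ℕ} (p : RepeatedInteraction L K) (h : a + c = L)
    (O : Matrix (Fin L ⊕ Fin L) (Fin L ⊕ Fin L) ℝ) : RepeatedInteraction c K where
  RS := (O * p.RS * Oᵀ).submatrix (Sum.map (modeC h) (modeC h)) (Sum.map (modeC h) (modeC h))
  RB := p.RB
  W := (O * p.W).submatrix (Sum.map (modeC h) (modeC h)) id
  ω := p.ω
  antisymm_RS := by
    rw [Matrix.transpose_submatrix, transpose_conj_eq_neg O p.antisymm_RS]
    rfl
  antisymm_RB := p.antisymm_RB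
  quasiFree := p.quasiFree

/-- The Lindblad generator of the continuous-time limit, for the bath state `D D^*`. -/
def RepeatedInteraction.generator {L K : ℕ} (p : RepeatedInteraction L K) (E : TensorIso)
    (D : Op K) : Op L →ₗ[ℂ] Op L :=
  lindblad (quadHam p.RS) (fun b => majLin (jumpCoeff D p.W b)) (twist E L)

theorem IsState.conj {n : Type} [Fintype n] [DecidableEq n] {V ρ : Matrix n n ℂ}
    (hV : V * Vᴴ = 1) (hρ : IsState ρ) : IsState (V * ρ * Vᴴ) := by
  refine ⟨hρ.1.mul_mul_conjTranspose_same V, ?_⟩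
  rw [Matrix.trace_mul_comm, ← mul_assoc, mul_eq_one_comm.mp hV, one_mul, hρ.2]

theorem IsState.vacMat_conj {L a c : ℕ} (h : a + c = L) {ρ : Op c} (hρ : IsState ρ) :
    IsState (vacMat h * ρ * (vacMat h)ᴴ) := by
  refine ⟨hρ.1.mul_mul_conjTranspose_same _, ?_⟩
  rw [Matrix.trace_mul_comm, ← Matrix.mul_assoc, conjTranspose_vacMat_mul_vacMat, Matrix.one_mul,
    hρ.2]

theorem twist_comm_of_parity_comm {L : ℕ} {V : Op L}
    (hV : V * parity L = parity L * V ∨ V * parity L = -(parity L * V)) (E : TensorIso) :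
    V * twist E L = twist E L * V ∨ V * twist E L = -(twist E L * V) := by
  cases E
  · exact hV
  · left
    simp [twist]

/-- The restriction of a process to the non-empty modes of a stationary state. -/
theorem RepeatedInteraction.exists_restriction {L K : ℕ} (p : RepeatedInteraction L K)
    (E : TensorIso) (D : Op K) {σ : Op L} (hσ : IsState σ) (hst : p.generator E D σ = 0) :
    ∃ (O : Matrix (Fin L ⊕ Fin L) (Fin L ⊕ Fin L) ℝ) (V : Op L) (a c : ℕ) (h : a + c = L)
      (ρ : Op c), Oᵀ * O = 1 ∧ V * Vᴴ = 1 ∧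
      (∀ x, V * majLin x * Vᴴ = majLin (O.map Complex.ofReal *ᵥ x)) ∧
      (∀ X : Op c, V * p.generator E D (Vᴴ * (vacMat h * X * (vacMat h)ᴴ) * V) * Vᴴ =
        vacMat h * (p.restrict h O).generator E D X * (vacMat h)ᴴ) ∧
      vacMat h * ((vacMat h)ᴴ * (V * σ * Vᴴ)) = V * σ * Vᴴ ∧
      ρ.PosDef ∧ ρ.trace = 1 ∧ (p.restrict h O).generator E D ρ = 0 := by
  obtain ⟨O, V, a, c, h, m, hO, hV, hVO, hVP, hocc, hA, hC⟩ := exists_diagonalization hσ.1 hσ.2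
  have hV' : Vᴴ * V = 1 := mul_eq_one_comm.mp hV
  set σ' : Op L := V * σ * Vᴴ with hσ'def
  have hσ' : IsState σ' := hσ.conj hV
  have hrot : ∀ X, V * p.generator E D (Vᴴ * X * V) * Vᴴ =
      lindblad (quadHam (O * p.RS * Oᵀ)) (fun b => majLin (jumpCoeff D (O * p.W) b))
        (twist E L) X := by
    intro X
    rw [RepeatedInteraction.generator, conj_lindblad hV _ _ (twist_comm_of_parity_comm hVP E),
      conj_quadHam hV' hVO]
    simp only [hVO, mulVec_jumpCoeff]
  have hst' : lindblad (quadHam (O * p.RS * Oᵀ)) (fun b => majLin (jumpCoeff D (O * p.W) b))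
      (twist E L) σ' = 0 := by
    have h1 : Vᴴ * σ' * V = σ := by
      calc Vᴴ * σ' * V = (Vᴴ * V) * σ * (Vᴴ * V) := by simp only [hσ'def, mul_assoc]
        _ = σ := by rw [hV', one_mul, mul_one]
    rw [← hrot, h1, hst, mul_zero, zero_mul]
  have hσ0 : σ' ≠ 0 := by
    intro h0
    have h1 := hσ'.2
    rw [h0, Matrix.trace_zero] at h1
    exact zero_ne_one h1
  have hAσ : ∀ i, annih (modeA h i) * σ' = 0 := fun i => hocc.annih_mul_eq_zero hσ'.1 (hA i)
  have hrestr : ∀ X : Op c, lindblad (quadHam (O * p.RS * Oᵀ))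
      (fun b => majLin (jumpCoeff D (O * p.W) b)) (twist E L) (vacMat h * X * (vacMat h)ᴴ) =
        vacMat h * (p.restrict h O).generator E D X * (vacMat h)ᴴ := fun X =>
    lindblad_vacMat h (transpose_conj_eq_neg O p.antisymm_RS) hσ'.1 hσ0 hst' hAσ
      (fun x hx => hocc.majLin_mul_vacMat h hA hC hx) X
  have hT : vacMat h * ((vacMat h)ᴴ * σ') = σ' := vacMat_mul_conjTranspose_mul h hAσ
  -- The rotated state lives on `Ω_A ⊗ Γ(ℂ^c)`. Its compression `σC` is stationary but not known to
  -- be faithful; it only supplies the two-point function for the product state.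
  set σC : Op c := (vacMat h)ᴴ * σ' * vacMat h with hσC
  have hσ'C : σ' = vacMat h * σC * (vacMat h)ᴴ := by
    have h1 := congrArg Matrix.conjTranspose hT
    rw [Matrix.conjTranspose_mul, Matrix.conjTranspose_mul, Matrix.conjTranspose_conjTranspose,
      hσ'.1.isHermitian.eq] at h1
    calc σ' = vacMat h * ((vacMat h)ᴴ * σ') := hT.symm
      _ = vacMat h * ((vacMat h)ᴴ * (σ' * vacMat h * (vacMat h)ᴴ)) := by rw [h1]
      _ = _ := by simp only [hσC, Matrix.mul_assoc]
  have hTT := conjTranspose_vacMat_mul_vacMat h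
  have hσC0 : (p.restrict h O).generator E D σC = 0 := by
    have h1 := hrestr σC
    rw [← hσ'C, hst'] at h1
    calc (p.restrict h O).generator E D σC
        = (vacMat h)ᴴ * vacMat h * (p.restrict h O).generator E D σC *
            ((vacMat h)ᴴ * vacMat h) := by rw [hTT, Matrix.one_mul, Matrix.mul_one]
      _ = (vacMat h)ᴴ * (vacMat h * (p.restrict h O).generator E D σC * (vacMat h)ᴴ) *
            vacMat h := by simp only [Matrix.mul_assoc]
      _ = 0 := by rw [← h1, Matrix.mul_zero, Matrix.zero_mul]
  have hσC1 : σC.trace = 1 := by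
    rw [hσC, Matrix.mul_assoc, Matrix.trace_mul_comm, Matrix.mul_assoc, Matrix.trace_mul_comm,
      Matrix.mul_assoc, hT, hσ'.2]
  have hoccC := hocc.restrict h hσ'C
  have hρocc := hasOccupation_productState hC
  refine ⟨O, V, a, c, h, productState fun i => m (modeC h i), hO, hV, hVO,
    fun X => (hrot _).trans (hrestr X), hT, posDef_productState hC, trace_productState _, ?_⟩
  exact lindblad_eq_zero_of_exchange (quadHam_mem_quadSpan _)
    (isHermitian_quadHam (p.restrict h O).antisymm_RS) _ E hσC0 (posDef_productState hC)
    (twist_mul_productState E _) (productState_exchange hC)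
    fun X hX => hoccC.trace_eq hρocc (hσC1.trans (trace_productState _).symm) hX

/-- The support of `σ` is that of a faithful state on `Ω_A ⊗ Γ(ℂ^c)`, up to a unitary. -/
theorem map_supp_eq_range_vacTensor {L a c : ℕ} (h : a + c = L) {V σ : Op L} (hV : V * Vᴴ = 1)
    (hT : vacMat h * ((vacMat h)ᴴ * (V * σ * Vᴴ)) = V * σ * Vᴴ) {ρ : Op c} (hρ : ρ.PosDef)
    (hsupp : supp (Vᴴ * (vacMat h * ρ * (vacMat h)ᴴ) * V) ≤ supp σ) :
    Submodule.map V.mulVecLin (supp σ) = LinearMap.range (vacTensor h) := by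
  have hV' : Vᴴ * V = 1 := mul_eq_one_comm.mp hV
  rw [vacTensor_eq]
  refine le_antisymm ?_ ?_
  -- By `hT` the range of `VσV^*` lies in that of `vacMat h`.
  · rintro _ ⟨_, ⟨ψ, rfl⟩, rfl⟩
    refine ⟨((vacMat h)ᴴ * (V * σ * Vᴴ) * V) *ᵥ ψ, ?_⟩
    simp only [Matrix.mulVecLin_apply, Matrix.mulVec_mulVec]
    rw [← Matrix.mul_assoc, hT, mul_assoc, hV', mul_one]
  · rintro _ ⟨ψ, rfl⟩
    -- A preimage under the transported state is obtained by applying it to `V^*(Ω_A ⊗ ρ⁻¹ψ)`,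
    -- faithfulness of `ρ` providing the inverse.
    refine ⟨(Vᴴ * vacMat h) *ᵥ ψ, hsupp ⟨(Vᴴ * vacMat h * ρ⁻¹) *ᵥ ψ, ?_⟩, ?_⟩
    · rw [Matrix.mulVecLin_apply, Matrix.mulVec_mulVec]
      congr 1
      calc Vᴴ * (vacMat h * ρ * (vacMat h)ᴴ) * V * (Vᴴ * vacMat h * ρ⁻¹)
          = Vᴴ * (vacMat h * ρ * ((vacMat h)ᴴ * ((V * Vᴴ) * vacMat h) * ρ⁻¹)) := by
            simp only [Matrix.mul_assoc]
        _ = Vᴴ * vacMat h := by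
            rw [hV, Matrix.one_mul, conjTranspose_vacMat_mul_vacMat, Matrix.one_mul,
              Matrix.mul_assoc, Matrix.mul_nonsing_inv _
                ((Matrix.isUnit_iff_isUnit_det _).mp hρ.isUnit), Matrix.mul_one]
    · rw [Matrix.mulVecLin_apply, Matrix.mulVec_mulVec, ← Matrix.mul_assoc, hV, Matrix.one_mul]
      rfl

end

end Fermion

/-! ### Proof of the proposition -/

theorem mainTheorem2 (L K : ℕ) (E : Fermion.TensorIso) (p : Fermion.RepeatedInteraction L K)
    (Λ : ℝ → Fermion.Op L →ₗ[ℂ] Fermion.Op L) (hΛ : p.IsLimit E Λ)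
    (σ : Fermion.Op L) (hσ : Fermion.IsStationary Λ σ)
    (hmax : ∀ ρ : Fermion.Op L, Fermion.IsStationary Λ ρ → Fermion.supp ρ ≤ Fermion.supp σ) :
    ∃ (U : Matrix (Fin L ⊕ Fin L) (Fin L ⊕ Fin L) ℂ) (V : Fermion.Op L)
      (a c : ℕ) (h : a + c = L),
      Fermion.IsBogoliubov U ∧ Fermion.Implements V U ∧
      Submodule.map V.mulVecLin (Fermion.supp σ) = LinearMap.range (Fermion.vacTensor h) ∧
      ∃ ΛC : ℝ → Fermion.Op c →ₗ[ℂ] Fermion.Op c,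
        (∀ t : ℝ, 0 ≤ t → ∀ ρ : Fermion.Op c,
          V * Λ t (Vᴴ * Fermion.vacTensorOp h ρ * V) * Vᴴ =
            Fermion.vacTensorOp h (ΛC t ρ)) ∧
        ∃ (K' : ℕ) (q : Fermion.RepeatedInteraction c K'), q.IsLimit E ΛC := by
  obtain ⟨B, hB⟩ :=
    Fermion.exists_eq_conjTranspose_mul_self (Fermion.isQuasiFree_spec p.quasiFree).1
  have hD : p.ω = Bᴴ * Bᴴᴴ := by rw [hB, Matrix.conjTranspose_conjTranspose]
  -- Limits are unique, so the given family is the semigroup of the Lindblad generator for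
  -- nonnegative times.
  have hΛt : ∀ t, 0 ≤ t → Λ t = Fermion.semigroup (p.generator E Bᴴ) t := fun t ht =>
    LinearMap.ext fun ρ =>
      tendsto_nhds_unique (hΛ t ht ρ) (p.isLimit_semigroup E hD t ht ρ)
  have hst : p.generator E Bᴴ σ = 0 := Fermion.generator_eq_zero_of_semigroup _ fun t ht => by
    rw [← hΛt t ht, hσ.2 t ht]
  obtain ⟨O, V, a, c, h, ρ, hO, hV, hVO, hrestr, hT, hρ, hρ1, hρ0⟩ :=
    p.exists_restriction E Bᴴ hσ.1 hst
  have hV' : Vᴴ * V = 1 := mul_eq_one_comm.mp hV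
  have hV'' : Vᴴ * Vᴴᴴ = 1 := by rwa [Matrix.conjTranspose_conjTranspose]
  -- `J` embeds operators of the restricted system and intertwines the two generators. It therefore
  -- intertwines the semigroups and sends stationary states to stationary states.
  let J : Fermion.Op c →ₗ[ℂ] Fermion.Op L :=
    { toFun := fun X => Vᴴ * (Fermion.vacMat h * X * (Fermion.vacMat h)ᴴ) * V
      map_add' := fun X Y => by
        simp only [Matrix.mul_add, Matrix.add_mul]
      map_smul' := fun r X => by
        simp only [Matrix.mul_smul, Matrix.smul_mul, RingHom.id_apply] }
  have hJX : ∀ X, J X = Vᴴ * (Fermion.vacMat h * X * (Fermion.vacMat h)ᴴ) * V := fun _ => rfl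
  have hJ : ∀ X, p.generator E Bᴴ (J X) = J ((p.restrict h O).generator E Bᴴ X) := by
    intro X
    rw [hJX ((p.restrict h O).generator E Bᴴ X), ← hrestr X, ← hJX, mul_assoc V,
      ← mul_assoc Vᴴ V, hV', one_mul, mul_assoc, hV', mul_one]
  have hJρ : Fermion.IsStationary Λ (J ρ) := by
    have h1 := Fermion.IsState.conj hV'' (Fermion.IsState.vacMat_conj h ⟨hρ.posSemidef, hρ1⟩)
    rw [Matrix.conjTranspose_conjTranspose] at h1
    refine ⟨h1, fun t ht => ?_⟩
    rw [hΛt t ht]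
    refine Fermion.semigroup_apply_eq_self _ ?_ t
    rw [hJ, hρ0, map_zero]
  -- Maximality enters through `hmax` at the state `J ρ`. The bath is unchanged by the restriction,
  -- so the number of its modes and the factor of its state are kept.
  refine ⟨Fermion.bogoliubovOf O, V, a, c, h, Fermion.isBogoliubov_bogoliubovOf hO,
    Fermion.implements_bogoliubovOf hV hVO,
    Fermion.map_supp_eq_range_vacTensor h hV hT hρ (hmax _ hJρ),
    Fermion.semigroup ((p.restrict h O).generator E Bᴴ), fun t ht X => ?_,
    K, p.restrict h O, (p.restrict h O).isLimit_semigroup E hD⟩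
  rw [Fermion.vacTensorOp_eq, Fermion.vacTensorOp_eq, hΛt t ht]
  rw [← hJX, Fermion.semigroup_apply_comm _ _ J hJ, hJX, mul_assoc Vᴴ, ← mul_assoc V, hV, one_mul, mul_assoc, hV, mul_one]
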